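/- Let $B$ be a quaternion algebra over $\mathbb{Q}$ that is ramified at $\infty$, with conjugation $x\mapsto x^*$, norm $n(x)=xx^*$ and trace $\mathrm{tr}(x)=x+x^*$, and let $B_0$ be a maximal order of $B$. For a field $L\supseteq\mathbb{Q}$ put $B_L=B\otimes_{\mathbb Q}L$ and let $H_3(B_L)$ be the space of Hermitian matrices $$h=\begin{pmatrix}c_1&a_3&a_2^*\\a_3^*&c_2&a_1\\a_2&a_1^*&c_3\end{pmatrix}\qquad(c_i\in L,\ a_i\in B_L),$$ with norm $N(h)=c_1c_2c_3-\sum_i c_i\,n(a_i)+\mathrm{tr}(a_1a_2a_3)$, adjoint $h^\#$ (the Hermitian matrix with diagonal entries $c_2c_3-n(a_1)$, $c_1c_3-n(a_2)$, $c_1c_2-n(a_3)$ and with $a_3^*a_2^*-c_1a_1$, $a_1^*a_3^*-c_2a_2$, $a_2^*a_1^*-c_3a_3$ in the places of $a_1,a_2,a_3$), and pairing $\mathrm{tr}(x,y)=\tfrac12\mathrm{tr}(xy+yx)$. Let $W_L=L\oplus H_3(B_L)\oplus H_3(B_L)\oplus L$, with symplectic form $$\langle(a,b,c,d),(a',b',c',d')\rangle=ad'-\mathrm{tr}(b,c')+\mathrm{tr}(c,b')-da'$$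 and quartic form $$Q(a,b,c,d)=(ad-\mathrm{tr}(b,c))^2+4aN(c)+4dN(b)-4\,\mathrm{tr}(b^\#,c^\#).$$ Let $G(L)$ be the group of pairs $(g,\nu)\in \mathrm{GL}(W_L)\times L^\times$, acting on $W_L$ on the right, with $\langle ug,vg\rangle=\nu\langle u,v\rangle$ and $Q(wg)=\nu^2Q(w)$ for all $u,v,w\in W_L$. Let $G(\mathbb{Z})$ be the subgroup preserving the lattice $W(\mathbb{Z})=\mathbb{Z}\oplus H_3(B_0)\oplus H_3(B_0)\oplus\mathbb{Z}$ (with $\nu\in\mathbb{Z}^\times$), where $H_3(B_0)$ consists of the Hermitian matrices with all entries in $B_0$. Let $G^+(\mathbb{R})$ be the identity component of $G(\mathbb{R})$. Let $\mathcal{H}=\{Z=X+iY\in H_3(B_{\mathbb{C}}) : X,Y\in H_3(B_{\mathbb R}),\ Y \text{ positive definite}\}$ and $r(Z)=(1,-Z,Z^\#,-N(Z))\in W_{\mathbb C}$. The group $G^+(\mathbb{R})$ acts on $\mathcal H$, with factor of automorphy $j$, by $r(Z)g^{-1}=j(g,Z)\,r(gZ)$. For an integer $r\ge 0$ and a subgroup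 $\Gamma$ of $G(\mathbb{Z})$, a modular form on $G$ of weight $2r$ and level $\Gamma$ is a holomorphic function $F:\mathcal H\to\mathbb{C}$ such that $\nu(\gamma)^{-r}j(\gamma,Z)^{-2r}F(\gamma Z)=F(Z)$ for all $\gamma\in\Gamma\cap G^+(\mathbb{R})$ and $Z\in\mathcal H$, and such that $g\mapsto |N(\mathrm{Im}(g i))^rF(g i)|$, where $i=i\,1_3\in\mathcal{H}$, is of moderate growth on $G^+(\mathbb{R})$, that is, bounded by a constant times a power of the largest absolute value of an entry of $g$ or $g^{-1}$. Let $M\ge1$ be an integer and let $\Gamma$ be a congruence subgroup of $G(\mathbb{Z})$ of level $M$, that is, a subgroup of $G(\mathbb Z)$ containing the kernel of $G(\mathbb{Z})\to G(\mathbb{Z}/M)$; for example $\Gamma=\Gamma_G^0(M)$, the group of all $\gamma\in G(\mathbb{Z})$ that map $(0,0,0,1)$ to a multiple of itself modulo $M$. Let $F$ be a modular form on $G$ of weight $2r$ and level $\Gamma$, and let $f$ be the restriction of $F$ to the Siegel upper half space $\mathbb{H}_3$ of degree $3$, embedded in $\mathcal{H}$ through $\mathbb{C}\subset B_{\mathbb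 C}$. Then $F$ and $f$ have absolutely convergent Fourier expansions $$F(Z)=\sum_{h\in H_3(B)}a_F(h)\,e^{2\pi i\,\mathrm{tr}(Z,h)}\ (Z\in\mathcal H),\qquad f(z)=\sum_{T\in \mathrm{Sym}_3(\mathbb{Q})}a_f(T)\,e^{2\pi i\,\mathrm{tr}(Tz)}\ (z\in\mathbb{H}_3),$$ and each Fourier coefficient $a_f(T)$ is a finite $\mathbb{Z}$-linear combination of Fourier coefficients $a_F(h)$ of $F$. -/

import Mathlib

noncomputable section

namespace QuatG

/-! ## Quaternion algebras over `ℚ` and Hermitian `3 × 3` matrices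

Throughout, `α β : ℚ` are the structure constants of the quaternion algebra
`B = (α, β / ℚ)` with basis `1, i, j, k`, `i² = α`, `j² = β`, `k = i j`.
It is ramified at infinity exactly when `α < 0` and `β < 0`. -/

/-- The quaternion algebra `B_L = B ⊗ L` over a field `L` of characteristic zero.
Its `star` is the `L`-linear quaternion conjugation `x ↦ x^*`; in particular it fixes the
scalars `ℂ ⊆ B_ℂ`. -/
abbrev Quat (α β : ℚ) (L : Type) [Field L] : Type :=
  QuaternionAlgebra L (α : L) 0 (β : L)

/-- The reduced norm `n(x) = x x^*`, an element of the base field. -/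
def qnorm {α β : ℚ} {L : Type} [Field L] (x : Quat α β L) : L := (x * star x).re

/-- The reduced trace `tr(x) = x + x^*`, an element of the base field. -/
def qtr {α β : ℚ} {L : Type} [Field L] (x : Quat α β L) : L := (x + star x).re

/-- An order of `B`: a subring that is finitely generated as an abelian group and spans `B`. -/
def IsOrder {α β : ℚ} (O : Subring (Quat α β ℚ)) : Prop :=
  O.toAddSubgroup.FG ∧ Submodule.span ℚ (O : Set (Quat α β ℚ)) = ⊤

/-- A maximal order of `B`. -/
def IsMaximalOrder {α β : ℚ} (O : Subring (Quat α β ℚ)) : Prop :=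
  Maximal (IsOrder (α := α) (β := β)) O

/-- Coordinates on `H_3(B_L)`: the three diagonal entries `c_1, c_2, c_3`, and the coordinates of
the quaternions `a_1, a_2, a_3` with respect to the basis `1, i, j, k`. -/
abbrev HIdx : Type := Fin 3 ⊕ (Fin 3 × Fin 4)

/-- The space `H_3(B_L)` of Hermitian `3 × 3` matrices over `B_L`, in coordinates
(see `toMatrix`). -/
abbrev H3 (L : Type) : Type := HIdx → L

/-- The diagonal entry `c_{i+1}` of a Hermitian matrix. -/
def dg {L : Type} (h : H3 L) (i : Fin 3) : L := h (Sum.inl i)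

/-- The quaternion `a_{i+1}` of a Hermitian matrix. -/
def off (α β : ℚ) {L : Type} [Field L] (h : H3 L) (i : Fin 3) : Quat α β L :=
  ⟨h (Sum.inr (i, 0)), h (Sum.inr (i, 1)), h (Sum.inr (i, 2)), h (Sum.inr (i, 3))⟩

/-- The Hermitian matrix with given `c_i` and `a_i`. -/
def mkH {α β : ℚ} {L : Type} [Field L] (c : Fin 3 → L) (x : Fin 3 → Quat α β L) : H3 L :=
  Sum.elim c (fun p => ![(x p.1).re, (x p.1).imI, (x p.1).imJ, (x p.1).imK] p.2)

/-- The matrix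
`(c_1, a_3, a_2^*; a_3^*, c_2, a_1; a_2, a_1^*, c_3)` attached to its coordinates. -/
def toMatrix (α β : ℚ) {L : Type} [Field L] (h : H3 L) :
    Matrix (Fin 3) (Fin 3) (Quat α β L) :=
  !![algebraMap L _ (dg h 0), off α β h 2, star (off α β h 1);
     star (off α β h 2), algebraMap L _ (dg h 1), off α β h 0;
     off α β h 1, star (off α β h 0), algebraMap L _ (dg h 2)]

/-- The cubic norm `N(h) = c_1c_2c_3 - c_1 n(a_1) - c_2 n(a_2) - c_3 n(a_3) + tr(a_1a_2a_3)`. -/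
def normN (α β : ℚ) {L : Type} [Field L] (h : H3 L) : L :=
  dg h 0 * dg h 1 * dg h 2 - dg h 0 * qnorm (off α β h 0) - dg h 1 * qnorm (off α β h 1)
    - dg h 2 * qnorm (off α β h 2) + qtr (off α β h 0 * off α β h 1 * off α β h 2)

/-- The adjoint `h^#`. -/
def sharp (α β : ℚ) {L : Type} [Field L] (h : H3 L) : H3 L :=
  mkH (α := α) (β := β)
    ![dg h 1 * dg h 2 - qnorm (off α β h 0),
      dg h 0 * dg h 2 - qnorm (off α β h 1),
      dg h 0 * dg h 1 - qnorm (off α β h 2)]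
    ![star (off α β h 2) * star (off α β h 1) - dg h 0 • off α β h 0,
      star (off α β h 0) * star (off α β h 2) - dg h 1 • off α β h 1,
      star (off α β h 1) * star (off α β h 0) - dg h 2 • off α β h 2]

/-- The pairing `tr(x, y) = (1/2) tr(xy + yx)`. -/
def trPair (α β : ℚ) {L : Type} [Field L] (x y : H3 L) : L :=
  (1 / 2 : L) *
    (Matrix.trace (toMatrix α β x * toMatrix α β y + toMatrix α β y * toMatrix α β x)).re

/-- `Y ∈ H_3(B_ℝ)` is positive definite: `v^* Y v > 0` for all nonzero `v ∈ B_ℝ^3`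
(the quaternion `v^* Y v` is real). -/
def PosDefH (α β : ℚ) (Y : H3 ℝ) : Prop :=
  ∀ v : Fin 3 → Quat α β ℝ, v ≠ 0 →
    0 < (∑ i, ∑ j, star (v i) * toMatrix α β Y i j * v j).re

/-! ## The space `W` and the similitude group `G` -/

/-- Coordinates on `W_L = L ⊕ H_3(B_L) ⊕ H_3(B_L) ⊕ L`. -/
abbrev WIdx : Type := Unit ⊕ (HIdx ⊕ (HIdx ⊕ Unit))

/-- The `32`-dimensional space `W_L`, with elements `(a, b, c, d)`. -/
abbrev W (L : Type) : Type := WIdx → L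

/-- The component `a` of `(a, b, c, d)`. -/
def wa {L : Type} (w : W L) : L := w (Sum.inl ())

/-- The component `b` of `(a, b, c, d)`. -/
def wb {L : Type} (w : W L) : H3 L := fun k => w (Sum.inr (Sum.inl k))

/-- The component `c` of `(a, b, c, d)`. -/
def wc {L : Type} (w : W L) : H3 L := fun k => w (Sum.inr (Sum.inr (Sum.inl k)))

/-- The component `d` of `(a, b, c, d)`. -/
def wd {L : Type} (w : W L) : L := w (Sum.inr (Sum.inr (Sum.inr ())))

/-- The vector `(a, b, c, d)`. -/
def mkW {L : Type} (a : L) (b c : H3 L) (d : L) : W L :=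
  Sum.elim (fun _ => a) (Sum.elim b (Sum.elim c (fun _ => d)))

/-- The symplectic form on `W_L`. -/
def symp (α β : ℚ) {L : Type} [Field L] (u v : W L) : L :=
  wa u * wd v - trPair α β (wb u) (wc v) + trPair α β (wc u) (wb v) - wd u * wa v

/-- The quartic form on `W_L`. -/
def quartic (α β : ℚ) {L : Type} [Field L] (w : W L) : L :=
  (wa w * wd w - trPair α β (wb w) (wc w)) ^ 2 + 4 * wa w * normN α β (wc w)
    + 4 * wd w * normN α β (wb w) - 4 * trPair α β (sharp α β (wb w)) (sharp α β (wc w))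

/-- `GL(W_L) × GL_1(L)`.  A matrix acts on `W_L` on the right, by `w ↦ w ᵥ* g`. -/
abbrev GLW (L : Type) [Field L] : Type := GL WIdx L × Lˣ

/-- The right action `w ↦ w g`. -/
def ract {L : Type} [Field L] (w : W L) (g : GLW L) : W L :=
  Matrix.vecMul w (g.1 : Matrix WIdx WIdx L)

theorem ract_one {L : Type} [Field L] (w : W L) : ract w (1 : GLW L) = w := by
  simp [ract]

theorem ract_mul {L : Type} [Field L] (w : W L) (g h : GLW L) :
    ract w (g * h) = ract (ract w g) h := by
  simp [ract, Matrix.vecMul_vecMul]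

theorem ract_inv_ract {L : Type} [Field L] (w : W L) (g : GLW L) :
    ract (ract w g⁻¹) g = w := by
  rw [← ract_mul, inv_mul_cancel, ract_one]

theorem ract_add {L : Type} [Field L] (u v : W L) (g : GLW L) :
    ract (u + v) g = ract u g + ract v g := by
  simp [ract, Matrix.add_vecMul]

theorem ract_smul {L : Type} [Field L] (t : L) (v : W L) (g : GLW L) :
    ract (t • v) g = t • ract v g := by
  simp [ract, Matrix.smul_vecMul]

/-- The group `G(L)` of pairs `(g, ν)` such that `⟨ug, vg⟩ = ν ⟨u, v⟩` and `Q(wg) = ν² Q(w)`. -/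
def GG (α β : ℚ) (L : Type) [Field L] : Subgroup (GLW L) where
  carrier := {g | (∀ u v : W L, symp α β (ract u g) (ract v g) = (g.2 : L) * symp α β u v) ∧
    ∀ w : W L, quartic α β (ract w g) = (g.2 : L) ^ 2 * quartic α β w}
  one_mem' := by simp [ract_one]
  mul_mem' := by
    rintro g h ⟨hg1, hg2⟩ ⟨hh1, hh2⟩
    refine ⟨fun u v => ?_, fun w => ?_⟩
    · rw [ract_mul, ract_mul, hh1, hg1, Prod.snd_mul, Units.val_mul]; ring
    · rw [ract_mul, hh2, hg2, Prod.snd_mul, Units.val_mul]; ring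
  inv_mem' := by
    rintro g ⟨hg1, hg2⟩
    refine ⟨fun u v => ?_, fun w => ?_⟩
    · have h := hg1 (ract u g⁻¹) (ract v g⁻¹)
      rw [ract_inv_ract, ract_inv_ract] at h
      rw [h, Prod.snd_inv, ← mul_assoc, Units.inv_mul, one_mul]
    · have h := hg2 (ract w g⁻¹)
      rw [ract_inv_ract] at h
      rw [h, Prod.snd_inv, ← mul_assoc, ← mul_pow, Units.inv_mul, one_pow, one_mul]

/-- `G^+(ℝ)`, the connected component of the identity in `G(ℝ)`. -/
def GPlus (α β : ℚ) : Subgroup (GLW ℝ) :=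
  (Subgroup.connectedComponentOfOne (GG α β ℝ)).map (GG α β ℝ).subtype

/-! ## The integral structure and congruence subgroups -/

/-- The Hermitian matrices with all entries in the order `B_0`: since `B_0 ∩ ℚ = ℤ`, this means
`c_i ∈ ℤ` and `a_i ∈ B_0`. -/
def H3int {α β : ℚ} (B₀ : Subring (Quat α β ℚ)) : Set (H3 ℚ) :=
  {h | (∀ i, ∃ n : ℤ, dg h i = n) ∧ ∀ i, off α β h i ∈ B₀}

/-- The lattice `W(ℤ) = ℤ ⊕ H_3(B_0) ⊕ H_3(B_0) ⊕ ℤ`, viewed inside `W_ℝ`.  It is the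
intersection of `W_ℚ` with `(⋀³ W_6(ℤ)) ⊗ B_0`, because the components of `(a, b, c, d)` in the
standard basis of `⋀³ W_6(ℤ)` are `a`, `d` and the matrix entries of `b` and `c`. -/
def Wint {α β : ℚ} (B₀ : Subring (Quat α β ℚ)) : AddSubgroup (W ℝ) where
  carrier := {w | ∃ v : W ℚ, (∃ n : ℤ, wa v = n) ∧ wb v ∈ H3int B₀ ∧ wc v ∈ H3int B₀ ∧
    (∃ n : ℤ, wd v = n) ∧ w = fun k => (v k : ℝ)}
  zero_mem' := by
    have h0 : (0 : H3 ℚ) ∈ H3int B₀ := by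
      refine ⟨fun i => ⟨0, by simp [dg]⟩, fun i => ?_⟩
      have : off α β (0 : H3 ℚ) i = 0 := by ext <;> simp [off]
      rw [this]; exact B₀.zero_mem
    refine ⟨0, ⟨0, by simp [wa]⟩, h0, h0, ⟨0, by simp [wd]⟩, ?_⟩
    funext k; simp
  add_mem' := by
    have hadd : ∀ x y : H3 ℚ, x ∈ H3int B₀ → y ∈ H3int B₀ → x + y ∈ H3int B₀ := by
      rintro x y ⟨hx1, hx2⟩ ⟨hy1, hy2⟩
      refine ⟨fun i => ?_, fun i => ?_⟩
      · obtain ⟨m, hm⟩ := hx1 i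
        obtain ⟨n, hn⟩ := hy1 i
        refine ⟨m + n, ?_⟩
        simp only [dg, Pi.add_apply] at hm hn ⊢
        rw [hm, hn]; push_cast; ring
      · have : off α β (x + y) i = off α β x i + off α β y i := by ext <;> simp [off]
        rw [this]; exact B₀.add_mem (hx2 i) (hy2 i)
    rintro _ _ ⟨u, ⟨m, hm⟩, hb, hc, ⟨n, hn⟩, rfl⟩ ⟨v, ⟨m', hm'⟩, hb', hc', ⟨n', hn'⟩, rfl⟩
    refine ⟨u + v, ⟨m + m', ?_⟩, hadd _ _ hb hb', hadd _ _ hc hc', ⟨n + n', ?_⟩, ?_⟩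
    · simp only [wa, Pi.add_apply] at hm hm' ⊢
      rw [hm, hm']; push_cast; ring
    · simp only [wd, Pi.add_apply] at hn hn' ⊢
      rw [hn, hn']; push_cast; ring
    · funext k; simp
  neg_mem' := by
    have hneg : ∀ x : H3 ℚ, x ∈ H3int B₀ → -x ∈ H3int B₀ := by
      rintro x ⟨hx1, hx2⟩
      refine ⟨fun i => ?_, fun i => ?_⟩
      · obtain ⟨m, hm⟩ := hx1 i
        refine ⟨-m, ?_⟩
        simp only [dg, Pi.neg_apply] at hm ⊢
        rw [hm]; push_cast; ring
      · have : off α β (-x) i = -off α β x i := by ext <;> simp [off]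
        rw [this]; exact B₀.neg_mem (hx2 i)
    rintro _ ⟨u, ⟨m, hm⟩, hb, hc, ⟨n, hn⟩, rfl⟩
    refine ⟨-u, ⟨-m, ?_⟩, hneg _ hb, hneg _ hc, ⟨-n, ?_⟩, ?_⟩
    · simp only [wa, Pi.neg_apply] at hm ⊢
      rw [hm]; push_cast; ring
    · simp only [wd, Pi.neg_apply] at hn ⊢
      rw [hn]; push_cast; ring
    · funext k; simp

/-- `G(ℤ)`, as a subgroup of `G(ℝ)`: the elements that restrict to an automorphism of `W(ℤ)` and
have similitude factor in `ℤˣ`. -/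
def GZ {α β : ℚ} (B₀ : Subring (Quat α β ℚ)) : Subgroup (GLW ℝ) where
  carrier := {g | g ∈ GG α β ℝ ∧ (∀ w : W ℝ, ract w g ∈ Wint B₀ ↔ w ∈ Wint B₀) ∧
    (g.2 = 1 ∨ g.2 = -1)}
  one_mem' := ⟨one_mem _, fun w => by rw [ract_one], Or.inl rfl⟩
  mul_mem' := by
    rintro g h ⟨hg, hg1, hg2⟩ ⟨hh, hh1, hh2⟩
    refine ⟨mul_mem hg hh, fun w => by rw [ract_mul, hh1, hg1], ?_⟩
    rw [Prod.snd_mul]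
    rcases hg2 with h1 | h1 <;> rcases hh2 with h2 | h2 <;> rw [h1, h2] <;> simp
  inv_mem' := by
    rintro g ⟨hg, hg1, hg2⟩
    refine ⟨inv_mem hg, fun w => ?_, ?_⟩
    · rw [← hg1 (ract w g⁻¹), ract_inv_ract]
    · rw [Prod.snd_inv]
      rcases hg2 with h1 | h1 <;> rw [h1] <;> simp

/-- The principal congruence subgroup `Γ_G(M)`: the kernel of `G(ℤ) → G(ℤ/M)`. -/
def GammaPrincipal {α β : ℚ} (B₀ : Subring (Quat α β ℚ)) (M : ℕ) : Subgroup (GLW ℝ) where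
  carrier := {g | g ∈ GZ B₀ ∧ ∀ w ∈ Wint B₀, ∃ v ∈ Wint B₀, ract w g = w + (M : ℝ) • v}
  one_mem' := ⟨one_mem _, fun w _ => ⟨0, zero_mem _, by simp [ract_one]⟩⟩
  mul_mem' := by
    rintro g h ⟨hg, hg1⟩ ⟨hh, hh1⟩
    refine ⟨mul_mem hg hh, fun w hw => ?_⟩
    obtain ⟨v, hv, e⟩ := hg1 w hw
    obtain ⟨v', hv', e'⟩ := hh1 w hw
    refine ⟨v' + ract v h, add_mem hv' ((hh.2.1 v).2 hv), ?_⟩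
    rw [ract_mul, e, ract_add, ract_smul, e', smul_add, add_assoc]
  inv_mem' := by
    rintro g ⟨hg, hg1⟩
    refine ⟨inv_mem hg, fun w hw => ?_⟩
    obtain ⟨v, hv, e⟩ := hg1 (ract w g⁻¹) (((inv_mem hg).2.1 w).2 hw)
    rw [ract_inv_ract] at e
    refine ⟨-v, neg_mem hv, ?_⟩
    rw [smul_neg]
    exact eq_add_neg_of_add_eq e.symm

/-- The vector `f = (0, 0, 0, 1)`; the parabolic `P` is the stabilizer of the line it spans. -/
def fvec : W ℝ := mkW 0 0 0 1

theorem wd_int {α β : ℚ} {B₀ : Subring (Quat α β ℚ)} {w : W ℝ} (hw : w ∈ Wint B₀) :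
    ∃ n : ℤ, wd w = n := by
  obtain ⟨v, -, -, -, ⟨n, hn⟩, rfl⟩ := hw
  exact ⟨n, by simp only [wd] at hn ⊢; rw [hn]; simp⟩

theorem fvec_mem {α β : ℚ} (B₀ : Subring (Quat α β ℚ)) : fvec ∈ Wint B₀ := by
  have h0 : (0 : H3 ℚ) ∈ H3int B₀ := by
    refine ⟨fun i => ⟨0, by simp [dg]⟩, fun i => ?_⟩
    have : off α β (0 : H3 ℚ) i = 0 := by ext <;> simp [off]
    rw [this]; exact B₀.zero_mem
  refine ⟨mkW 0 0 0 1, ⟨0, by simp [wa, mkW]⟩, h0, h0, ⟨1, by simp [wd, mkW]⟩, ?_⟩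
  funext k
  rcases k with k | k | k | k <;> simp [fvec, mkW]

/-- The congruence subgroup `Γ_G^0(M)`: the elements of `G(ℤ)` whose reduction mod `M` lies in
`P(ℤ/M)`, that is, maps `f` to a multiple of `f` modulo `M`. -/
def GammaZero {α β : ℚ} (B₀ : Subring (Quat α β ℚ)) (M : ℕ) : Subgroup (GLW ℝ) where
  carrier := {g | g ∈ GZ B₀ ∧ ∃ n : ℤ, ∃ v ∈ Wint B₀, ract fvec g = (n : ℝ) • fvec + (M : ℝ) • v}
  one_mem' := ⟨one_mem _, 1, 0, zero_mem _, by simp [ract_one]⟩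
  mul_mem' := by
    rintro g h ⟨hg, n, v, hv, e⟩ ⟨hh, m, u, hu, e'⟩
    refine ⟨mul_mem hg hh, n * m, n • u + ract v h,
      add_mem (zsmul_mem hu n) ((hh.2.1 v).2 hv), ?_⟩
    rw [ract_mul, e, ract_add, ract_smul, ract_smul, e']
    funext k
    simp only [Pi.add_apply, Pi.smul_apply, smul_eq_mul, zsmul_eq_mul]
    push_cast
    simp only [Pi.mul_apply, Pi.intCast_apply]
    ring
  inv_mem' := by
    rintro g ⟨hg, n, v, hv, e⟩
    have hfi : ract fvec g⁻¹ ∈ Wint B₀ := ((inv_mem hg).2.1 _).2 (fvec_mem B₀)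
    have hvi : ract v g⁻¹ ∈ Wint B₀ := ((inv_mem hg).2.1 _).2 hv
    have e1 : fvec = (n : ℝ) • ract fvec g⁻¹ + (M : ℝ) • ract v g⁻¹ := by
      rw [← ract_smul, ← ract_smul, ← ract_add, ← e, ← ract_mul, mul_inv_cancel, ract_one]
    obtain ⟨x, hx⟩ := wd_int hfi
    obtain ⟨y, hy⟩ := wd_int hvi
    have e2 : (1 : ℝ) = n * x + M * y := by
      have := congrArg wd e1
      simp only [wd, fvec, mkW, Pi.add_apply, Pi.smul_apply, smul_eq_mul, Sum.elim_inr] at this hx hy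
      rw [hx, hy] at this
      exact this
    refine ⟨inv_mem hg, x, y • ract fvec g⁻¹ - x • ract v g⁻¹,
      sub_mem (zsmul_mem hfi y) (zsmul_mem hvi x), ?_⟩
    funext k
    have e3 := congrFun e1 k
    simp only [Pi.add_apply, Pi.smul_apply, smul_eq_mul, zsmul_eq_mul, Pi.sub_apply,
      Pi.mul_apply, Pi.intCast_apply] at e3 ⊢
    linear_combination ract fvec g⁻¹ k * e2 - (x : ℝ) * e3

/-- A congruence subgroup of `G(ℤ)` of level dividing `M`. -/
def IsCongruenceSubgroup {α β : ℚ} (B₀ : Subring (Quat α β ℚ)) (M : ℕ)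
    (Γ : Subgroup (GLW ℝ)) : Prop :=
  GammaPrincipal B₀ M ≤ Γ ∧ Γ ≤ GZ B₀

/-- `Γ_G^0(M)` is a congruence subgroup of `G(ℤ)` of level dividing `M`. -/
theorem isCongruenceSubgroup_GammaZero {α β : ℚ} (B₀ : Subring (Quat α β ℚ)) (M : ℕ) :
    IsCongruenceSubgroup B₀ M (GammaZero B₀ M) := by
  refine ⟨fun g hg => ⟨hg.1, ?_⟩, fun g hg => hg.1⟩
  obtain ⟨v, hv, e⟩ := hg.2 fvec (fvec_mem B₀)
  exact ⟨1, v, hv, by simpa using e⟩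

/-! ## The Hermitian symmetric space and modular forms on `G` -/

/-- `Im Z = Y` for `Z = X + iY ∈ H_3(B_ℂ)`. -/
def imH (Z : H3 ℂ) : H3 ℝ := fun k => (Z k).im

/-- The Hermitian symmetric space `ℋ`. -/
def HH (α β : ℚ) : Set (H3 ℂ) := {Z | PosDefH α β (imH Z)}

/-- The base point `i = i 1_3 ∈ ℋ`. -/
def iH : H3 ℂ := Sum.elim (fun _ => Complex.I) (fun _ => 0)

/-- `r(Z) = (1, -Z, Z^#, -N(Z)) ∈ W_ℂ`. -/
def rvec (α β : ℚ) (Z : H3 ℂ) : W ℂ := mkW 1 (-Z) (sharp α β Z) (-normN α β Z)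

/-- The image of a real element in `GL(W_ℂ) × GL_1(ℂ)`. -/
def toC (g : GLW ℝ) : GLW ℂ :=
  (Matrix.GeneralLinearGroup.map Complex.ofRealHom g.1, Units.map Complex.ofRealHom g.2)

/-- The factor of automorphy `j(g, Z)`.  It is defined, together with `gZ`, by
`r(Z) g⁻¹ = j(g, Z) r(gZ)`; so it is the first component of `r(Z) g⁻¹`. -/
def jfac (α β : ℚ) (g : GLW ℝ) (Z : H3 ℂ) : ℂ := wa (ract (rvec α β Z) (toC g⁻¹))

/-- The action `gZ`, read off from the second component of `r(Z) g⁻¹ = j(g, Z) r(gZ)`. -/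
def act (α β : ℚ) (g : GLW ℝ) (Z : H3 ℂ) : H3 ℂ :=
  -((jfac α β g Z)⁻¹ • wb (ract (rvec α β Z) (toC g⁻¹)))

/-- `(F|_{2r} g)(Z) = ν(g)^{-r} j(g, Z)^{-2r} F(gZ)`. -/
def slash (α β : ℚ) (r : ℕ) (g : GLW ℝ) (F : H3 ℂ → ℂ) (Z : H3 ℂ) : ℂ :=
  (((g.2 : ℝ) : ℂ) ^ r)⁻¹ * (jfac α β g Z ^ (2 * r))⁻¹ * F (act α β g Z)

/-- The height `‖g‖`: the largest absolute value of an entry of `g` or of `g⁻¹`. -/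
def height (g : GLW ℝ) : ℝ :=
  max ‖fun p : WIdx × WIdx => (g.1 : Matrix WIdx WIdx ℝ) p.1 p.2‖
    ‖fun p : WIdx × WIdx => ((g⁻¹).1 : Matrix WIdx WIdx ℝ) p.1 p.2‖

/-- `F` is a modular form on `G` of weight `2r` and level `Γ`: it is holomorphic on `ℋ`, invariant
under the weight `2r` action of (the elements of `G^+(ℝ)` in) `Γ`, and the function
`N(Im Z)^r F(Z)`, `Z = g i`, is of moderate growth in `g`.  Only the values of `F` on `ℋ`
matter. -/
structure IsModularForm (α β : ℚ) (r : ℕ) (Γ : Subgroup (GLW ℝ)) (F : H3 ℂ → ℂ) : Prop where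
  holomorphic : DifferentiableOn ℂ F (HH α β)
  slash_eq : ∀ γ ∈ Γ, γ ∈ GPlus α β → ∀ Z ∈ HH α β, slash α β r γ F Z = F Z
  moderate_growth : ∃ (C : ℝ) (n : ℕ), ∀ g ∈ GPlus α β,
    ‖((normN α β (imH (act α β g iH)) : ℝ) : ℂ) ^ r * F (act α β g iH)‖ ≤ C * height g ^ n

/-- `aF` is the family of Fourier coefficients of `F`:
`F(Z) = ∑_{h ∈ H_3(B)} aF(h) exp(2πi tr(Z, h))` on `ℋ`.  The sum converges unconditionally, hence
absolutely, so that the coefficients are determined by `F`. -/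
def IsFourierExpansion (α β : ℚ) (F : H3 ℂ → ℂ) (aF : H3 ℚ → ℂ) : Prop :=
  ∀ Z ∈ HH α β, HasSum
    (fun h : H3 ℚ => aF h *
      Complex.exp (2 * Real.pi * Complex.I * trPair α β Z (fun k => ((h k : ℚ) : ℂ)))) (F Z)

/-! ## The Siegel upper half space -/

/-- The Siegel upper half space of degree `3`. -/
def Siegel : Set (Matrix (Fin 3) (Fin 3) ℂ) :=
  {z | z.IsSymm ∧ (z.map Complex.im).PosDef}

/-- The embedding of (symmetric matrices over `ℂ`, in particular) the Siegel upper half space into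
`H_3(B_ℂ)` induced by `ℂ ⊆ B_ℂ`. -/
def siegelEmb (z : Matrix (Fin 3) (Fin 3) ℂ) : H3 ℂ :=
  Sum.elim (fun i => z i i)
    (fun p => if p.2 = 0 then ![z 1 2, z 2 0, z 0 1] p.1 else 0)

/-- The restriction to the Siegel upper half space of a function on `ℋ`. -/
def restrict (F : H3 ℂ → ℂ) (z : Matrix (Fin 3) (Fin 3) ℂ) : ℂ := F (siegelEmb z)

/-- Rational symmetric `3 × 3` matrices. -/
abbrev Sym3 : Type := {T : Matrix (Fin 3) (Fin 3) ℚ // T.IsSymm}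

/-- `af` is the family of Fourier coefficients of the function `f` on the Siegel upper half space:
`f(z) = ∑_T af(T) exp(2πi tr(T z))`. -/
def IsSiegelFourierExpansion (f : Matrix (Fin 3) (Fin 3) ℂ → ℂ) (af : Sym3 → ℂ) : Prop :=
  ∀ z ∈ Siegel, HasSum
    (fun T : Sym3 => af T *
      Complex.exp (2 * Real.pi * Complex.I *
        Matrix.trace (T.1.map (fun q : ℚ => (q : ℂ)) * z))) (f z)

end QuatG

end

/-! The group `Γ` contains the translations `Z ↦ Z + A` for all `A` in some lattice, and these have
`j = ν = 1`; so `F` is periodic (`IsModularForm.exists_period`). A periodic holomorphic function on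
a tube over an open convex set is the sum of its Fourier series (`hasSum_fourier_tube`), which gives
the expansion of `F`, supported on the lattice dual to the periods. For `z` in the Siegel space,
`tr(z, h)` depends only on `symPart h`, the diagonal and the real parts of the off-diagonal entries
of `h`. Grouping terms gives the expansion of `f`, with `a_f(T)` the sum of `a_F(h)` over the fibre
`symPart h = T`. What remains is that each fibre contains only finitely many `h` with `a_F(h) ≠ 0`.

On a fibre the diagonal of `h` is fixed, so it suffices to bound the off-diagonal entries by the
diagonal. This follows from `tr(Y₀, h) ≥ 0` for a few explicit positive definite `Y₀`
(`IsModularForm.trPair_testIm_nonneg`), which is deduced from moderate growth. Along the ray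
`e^{2s}Y₀` the form `F` is bounded by `C e^{Ks}`, uniformly in the real part
(`IsModularForm.growth_on_ray`), while a nonzero coefficient with `tr(Y₀, h) < 0` would force growth
like `exp(τ e^{2s})`. The ray is reached from the base point by translations, scalars and opposite
unipotents: an opposite unipotent sends `i` to `-(A + i)⁻¹`, and for suitable `A` the imaginary part
`Y₀` of that point has a single nonzero off-diagonal entry, of either sign. That these maps lie in
`G^+(ℝ)` rests on the identities of the cubic norm structure `(H_3, N, #)`.

The expansions in the statement are indexed by all rational matrices, so their frequencies need not
lie in a common lattice. Coefficients are therefore isolated by averaging along the multiples of a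
real direction whose coordinates and `1` are linearly independent over `ℚ`
(`norm_coeff_le_of_hasSum`). This bounds each term by the supremum of `F` on a horizontal slice, and
yields both the uniqueness of the coefficients and the growth argument. -/

noncomputable section
namespace QuatG
variable {α β : ℚ} {L : Type} [Field L]

/-! ### The cubic norm structure on Hermitian matrices, in coordinates. -/

section Coordinates

variable (x y : Quat α β L) (t : L)

theorem re_mul : (x * y).re =
    x.re * y.re + α * x.imI * y.imI + β * x.imJ * y.imJ - α * β * x.imK * y.imK := by
  simp

theorem imI_mul : (x * y).imI =
    x.re * y.imI + x.imI * y.re - β * x.imJ * y.imK + β * x.imK * y.imJ := by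
  simp

theorem imJ_mul : (x * y).imJ =
    x.re * y.imJ + α * x.imI * y.imK + x.imJ * y.re - α * x.imK * y.imI := by
  simp

theorem imK_mul : (x * y).imK =
    x.re * y.imK + x.imI * y.imJ - x.imJ * y.imI + x.imK * y.re := by
  simp

theorem re_star : (star x).re = x.re := by simp
theorem imI_star : (star x).imI = -x.imI := rfl
theorem imJ_star : (star x).imJ = -x.imJ := rfl
theorem imK_star : (star x).imK = -x.imK := rfl

theorem qnorm_eq :
    qnorm x = x.re ^ 2 - α * x.imI ^ 2 - β * x.imJ ^ 2 + α * β * x.imK ^ 2 := by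
  simp only [qnorm, re_mul, re_star, imI_star, imJ_star, imK_star]; ring

theorem qtr_eq : qtr x = 2 * x.re := by
  rw [qtr, QuaternionAlgebra.re_add, re_star]; ring

end Coordinates

theorem ext_dg_off {x y : H3 L} (h : ∀ i, dg x i = dg y i)
    (h' : ∀ i, off α β x i = off α β y i) : x = y := by
  funext k
  rcases k with i | ⟨i, l⟩
  · exact h i
  · have := h' i
    simp only [off, QuaternionAlgebra.mk.injEq] at this
    fin_cases l
    exacts [this.1, this.2.1, this.2.2.1, this.2.2.2]

theorem dg_add (x y : H3 L) (i : Fin 3) : dg (x + y) i = dg x i + dg y i := rfl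
theorem off_add (x y : H3 L) (i : Fin 3) : off α β (x + y) i = off α β x i + off α β y i := rfl
theorem dg_sub (x y : H3 L) (i : Fin 3) : dg (x - y) i = dg x i - dg y i := rfl
theorem off_sub (x y : H3 L) (i : Fin 3) : off α β (x - y) i = off α β x i - off α β y i := rfl
theorem dg_smul (t : L) (x : H3 L) (i : Fin 3) : dg (t • x) i = t * dg x i := rfl
theorem off_smul (t : L) (x : H3 L) (i : Fin 3) : off α β (t • x) i = t • off α β x i := rfl

theorem trPair_eq [CharZero L] (x y : H3 L) : trPair α β x y =
    dg x 0 * dg y 0 + dg x 1 * dg y 1 + dg x 2 * dg y 2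
    + (2 * (off α β x 0 * star (off α β y 0)).re + 2 * (off α β x 1 * star (off α β y 1)).re
      + 2 * (off α β x 2 * star (off α β y 2)).re) := by
  simp [trPair, toMatrix, Matrix.trace, Fin.sum_univ_three, dg, off]
  ring

section Sharp

variable (x y z : H3 L)

theorem dg_sharp_zero : dg (sharp α β x) 0 = dg x 1 * dg x 2 - qnorm (off α β x 0) := rfl
theorem dg_sharp_one : dg (sharp α β x) 1 = dg x 0 * dg x 2 - qnorm (off α β x 1) := rfl
theorem dg_sharp_two : dg (sharp α β x) 2 = dg x 0 * dg x 1 - qnorm (off α β x 2) := rfl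
theorem off_sharp_zero : off α β (sharp α β x) 0 =
    star (off α β x 2) * star (off α β x 1) - dg x 0 • off α β x 0 := rfl
theorem off_sharp_one : off α β (sharp α β x) 1 =
    star (off α β x 0) * star (off α β x 2) - dg x 1 • off α β x 1 := rfl
theorem off_sharp_two : off α β (sharp α β x) 2 =
    star (off α β x 1) * star (off α β x 0) - dg x 2 • off α β x 2 := rfl

/-- With `normN_add` and `trPair_sharp_self`, one of the axioms of a cubic norm structure. Each is a
polynomial identity in the coordinates; the invariance of the forms on `W` is deduced from them. -/
theorem sharp_sharp : sharp α β (sharp α β x) = normN α β x • x := by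
  apply ext_dg_off (α := α) (β := β) <;> intro i
  · rw [dg_smul]
    fin_cases i <;> dsimp only [Fin.zero_eta, Fin.mk_one, Fin.reduceFinMk, Fin.isValue] <;>
      simp only [dg_sharp_zero, dg_sharp_one, dg_sharp_two, off_sharp_zero, off_sharp_one,
        off_sharp_two, normN, qtr_eq, qnorm_eq, re_mul, imI_mul, imJ_mul, imK_mul,
        QuaternionAlgebra.re_sub, QuaternionAlgebra.imI_sub, QuaternionAlgebra.imJ_sub,
        QuaternionAlgebra.imK_sub, QuaternionAlgebra.re_smul, QuaternionAlgebra.imI_smul,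
        QuaternionAlgebra.imJ_smul, QuaternionAlgebra.imK_smul,
        re_star, imI_star, imJ_star, imK_star, smul_eq_mul] <;> ring
  · rw [off_smul]
    fin_cases i <;> dsimp only [Fin.zero_eta, Fin.mk_one, Fin.reduceFinMk, Fin.isValue] <;>
      ext <;> simp only [dg_sharp_zero, dg_sharp_one, dg_sharp_two, off_sharp_zero, off_sharp_one,
        off_sharp_two, normN, qtr_eq, qnorm_eq, re_mul, imI_mul, imJ_mul, imK_mul,
        QuaternionAlgebra.re_sub, QuaternionAlgebra.imI_sub, QuaternionAlgebra.imJ_sub,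
        QuaternionAlgebra.imK_sub, QuaternionAlgebra.re_smul, QuaternionAlgebra.imI_smul,
        QuaternionAlgebra.imJ_smul, QuaternionAlgebra.imK_smul,
        re_star, imI_star, imJ_star, imK_star, smul_eq_mul] <;> ring

theorem normN_add [CharZero L] : normN α β (x + y) =
    normN α β x + trPair α β (sharp α β x) y + trPair α β x (sharp α β y) + normN α β y := by
  simp only [trPair_eq, dg_sharp_zero, dg_sharp_one, dg_sharp_two, off_sharp_zero, off_sharp_one,
    off_sharp_two, normN, qtr_eq, qnorm_eq, re_mul, imI_mul, imJ_mul, imK_mul, dg_add, off_add,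
    QuaternionAlgebra.re_add, QuaternionAlgebra.imI_add, QuaternionAlgebra.imJ_add,
    QuaternionAlgebra.imK_add,
    QuaternionAlgebra.re_sub, QuaternionAlgebra.imI_sub, QuaternionAlgebra.imJ_sub,
    QuaternionAlgebra.imK_sub, QuaternionAlgebra.re_smul, QuaternionAlgebra.imI_smul,
    QuaternionAlgebra.imJ_smul, QuaternionAlgebra.imK_smul,
    re_star, imI_star, imJ_star, imK_star, smul_eq_mul]
  ring

theorem trPair_sharp_self [CharZero L] : trPair α β (sharp α β x) x = 3 * normN α β x := by
  simp only [trPair_eq, dg_sharp_zero, dg_sharp_one, dg_sharp_two, off_sharp_zero, off_sharp_one,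
    off_sharp_two, normN, qtr_eq, qnorm_eq, re_mul, imI_mul, imJ_mul, imK_mul,
    QuaternionAlgebra.re_sub, QuaternionAlgebra.imI_sub, QuaternionAlgebra.imJ_sub,
    QuaternionAlgebra.imK_sub, QuaternionAlgebra.re_smul, QuaternionAlgebra.imI_smul,
    QuaternionAlgebra.imJ_smul, QuaternionAlgebra.imK_smul,
    re_star, imI_star, imJ_star, imK_star, smul_eq_mul]
  ring

variable {x y z} in
theorem trPair_comm [CharZero L] : trPair α β x y = trPair α β y x := by
  simp only [trPair, add_comm]

theorem trPair_add_left [CharZero L] :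
    trPair α β (x + y) z = trPair α β x z + trPair α β y z := by
  simp only [trPair_eq, dg_add, off_add, add_mul, QuaternionAlgebra.re_add]
  ring

theorem trPair_smul_left [CharZero L] (t : L) : trPair α β (t • x) y = t * trPair α β x y := by
  simp only [trPair_eq, dg_smul, off_smul, smul_mul_assoc, QuaternionAlgebra.re_smul, smul_eq_mul]
  ring

theorem trPair_add_right [CharZero L] :
    trPair α β x (y + z) = trPair α β x y + trPair α β x z := by
  rw [trPair_comm, trPair_add_left, trPair_comm (x := y), trPair_comm (x := z)]

theorem trPair_smul_right [CharZero L] (t : L) : trPair α β x (t • y) = t * trPair α β x y := by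
  rw [trPair_comm, trPair_smul_left, trPair_comm]

theorem trPair_neg_left [CharZero L] : trPair α β (-x) y = -trPair α β x y := by
  rw [← neg_one_smul L x, trPair_smul_left, neg_one_mul]

theorem trPair_neg_right [CharZero L] : trPair α β x (-y) = -trPair α β x y := by
  rw [trPair_comm, trPair_neg_left, trPair_comm]

theorem trPair_zero_left [CharZero L] : trPair α β 0 x = 0 := by
  simpa using trPair_smul_left (α := α) (β := β) 0 x (0 : L)

theorem trPair_zero_right [CharZero L] : trPair α β x 0 = 0 := by
  rw [trPair_comm, trPair_zero_left]

theorem sharp_smul (t : L) : sharp α β (t • x) = t ^ 2 • sharp α β x := by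
  apply ext_dg_off (α := α) (β := β) <;> intro i
  · rw [dg_smul]
    fin_cases i <;> dsimp only [Fin.zero_eta, Fin.mk_one, Fin.reduceFinMk, Fin.isValue] <;>
      simp only [dg_sharp_zero, dg_sharp_one, dg_sharp_two, qnorm_eq, dg_smul, off_smul,
        QuaternionAlgebra.re_smul, QuaternionAlgebra.imI_smul,
        QuaternionAlgebra.imJ_smul, QuaternionAlgebra.imK_smul, smul_eq_mul] <;> ring
  · rw [off_smul]
    fin_cases i <;> dsimp only [Fin.zero_eta, Fin.mk_one, Fin.reduceFinMk, Fin.isValue] <;>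
      simp only [off_sharp_zero, off_sharp_one, off_sharp_two, dg_smul, off_smul,
        QuaternionAlgebra.star_smul', smul_sub, smul_mul_smul_comm, smul_smul, ← pow_two] <;>
      ring_nf

theorem sharp_neg : sharp α β (-x) = sharp α β x := by
  rw [← neg_one_smul L x, sharp_smul]; simp

theorem normN_smul (t : L) : normN α β (t • x) = t ^ 3 * normN α β x := by
  simp only [normN, qtr_eq, qnorm_eq, re_mul, imI_mul, imJ_mul, imK_mul, dg_smul, off_smul,
    QuaternionAlgebra.re_smul, QuaternionAlgebra.imI_smul,
    QuaternionAlgebra.imJ_smul, QuaternionAlgebra.imK_smul, smul_eq_mul]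
  ring

theorem normN_neg : normN α β (-x) = -normN α β x := by
  rw [← neg_one_smul L x, normN_smul]; ring

/-- The number `tr(x^##, x^#)` equals `3N(x^#)`, and also `N(x) tr(x, x^#) = 3N(x)²`. -/
theorem normN_sharp [CharZero L] : normN α β (sharp α β x) = normN α β x ^ 2 := by
  have h := trPair_sharp_self (α := α) (β := β) (sharp α β x)
  rw [sharp_sharp, trPair_smul_left, trPair_comm, trPair_sharp_self] at h
  linear_combination -h / 3

end Sharp

/-- The bilinear operation `x × y = (x + y)^# - x^# - y^#`. -/
def cross (α β : ℚ) {L : Type} [Field L] (x y : H3 L) : H3 L :=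
  sharp α β (x + y) - sharp α β x - sharp α β y

section Cross

variable (x y z : H3 L)

theorem dg_cross_zero : dg (cross α β x y) 0 =
    dg x 1 * dg y 2 + dg y 1 * dg x 2 - 2 * (off α β x 0 * star (off α β y 0)).re := by
  simp only [cross, dg_sub, dg_sharp_zero, dg_add, off_add, qnorm_eq, QuaternionAlgebra.re_add,
    QuaternionAlgebra.imI_add, QuaternionAlgebra.imJ_add, QuaternionAlgebra.imK_add,
    re_mul, re_star, imI_star, imJ_star, imK_star]
  ring

theorem dg_cross_one : dg (cross α β x y) 1 =
    dg x 0 * dg y 2 + dg y 0 * dg x 2 - 2 * (off α β x 1 * star (off α β y 1)).re := by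
  simp only [cross, dg_sub, dg_sharp_one, dg_add, off_add, qnorm_eq, QuaternionAlgebra.re_add,
    QuaternionAlgebra.imI_add, QuaternionAlgebra.imJ_add, QuaternionAlgebra.imK_add,
    re_mul, re_star, imI_star, imJ_star, imK_star]
  ring

theorem dg_cross_two : dg (cross α β x y) 2 =
    dg x 0 * dg y 1 + dg y 0 * dg x 1 - 2 * (off α β x 2 * star (off α β y 2)).re := by
  simp only [cross, dg_sub, dg_sharp_two, dg_add, off_add, qnorm_eq, QuaternionAlgebra.re_add,
    QuaternionAlgebra.imI_add, QuaternionAlgebra.imJ_add, QuaternionAlgebra.imK_add,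
    re_mul, re_star, imI_star, imJ_star, imK_star]
  ring

theorem off_cross_zero : off α β (cross α β x y) 0 =
    star (off α β x 2) * star (off α β y 1) + star (off α β y 2) * star (off α β x 1)
      - dg x 0 • off α β y 0 - dg y 0 • off α β x 0 := by
  simp only [cross, off_sub, off_sharp_zero, dg_add, off_add, star_add, add_mul, mul_add, add_smul,
    smul_add]
  abel

theorem off_cross_one : off α β (cross α β x y) 1 =
    star (off α β x 0) * star (off α β y 2) + star (off α β y 0) * star (off α β x 2)
      - dg x 1 • off α β y 1 - dg y 1 • off α β x 1 := by
  simp only [cross, off_sub, off_sharp_one, dg_add, off_add, star_add, add_mul, mul_add, add_smul,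
    smul_add]
  abel

theorem off_cross_two : off α β (cross α β x y) 2 =
    star (off α β x 1) * star (off α β y 0) + star (off α β y 1) * star (off α β x 0)
      - dg x 2 • off α β y 2 - dg y 2 • off α β x 2 := by
  simp only [cross, off_sub, off_sharp_two, dg_add, off_add, star_add, add_mul, mul_add, add_smul,
    smul_add]
  abel

theorem cross_comm : cross α β x y = cross α β y x := by
  rw [cross, cross, add_comm x y, sub_right_comm]

theorem sharp_add : sharp α β (x + y) = sharp α β x + cross α β x y + sharp α β y := by
  rw [cross]; abel

theorem cross_add_left : cross α β (x + y) z = cross α β x z + cross α β y z := by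
  apply ext_dg_off (α := α) (β := β) <;> intro i
  · rw [dg_add]
    fin_cases i <;> dsimp only [Fin.zero_eta, Fin.mk_one, Fin.reduceFinMk, Fin.isValue] <;>
      simp only [dg_cross_zero, dg_cross_one, dg_cross_two, dg_add, off_add, add_mul,
        QuaternionAlgebra.re_add] <;> ring
  · rw [off_add]
    fin_cases i <;> dsimp only [Fin.zero_eta, Fin.mk_one, Fin.reduceFinMk, Fin.isValue] <;>
      simp only [off_cross_zero, off_cross_one, off_cross_two, dg_add, off_add, add_mul, star_add,
        mul_add, add_smul, smul_add] <;> abel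

theorem cross_smul_left (t : L) : cross α β (t • x) y = t • cross α β x y := by
  apply ext_dg_off (α := α) (β := β) <;> intro i
  · rw [dg_smul]
    fin_cases i <;> dsimp only [Fin.zero_eta, Fin.mk_one, Fin.reduceFinMk, Fin.isValue] <;>
      simp only [dg_cross_zero, dg_cross_one, dg_cross_two, dg_smul, off_smul, smul_mul_assoc,
        QuaternionAlgebra.re_smul, smul_eq_mul] <;> ring
  · rw [off_smul]
    fin_cases i <;> dsimp only [Fin.zero_eta, Fin.mk_one, Fin.reduceFinMk, Fin.isValue] <;>
      simp only [off_cross_zero, off_cross_one, off_cross_two, dg_smul, off_smul, smul_mul_assoc,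
        QuaternionAlgebra.star_smul', mul_smul_comm, smul_add, smul_sub, smul_smul] <;> ring_nf

theorem cross_add_right : cross α β x (y + z) = cross α β x y + cross α β x z := by
  rw [cross_comm, cross_add_left, cross_comm y, cross_comm z]

theorem cross_smul_right (t : L) : cross α β x (t • y) = t • cross α β x y := by
  rw [cross_comm, cross_smul_left, cross_comm]

theorem cross_self : cross α β x x = (2 : L) • sharp α β x := by
  rw [cross, ← two_smul L x, sharp_smul, sub_sub, ← two_smul L (sharp α β x), ← sub_smul]
  norm_num

/-- Both sides are the full polarization of the cubic form `normN`, a symmetric trilinear form. -/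
theorem trPair_cross_rotate [CharZero L] :
    trPair α β (cross α β x y) z = trPair α β x (cross α β y z) := by
  simp only [trPair_eq, dg_cross_zero, dg_cross_one, dg_cross_two, off_cross_zero, off_cross_one,
    off_cross_two, re_mul, imI_mul, imJ_mul, imK_mul,
    QuaternionAlgebra.re_add, QuaternionAlgebra.imI_add, QuaternionAlgebra.imJ_add,
    QuaternionAlgebra.imK_add,
    QuaternionAlgebra.re_sub, QuaternionAlgebra.imI_sub, QuaternionAlgebra.imJ_sub,
    QuaternionAlgebra.imK_sub, QuaternionAlgebra.re_smul, QuaternionAlgebra.imI_smul,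
    QuaternionAlgebra.imJ_smul, QuaternionAlgebra.imK_smul,
    re_star, imI_star, imJ_star, imK_star, smul_eq_mul]
  ring

end Cross

end QuatG

end

/-! ### Unipotent maps, inversion and scaling on `W`, and their effect on the two forms. -/

noncomputable section
namespace QuatG

set_option linter.unusedSectionVars false

variable {α β : ℚ} {L : Type} [Field L]

section WCoordinates

@[simp] theorem wa_mkW (a d : L) (b c : H3 L) : wa (mkW a b c d) = a := rfl
@[simp] theorem wb_mkW (a d : L) (b c : H3 L) : wb (mkW a b c d) = b := rfl
@[simp] theorem wc_mkW (a d : L) (b c : H3 L) : wc (mkW a b c d) = c := rfl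
@[simp] theorem wd_mkW (a d : L) (b c : H3 L) : wd (mkW a b c d) = d := rfl

theorem W_ext {u v : W L} (h₁ : wa u = wa v) (h₂ : wb u = wb v) (h₃ : wc u = wc v)
    (h₄ : wd u = wd v) : u = v := by
  funext k
  rcases k with k | k | k | k
  exacts [h₁, congrFun h₂ k, congrFun h₃ k, h₄]

theorem mkW_eta (w : W L) : mkW (wa w) (wb w) (wc w) (wd w) = w := W_ext rfl rfl rfl rfl

theorem wa_add (u v : W L) : wa (u + v) = wa u + wa v := rfl
theorem wb_add (u v : W L) : wb (u + v) = wb u + wb v := rfl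
theorem wc_add (u v : W L) : wc (u + v) = wc u + wc v := rfl
theorem wd_add (u v : W L) : wd (u + v) = wd u + wd v := rfl
theorem wa_smul (t : L) (v : W L) : wa (t • v) = t * wa v := rfl
theorem wb_smul (t : L) (v : W L) : wb (t • v) = t • wb v := rfl
theorem wc_smul (t : L) (v : W L) : wc (t • v) = t • wc v := rfl
theorem wd_smul (t : L) (v : W L) : wd (t • v) = t * wd v := rfl

end WCoordinates

section LinearMaps

variable [CharZero L]

/-- The unipotent map `(a, b, c, d) ↦ (a, b + aA, c + b × A + aA^#, d + tr(c, A) + tr(b, A^#) +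
aN(A))` of `W`. -/
def translation (α β : ℚ) (A : H3 L) : W L →ₗ[L] W L where
  toFun w := mkW (wa w) (wb w + wa w • A) (wc w + cross α β (wb w) A + wa w • sharp α β A)
    (wd w + trPair α β (wc w) A + trPair α β (wb w) (sharp α β A) + wa w * normN α β A)
  map_add' u v := by
    apply W_ext <;> simp only [wa_add, wb_add, wc_add, wd_add, wa_mkW, wb_mkW, wc_mkW, wd_mkW,
      cross_add_left, trPair_add_left, add_smul]
    · abel
    · abel
    · ring
  map_smul' t v := by
    apply W_ext <;> simp only [wa_smul, wb_smul, wc_smul, wd_smul, wa_mkW, wb_mkW, wc_mkW, wd_mkW,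
      cross_smul_left, trPair_smul_left, smul_add, smul_smul, RingHom.id_apply]
    ring

theorem translation_apply (A : H3 L) (w : W L) : translation α β A w =
    mkW (wa w) (wb w + wa w • A) (wc w + cross α β (wb w) A + wa w • sharp α β A)
    (wd w + trPair α β (wc w) A + trPair α β (wb w) (sharp α β A) + wa w * normN α β A) := rfl

theorem cross_zero_right (x : H3 L) : cross α β x 0 = 0 := by
  simpa using cross_smul_right (α := α) (β := β) x 0 (0 : L)

theorem sharp_zero : sharp α β (0 : H3 L) = 0 := by
  simpa using sharp_smul (α := α) (β := β) (0 : H3 L) (0 : L)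

theorem normN_zero : normN α β (0 : H3 L) = 0 := by
  simpa using normN_smul (α := α) (β := β) (0 : H3 L) (0 : L)

theorem translation_zero : translation α β (0 : H3 L) = LinearMap.id := by
  apply LinearMap.ext; intro w
  apply W_ext <;> simp [translation_apply, cross_zero_right, sharp_zero, normN_zero,
    trPair_zero_right]

/-- This is the expansion of `sharp` and `normN` on a sum. Additivity also exhibits the translation
by `-A` as the inverse. -/
theorem translation_add (A B : H3 L) :
    translation α β (A + B) = translation α β B ∘ₗ translation α β A := by
  apply LinearMap.ext; intro w
  apply W_ext <;> simp only [translation_apply, LinearMap.comp_apply, wa_mkW, wb_mkW, wc_mkW,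
    wd_mkW, smul_add, cross_add_right, cross_add_left, cross_smul_left, sharp_add,
    trPair_add_right, trPair_add_left, trPair_smul_left, normN_add, trPair_cross_rotate]
  · abel
  · abel
  · ring

theorem symp_translation (A : H3 L) (u v : W L) :
    symp α β (translation α β A u) (translation α β A v) = symp α β u v := by
  have h₁ := trPair_cross_rotate (α := α) (β := β) (wb u) A (wb v)
  have h₂ := trPair_comm (α := α) (β := β) (x := wb v) (y := sharp α β A)
  have h₃ := trPair_comm (α := α) (β := β) (x := A) (y := wc v)
  have h₄ := cross_comm (α := α) (β := β) A (wb v)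
  have h₅ := trPair_cross_rotate (α := α) (β := β) A A (wb v)
  rw [h₄] at h₅
  rw [cross_self, trPair_smul_left] at h₅
  have h₆ := trPair_cross_rotate (α := α) (β := β) (wb u) A A
  rw [cross_self, trPair_smul_right] at h₆
  simp only [symp, translation_apply, wa_mkW, wb_mkW, wc_mkW, wd_mkW, trPair_add_left,
    trPair_add_right, trPair_smul_left, trPair_smul_right]
  rw [h₁, h₂, h₃, h₄, h₆, trPair_comm (x := sharp α β A) (y := A), ← h₅]
  ring

/-- The formula `a²Q(w) = (a²d - a tr(b, c) + 2N(b))² + 4N(ac - b^#)`. -/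
theorem sq_mul_quartic (w : W L) : wa w ^ 2 * quartic α β w =
    (wa w ^ 2 * wd w - wa w * trPair α β (wb w) (wc w) + 2 * normN α β (wb w)) ^ 2
      + 4 * normN α β (wa w • wc w - sharp α β (wb w)) := by
  rw [sub_eq_add_neg (wa w • wc w), normN_add, normN_neg, sharp_neg, sharp_sharp, normN_sharp, sharp_smul,
    normN_smul, trPair_neg_right, trPair_smul_left, trPair_smul_left, trPair_smul_right,
    trPair_comm (x := wc w), trPair_comm (x := sharp α β (wc w)), quartic]
  ring

/-- In `sq_mul_quartic`, both `ac - b^#` and `a²d - a tr(b, c) + 2N(b)` are unchanged by a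
translation. -/
theorem sq_mul_quartic_translation (A : H3 L) (w : W L) :
    wa w ^ 2 * quartic α β (translation α β A w) = wa w ^ 2 * quartic α β w := by
  have key := sq_mul_quartic (α := α) (β := β) (translation α β A w)
  have h₁ : wa (translation α β A w) = wa w := rfl
  rw [h₁] at key
  rw [key, sq_mul_quartic]
  have h₂ : wa w • wc (translation α β A w) - sharp α β (wb (translation α β A w)) =
      wa w • wc w - sharp α β (wb w) := by
    simp only [translation_apply, wb_mkW, wc_mkW, sharp_add, smul_add, cross_smul_right,
      sharp_smul, smul_smul, pow_two]
    abel
  have h₃ : wa w ^ 2 * wd (translation α β A w)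
      - wa w * trPair α β (wb (translation α β A w)) (wc (translation α β A w))
      + 2 * normN α β (wb (translation α β A w)) =
      wa w ^ 2 * wd w - wa w * trPair α β (wb w) (wc w) + 2 * normN α β (wb w) := by
    have h₅ := trPair_cross_rotate (α := α) (β := β) (wb w) (wb w) A
    rw [cross_self, trPair_smul_left] at h₅
    have h₆ := trPair_cross_rotate (α := α) (β := β) (wb w) A A
    rw [cross_self, trPair_smul_right] at h₆
    have h₇ := trPair_sharp_self (α := α) (β := β) A
    rw [trPair_comm] at h₇
    simp only [translation_apply, wb_mkW, wc_mkW, wd_mkW, trPair_add_left, trPair_add_right,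
      trPair_smul_left, trPair_smul_right, normN_add, normN_smul, sharp_smul, ← h₅,
      trPair_comm (x := A) (y := wc w), trPair_comm (x := A) (y := cross α β (wb w) A), h₆, h₇]
    ring
  rw [h₂, h₃]

/-- The map `(a, b, c, d) ↦ (-d, c, -b, a)` of `W`. -/
def inversion : W L →ₗ[L] W L where
  toFun w := mkW (-wd w) (wc w) (-wb w) (wa w)
  map_add' u v := by
    apply W_ext <;> simp only [wa_add, wb_add, wc_add, wd_add, wa_mkW, wb_mkW, wc_mkW, wd_mkW,
      neg_add]
  map_smul' t v := by
    apply W_ext <;> simp only [wa_smul, wb_smul, wc_smul, wd_smul, wa_mkW, wb_mkW, wc_mkW, wd_mkW,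
      smul_neg, RingHom.id_apply, mul_neg]

theorem inversion_apply (w : W L) : inversion w = mkW (-wd w) (wc w) (-wb w) (wa w) := rfl

theorem inversion_inversion (w : W L) : inversion (inversion w) = -w := by
  apply W_ext <;> simp only [inversion_apply, wa_mkW, wb_mkW, wc_mkW, wd_mkW] <;> rfl

theorem symp_inversion (u v : W L) : symp α β (inversion u) (inversion v) = symp α β u v := by
  simp only [symp, inversion_apply, wa_mkW, wb_mkW, wc_mkW, wd_mkW, trPair_neg_left,
    trPair_neg_right]
  ring

theorem quartic_inversion (w : W L) : quartic α β (inversion w) = quartic α β w := by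
  simp only [quartic, inversion_apply, wa_mkW, wb_mkW, wc_mkW, wd_mkW,
    trPair_neg_right, normN_neg, sharp_neg]
  rw [trPair_comm (x := wc w), trPair_comm (x := sharp α β (wc w))]
  ring

theorem symp_neg (u v : W L) : symp α β (-u) (-v) = symp α β u v := by
  rw [← inversion_inversion, ← inversion_inversion v, symp_inversion, symp_inversion]

theorem quartic_neg (w : W L) : quartic α β (-w) = quartic α β w := by
  rw [← inversion_inversion, quartic_inversion, quartic_inversion]

/-- The conjugate of a translation by the inversion. -/
def oppositeTranslation (α β : ℚ) (A : H3 L) : W L →ₗ[L] W L :=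
  -- The square of `inversion` is `-1`, so its inverse is its negative; hence the sign.
  -(inversion ∘ₗ translation α β A ∘ₗ inversion)

theorem oppositeTranslation_apply (A : H3 L) (w : W L) :
    oppositeTranslation α β A w = -inversion (translation α β A (inversion w)) := rfl

theorem oppositeTranslation_zero : oppositeTranslation α β (0 : H3 L) = LinearMap.id := by
  apply LinearMap.ext; intro w
  rw [oppositeTranslation_apply, translation_zero, LinearMap.id_apply, inversion_inversion,
    neg_neg, LinearMap.id_apply]

theorem oppositeTranslation_add (A B : H3 L) : oppositeTranslation α β (A + B) =
    oppositeTranslation α β B ∘ₗ oppositeTranslation α β A := by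
  apply LinearMap.ext; intro w
  rw [LinearMap.comp_apply, oppositeTranslation_apply, oppositeTranslation_apply,
    oppositeTranslation_apply, translation_add, map_neg, inversion_inversion, neg_neg]
  rfl

theorem symp_oppositeTranslation (A : H3 L) (u v : W L) :
    symp α β (oppositeTranslation α β A u) (oppositeTranslation α β A v) = symp α β u v := by
  rw [oppositeTranslation_apply, oppositeTranslation_apply, symp_neg, symp_inversion,
    symp_translation, symp_inversion]

/-- The diagonal map `(a, b, c, d) ↦ (t³a, tb, t⁻¹c, t⁻³d)` of `W`. -/
def scaling (t : L) : W L →ₗ[L] W L where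
  toFun w := mkW (t ^ 3 * wa w) (t • wb w) (t⁻¹ • wc w) (t⁻¹ ^ 3 * wd w)
  map_add' u v := by
    apply W_ext <;> simp only [wa_add, wb_add, wc_add, wd_add, wa_mkW, wb_mkW, wc_mkW, wd_mkW,
      mul_add, smul_add]
  map_smul' s v := by
    apply W_ext <;> simp only [wa_smul, wb_smul, wc_smul, wd_smul, wa_mkW, wb_mkW, wc_mkW, wd_mkW,
      RingHom.id_apply, smul_comm s, mul_left_comm s]

theorem scaling_apply (t : L) (w : W L) : scaling t w =
    mkW (t ^ 3 * wa w) (t • wb w) (t⁻¹ • wc w) (t⁻¹ ^ 3 * wd w) := rfl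

theorem scaling_one : scaling (1 : L) = LinearMap.id := by
  apply LinearMap.ext; intro w
  apply W_ext <;> simp [scaling_apply]

theorem scaling_mul (s t : L) : scaling (s * t) = scaling t ∘ₗ scaling s := by
  apply LinearMap.ext; intro w
  apply W_ext <;> simp only [scaling_apply, LinearMap.comp_apply, wa_mkW, wb_mkW, wc_mkW, wd_mkW,
    mul_inv, smul_smul, mul_comm s t]
  · ring
  · ring

theorem symp_scaling {t : L} (ht : t ≠ 0) (u v : W L) :
    symp α β (scaling t u) (scaling t v) = symp α β u v := by
  simp only [symp, scaling_apply, wa_mkW, wb_mkW, wc_mkW, wd_mkW, trPair_smul_left,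
    trPair_smul_right]
  field_simp

theorem quartic_scaling {t : L} (ht : t ≠ 0) (w : W L) :
    quartic α β (scaling t w) = quartic α β w := by
  simp only [quartic, scaling_apply, wa_mkW, wb_mkW, wc_mkW, wd_mkW, trPair_smul_left,
    trPair_smul_right, normN_smul, sharp_smul]
  field_simp

end LinearMaps

/-! ### Compatibility with extension of scalars. -/

section BaseChange

variable {K : Type} [Field K] (φ : L →+* K) [CharZero L] [CharZero K]

theorem re_off_map (x : H3 L) (i : Fin 3) :
    (off α β (fun k => φ (x k)) i).re = φ (off α β x i).re := rfl
theorem imI_off_map (x : H3 L) (i : Fin 3) :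
    (off α β (fun k => φ (x k)) i).imI = φ (off α β x i).imI := rfl
theorem imJ_off_map (x : H3 L) (i : Fin 3) :
    (off α β (fun k => φ (x k)) i).imJ = φ (off α β x i).imJ := rfl
theorem imK_off_map (x : H3 L) (i : Fin 3) :
    (off α β (fun k => φ (x k)) i).imK = φ (off α β x i).imK := rfl
theorem dg_map (x : H3 L) (i : Fin 3) : dg (fun k => φ (x k)) i = φ (dg x i) := rfl

theorem trPair_map (x y : H3 L) :
    trPair α β (fun k => φ (x k)) (fun k => φ (y k)) = φ (trPair α β x y) := by
  simp only [trPair_eq, re_mul, re_star, imI_star, imJ_star, imK_star, re_off_map, imI_off_map,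
    imJ_off_map, imK_off_map, dg_map, map_add, map_mul, map_sub, map_neg, map_ratCast, map_ofNat]

theorem normN_map (x : H3 L) : normN α β (fun k => φ (x k)) = φ (normN α β x) := by
  simp only [normN, qtr_eq, qnorm_eq, re_mul, imI_mul, imJ_mul, imK_mul, re_off_map, imI_off_map,
    imJ_off_map, imK_off_map, dg_map, map_add, map_mul, map_sub, map_pow, map_ratCast, map_ofNat]

theorem sharp_map (x : H3 L) : sharp α β (fun k => φ (x k)) = fun k => φ (sharp α β x k) := by
  apply ext_dg_off (α := α) (β := β) <;> intro i
  · fin_cases i <;> dsimp only [Fin.zero_eta, Fin.mk_one, Fin.reduceFinMk, Fin.isValue] <;>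
      simp only [dg_sharp_zero, dg_sharp_one, dg_sharp_two, qnorm_eq, re_off_map, imI_off_map,
        imJ_off_map, imK_off_map, dg_map, map_add, map_mul, map_sub, map_pow, map_ratCast]
  · fin_cases i <;> dsimp only [Fin.zero_eta, Fin.mk_one, Fin.reduceFinMk, Fin.isValue] <;> ext <;>
      simp only [off_sharp_zero, off_sharp_one, off_sharp_two, re_off_map, imI_off_map,
        imJ_off_map, imK_off_map, dg_map, re_mul, imI_mul, imJ_mul, imK_mul,
        QuaternionAlgebra.re_sub, QuaternionAlgebra.imI_sub, QuaternionAlgebra.imJ_sub,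
        QuaternionAlgebra.imK_sub, QuaternionAlgebra.re_smul, QuaternionAlgebra.imI_smul,
        QuaternionAlgebra.imJ_smul, QuaternionAlgebra.imK_smul,
        re_star, imI_star, imJ_star, imK_star, smul_eq_mul,
        map_add, map_mul, map_sub, map_neg, map_ratCast]

theorem cross_map (x y : H3 L) : cross α β (fun k => φ (x k)) (fun k => φ (y k)) =
    fun k => φ (cross α β x y k) := by
  have h : (fun k => φ (x k)) + (fun k => φ (y k)) = fun k => φ ((x + y) k) := by
    funext k; simp
  rw [cross, h, sharp_map, sharp_map, sharp_map]
  funext k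
  simp [cross]

theorem translation_map (A : H3 L) (w : W L) :
    translation α β (fun k => φ (A k)) (fun k => φ (w k)) =
      fun k => φ (translation α β A w k) := by
  have ha : wa (fun k => φ (w k)) = φ (wa w) := rfl
  have hb : wb (fun k => φ (w k)) = fun k => φ (wb w k) := rfl
  have hc : wc (fun k => φ (w k)) = fun k => φ (wc w k) := rfl
  have hd : wd (fun k => φ (w k)) = φ (wd w) := rfl
  rw [translation_apply, ha, hb, hc, hd, cross_map, sharp_map, trPair_map, trPair_map, normN_map,
    translation_apply]
  funext k
  rcases k with k | k | k | k <;> simp [mkW]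

theorem inversion_map (w : W L) :
    inversion (fun k => φ (w k)) = fun k => φ (inversion w k) := by
  funext k
  rcases k with k | k | k | k <;> simp [inversion_apply, mkW, wa, wb, wc, wd]

theorem oppositeTranslation_map (A : H3 L) (w : W L) :
    oppositeTranslation α β (fun k => φ (A k)) (fun k => φ (w k)) =
      fun k => φ (oppositeTranslation α β A w k) := by
  simp only [oppositeTranslation_apply, inversion_map, translation_map]
  funext k
  simp

theorem scaling_map (t : L) (w : W L) :
    scaling (φ t) (fun k => φ (w k)) = fun k => φ (scaling t w k) := by
  funext k
  rcases k with k | k | k | k <;> simp [scaling_apply, mkW, wa, wb, wc, wd]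

end BaseChange

end QuatG

end

/-! ### Continuous families of elements of `G^+(ℝ)` and their action on `ℋ`. -/

noncomputable section
namespace QuatG

set_option linter.unusedSectionVars false

variable {α β : ℚ}

section Continuity

variable {X : Type*} [TopologicalSpace X] {f g : X → H3 ℝ}

theorem Continuous.dg (hf : Continuous f) (i : Fin 3) : Continuous fun x => dg (f x) i :=
  (continuous_apply _).comp hf
theorem Continuous.re_off (hf : Continuous f) (i : Fin 3) :
    Continuous fun x => (off α β (f x) i).re := (continuous_apply _).comp hf
theorem Continuous.imI_off (hf : Continuous f) (i : Fin 3) :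
    Continuous fun x => (off α β (f x) i).imI := (continuous_apply _).comp hf
theorem Continuous.imJ_off (hf : Continuous f) (i : Fin 3) :
    Continuous fun x => (off α β (f x) i).imJ := (continuous_apply _).comp hf
theorem Continuous.imK_off (hf : Continuous f) (i : Fin 3) :
    Continuous fun x => (off α β (f x) i).imK := (continuous_apply _).comp hf

theorem Continuous.trPair (hf : Continuous f) (hg : Continuous g) :
    Continuous fun x => trPair α β (f x) (g x) := by
  have h₁ := Continuous.dg hf
  have h₂ := Continuous.re_off (α := α) (β := β) hf
  have h₃ := Continuous.imI_off (α := α) (β := β) hf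
  have h₄ := Continuous.imJ_off (α := α) (β := β) hf
  have h₅ := Continuous.imK_off (α := α) (β := β) hf
  have k₁ := Continuous.dg hg
  have k₂ := Continuous.re_off (α := α) (β := β) hg
  have k₃ := Continuous.imI_off (α := α) (β := β) hg
  have k₄ := Continuous.imJ_off (α := α) (β := β) hg
  have k₅ := Continuous.imK_off (α := α) (β := β) hg
  simp only [trPair_eq, re_mul, re_star, imI_star, imJ_star, imK_star]
  fun_prop

theorem Continuous.normN (hf : Continuous f) : Continuous fun x => normN α β (f x) := by
  have h₁ := Continuous.dg hf
  have h₂ := Continuous.re_off (α := α) (β := β) hf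
  have h₃ := Continuous.imI_off (α := α) (β := β) hf
  have h₄ := Continuous.imJ_off (α := α) (β := β) hf
  have h₅ := Continuous.imK_off (α := α) (β := β) hf
  simp only [QuatG.normN, qtr_eq, qnorm_eq, re_mul, imI_mul, imJ_mul, imK_mul]
  fun_prop

theorem continuous_of_dg_off (h₁ : ∀ i, Continuous fun x => QuatG.dg (f x) i)
    (h₂ : ∀ i, Continuous fun x => (off α β (f x) i).re)
    (h₃ : ∀ i, Continuous fun x => (off α β (f x) i).imI)
    (h₄ : ∀ i, Continuous fun x => (off α β (f x) i).imJ)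
    (h₅ : ∀ i, Continuous fun x => (off α β (f x) i).imK) : Continuous f := by
  refine continuous_pi fun k => ?_
  rcases k with i | ⟨i, l⟩
  · exact h₁ i
  · fin_cases l
    exacts [h₂ i, h₃ i, h₄ i, h₅ i]

theorem Continuous.sharp (hf : Continuous f) : Continuous fun x => sharp α β (f x) := by
  have h₁ := Continuous.dg hf
  have h₂ := Continuous.re_off (α := α) (β := β) hf
  have h₃ := Continuous.imI_off (α := α) (β := β) hf
  have h₄ := Continuous.imJ_off (α := α) (β := β) hf
  have h₅ := Continuous.imK_off (α := α) (β := β) hf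
  apply continuous_of_dg_off (α := α) (β := β) <;> intro i
  · fin_cases i <;> dsimp only [Fin.zero_eta, Fin.mk_one, Fin.reduceFinMk, Fin.isValue] <;>
      simp only [dg_sharp_zero, dg_sharp_one, dg_sharp_two, qnorm_eq] <;> fun_prop
  all_goals
    fin_cases i <;> dsimp only [Fin.zero_eta, Fin.mk_one, Fin.reduceFinMk, Fin.isValue] <;>
      simp only [off_sharp_zero, off_sharp_one, off_sharp_two,
        re_mul, imI_mul, imJ_mul, imK_mul,
        QuaternionAlgebra.re_sub, QuaternionAlgebra.imI_sub, QuaternionAlgebra.imJ_sub,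
        QuaternionAlgebra.imK_sub, QuaternionAlgebra.re_smul, QuaternionAlgebra.imI_smul,
        QuaternionAlgebra.imJ_smul, QuaternionAlgebra.imK_smul,
        re_star, imI_star, imJ_star, imK_star, smul_eq_mul] <;> fun_prop

theorem Continuous.cross (hf : Continuous f) (hg : Continuous g) :
    Continuous fun x => cross α β (f x) (g x) :=
  ((Continuous.sharp (hf.add hg)).sub (Continuous.sharp hf)).sub (Continuous.sharp hg)

theorem Continuous.mkW {a d : X → ℝ} (ha : Continuous a) (hf : Continuous f) (hg : Continuous g)
    (hd : Continuous d) : Continuous fun x => mkW (a x) (f x) (g x) (d x) := by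
  refine continuous_pi fun k => ?_
  rcases k with k | k | k | k
  exacts [ha, (continuous_apply k).comp hf, (continuous_apply k).comp hg, hd]

theorem continuous_wa : Continuous (wa : W ℝ → ℝ) := continuous_apply _
theorem continuous_wb : Continuous (wb : W ℝ → H3 ℝ) := continuous_pi fun _ => continuous_apply _
theorem continuous_wc : Continuous (wc : W ℝ → H3 ℝ) := continuous_pi fun _ => continuous_apply _
theorem continuous_wd : Continuous (wd : W ℝ → ℝ) := continuous_apply _

theorem continuous_quartic : Continuous (quartic α β : W ℝ → ℝ) := by
  have h₁ := Continuous.trPair (α := α) (β := β) continuous_wb continuous_wc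
  have h₂ := Continuous.trPair (α := α) (β := β) (Continuous.sharp (α := α) (β := β) continuous_wb)
    (Continuous.sharp (α := α) (β := β) continuous_wc)
  have h₃ := Continuous.normN (α := α) (β := β) continuous_wb
  have h₄ := Continuous.normN (α := α) (β := β) continuous_wc
  have h₅ := continuous_wa
  have h₆ := continuous_wd
  unfold quartic
  fun_prop

theorem Continuous.translation {w : X → W ℝ} (hf : Continuous f) (hw : Continuous w) :
    Continuous fun x => translation α β (f x) (w x) := by
  have h₁ := continuous_wa.comp hw
  have h₂ := continuous_wb.comp hw
  have h₃ := continuous_wc.comp hw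
  have h₄ := continuous_wd.comp hw
  refine Continuous.mkW h₁ (h₂.add (h₁.smul hf))
    ((h₃.add (Continuous.cross h₂ hf)).add (h₁.smul (Continuous.sharp hf)))
    (((h₄.add (Continuous.trPair h₃ hf)).add (Continuous.trPair h₂ (Continuous.sharp hf))).add
      (h₁.mul (Continuous.normN hf)))

theorem Continuous.inversion {w : X → W ℝ} (hw : Continuous w) :
    Continuous fun x => inversion (w x) :=
  Continuous.mkW (continuous_wd.comp hw).neg (continuous_wc.comp hw) (continuous_wb.comp hw).neg
    (continuous_wa.comp hw)

theorem Continuous.oppositeTranslation {w : X → W ℝ} (hf : Continuous f) (hw : Continuous w) :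
    Continuous fun x => oppositeTranslation α β (f x) (w x) :=
  (Continuous.inversion (Continuous.translation hf (Continuous.inversion hw))).neg

theorem Continuous.scaling {t : X → ℝ} {w : X → W ℝ} (ht : Continuous t) (h0 : ∀ x, t x ≠ 0)
    (hw : Continuous w) : Continuous fun x => scaling (t x) (w x) :=
  Continuous.mkW ((ht.pow 3).mul (continuous_wa.comp hw)) (ht.smul (continuous_wb.comp hw))
    ((ht.inv₀ h0).smul (continuous_wc.comp hw)) (((ht.inv₀ h0).pow 3).mul (continuous_wd.comp hw))

end Continuity

/-- Where `a ≠ 0`, cancel `a²` in `sq_mul_quartic_translation`. Both sides are continuous in `a` and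
the nonzero reals are dense, so the identity extends to `a = 0`. -/
theorem quartic_translation (A : H3 ℝ) (w : W ℝ) :
    quartic α β (translation α β A w) = quartic α β w := by
  have hw : Continuous fun t : ℝ => mkW t (wb w) (wc w) (wd w) :=
    Continuous.mkW continuous_id continuous_const continuous_const continuous_const
  have h := Continuous.ext_on (dense_compl_singleton (0 : ℝ))
    (continuous_quartic.comp (Continuous.translation (α := α) (β := β)
      (continuous_const (y := A)) hw))
    ((continuous_quartic (α := α) (β := β)).comp hw) (fun t ht => by
      have := sq_mul_quartic_translation (α := α) (β := β) A (mkW t (wb w) (wc w) (wd w))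
      exact mul_left_cancel₀ (pow_ne_zero 2 ht) this)
  simpa only [Function.comp_apply, mkW_eta] using congrFun h (wa w)

theorem quartic_oppositeTranslation (A : H3 ℝ) (w : W ℝ) :
    quartic α β (oppositeTranslation α β A w) = quartic α β w := by
  rw [oppositeTranslation_apply, quartic_neg, quartic_inversion, quartic_translation,
    quartic_inversion]

/-- The matrix that acts on row vectors by a given linear map. -/
def rightMatrix {L : Type} [Field L] (f : W L →ₗ[L] W L) : Matrix WIdx WIdx L :=
  (LinearMap.toMatrix' f).transpose

theorem vecMul_rightMatrix {L : Type} [Field L] (f : W L →ₗ[L] W L) (w : W L) :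
    Matrix.vecMul w (rightMatrix f) = f w := by
  rw [rightMatrix, Matrix.vecMul_transpose, LinearMap.toMatrix'_mulVec]

theorem rightMatrix_comp {L : Type} [Field L] (f g : W L →ₗ[L] W L) :
    rightMatrix (g ∘ₗ f) = rightMatrix f * rightMatrix g := by
  rw [rightMatrix, LinearMap.toMatrix'_comp, Matrix.transpose_mul]; rfl

theorem rightMatrix_id {L : Type} [Field L] :
    rightMatrix (LinearMap.id : W L →ₗ[L] W L) = 1 := by
  rw [rightMatrix, LinearMap.toMatrix'_id, Matrix.transpose_one]

/-- An additive family of linear maps of `W`, acting on the right, as elements of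
`GL(W) × GL_1` with similitude factor `1`. -/
def glFamily {V L : Type} [AddCommGroup V] [Field L] (f : V → W L →ₗ[L] W L)
    (h₀ : f 0 = LinearMap.id) (h : ∀ u v, f (u + v) = f v ∘ₗ f u) (v : V) : GLW L :=
  (⟨rightMatrix (f v), rightMatrix (f (-v)),
    by rw [← rightMatrix_comp, ← h, add_neg_cancel, h₀, rightMatrix_id],
    by rw [← rightMatrix_comp, ← h, neg_add_cancel, h₀, rightMatrix_id]⟩, 1)

section Family

variable {V L : Type} [AddCommGroup V] [Field L] {f : V → W L →ₗ[L] W L}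
  (h₀ : f 0 = LinearMap.id) (h : ∀ u v, f (u + v) = f v ∘ₗ f u)

theorem ract_glFamily (v : V) (w : W L) : ract w (glFamily f h₀ h v) = f v w :=
  vecMul_rightMatrix _ _

theorem glFamily_inv (v : V) : (glFamily f h₀ h v)⁻¹ = glFamily f h₀ h (-v) := by
  refine Prod.ext (Units.ext ?_) (inv_one)
  rfl

theorem glFamily_zero : glFamily f h₀ h 0 = 1 :=
  Prod.ext (Units.ext (by change rightMatrix (f 0) = 1; rw [h₀, rightMatrix_id])) rfl

end Family

section Real

variable {V : Type} [AddCommGroup V] [TopologicalSpace V]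
  {f : V → W ℝ →ₗ[ℝ] W ℝ} (h₀ : f 0 = LinearMap.id)
  (h : ∀ u v, f (u + v) = f v ∘ₗ f u)

theorem glFamily_mem_GG (hs : ∀ v u w, symp α β (f v u) (f v w) = symp α β u w)
    (hq : ∀ v w, quartic α β (f v w) = quartic α β w) (v : V) :
    glFamily f h₀ h v ∈ GG α β ℝ := by
  refine ⟨fun u w => ?_, fun w => ?_⟩
  · rw [ract_glFamily, ract_glFamily, hs]
    simp [glFamily]
  · rw [ract_glFamily, hq]
    simp [glFamily]

theorem continuous_rightMatrix (hc : ∀ w, Continuous fun v => f v w) :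
    Continuous fun v => rightMatrix (f v) := by
  refine continuous_matrix fun i j => ?_
  simp only [rightMatrix, Matrix.transpose_apply, LinearMap.toMatrix'_apply]
  exact (continuous_apply j).comp (hc _)

theorem continuous_glFamily [ContinuousNeg V] (hc : ∀ w, Continuous fun v => f v w) :
    Continuous (glFamily f h₀ h) := by
  refine Continuous.prodMk (Units.continuous_iff.2 ⟨?_, ?_⟩) continuous_const
  · exact continuous_rightMatrix hc
  · exact (continuous_rightMatrix hc).comp continuous_neg

/-- The family is continuous on a connected space and takes the value `1` at `0`, so its range lies
in the identity component. -/
theorem glFamily_mem_GPlus [ContinuousNeg V] [PreconnectedSpace V]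
    (hs : ∀ v u w, symp α β (f v u) (f v w) = symp α β u w)
    (hq : ∀ v w, quartic α β (f v w) = quartic α β w)
    (hc : ∀ w, Continuous fun v => f v w) (v : V) :
    glFamily f h₀ h v ∈ GPlus α β := by
  have hm := glFamily_mem_GG h₀ h hs hq
  have hcont : Continuous fun v => (⟨glFamily f h₀ h v, hm v⟩ : GG α β ℝ) :=
    (continuous_glFamily h₀ h hc).subtype_mk _
  refine Subgroup.mem_map.2 ⟨⟨_, hm v⟩, ?_, rfl⟩
  refine (isPreconnected_range hcont).subset_connectedComponent ⟨0, ?_⟩ ⟨v, rfl⟩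
  exact Subtype.ext (glFamily_zero h₀ h)

end Real

/-- The unipotent element of `G(ℝ)` that translates `ℋ` by `A`. -/
def translationGL (α β : ℚ) (A : H3 ℝ) : GLW ℝ :=
  glFamily (fun A => translation α β A) translation_zero translation_add A

/-- The opposite unipotent element of `G(ℝ)` attached to `A`. -/
def oppositeGL (α β : ℚ) (A : H3 ℝ) : GLW ℝ :=
  glFamily (fun A => oppositeTranslation α β A) oppositeTranslation_zero
    oppositeTranslation_add A

/-- The element of `G(ℝ)` that scales `ℋ` by `e^{2s}`. -/
def scalingGL (s : ℝ) : GLW ℝ :=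
  glFamily (fun s : ℝ => scaling (Real.exp s)) (by rw [Real.exp_zero, scaling_one])
    (fun s t => by rw [Real.exp_add, scaling_mul]) s

theorem translationGL_mem (A : H3 ℝ) : translationGL α β A ∈ GPlus α β :=
  glFamily_mem_GPlus _ _ (fun _ => symp_translation _) (fun _ => quartic_translation _)
    (fun _ => Continuous.translation continuous_id continuous_const) A

theorem oppositeGL_mem (A : H3 ℝ) : oppositeGL α β A ∈ GPlus α β :=
  glFamily_mem_GPlus _ _ (fun _ => symp_oppositeTranslation _)
    (fun _ => quartic_oppositeTranslation _)
    (fun _ => Continuous.oppositeTranslation continuous_id continuous_const) A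

theorem scalingGL_mem (s : ℝ) : scalingGL s ∈ GPlus α β :=
  glFamily_mem_GPlus _ _ (fun s => symp_scaling (Real.exp_ne_zero s))
    (fun s => quartic_scaling (Real.exp_ne_zero s))
    (fun _ => Continuous.scaling Real.continuous_exp (fun s => Real.exp_ne_zero s)
      continuous_const) s

theorem GPlus_le_GG : GPlus α β ≤ GG α β ℝ := Subgroup.map_subtype_le _

section ToC

/-- Both sides are complex linear in `w` and agree on the standard basis, which is real. -/
theorem ract_toC {g : GLW ℝ} {f : W ℂ →ₗ[ℂ] W ℂ}
    (h : ∀ w : W ℝ, f (fun k => (w k : ℂ)) = fun k => ((ract w g k : ℝ) : ℂ)) (w : W ℂ) :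
    ract w (toC g) = f w := by
  rw [← vecMul_rightMatrix, ract]
  congr 1
  ext i j
  have := congrFun (h (Pi.single i 1)) j
  simp only [rightMatrix, Matrix.transpose_apply, LinearMap.toMatrix'_apply]
  have e : (fun k => (((Pi.single i 1 : W ℝ) k : ℝ) : ℂ)) = Pi.single i 1 := by
    funext k
    by_cases hk : k = i
    · subst hk; simp
    · simp [hk]
  rw [e] at this
  rw [this, ract, Matrix.single_one_vecMul]
  rfl

theorem toC_mul (g h : GLW ℝ) : toC (g * h) = toC g * toC h := by
  simp [toC]

theorem ract_translationGL_toC (A : H3 ℝ) (w : W ℂ) :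
    ract w (toC (translationGL α β A)) = translation α β (fun k => (A k : ℂ)) w :=
  ract_toC (fun w => by
    rw [translationGL, ract_glFamily]; exact translation_map Complex.ofRealHom A w) w

theorem ract_oppositeGL_toC (A : H3 ℝ) (w : W ℂ) :
    ract w (toC (oppositeGL α β A)) = oppositeTranslation α β (fun k => (A k : ℂ)) w :=
  ract_toC (fun w => by
    rw [oppositeGL, ract_glFamily]; exact oppositeTranslation_map Complex.ofRealHom A w) w

theorem ract_scalingGL_toC (s : ℝ) (w : W ℂ) :
    ract w (toC (scalingGL s)) = scaling (Real.exp s : ℂ) w :=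
  ract_toC (fun w => by
    rw [scalingGL, ract_glFamily]; exact scaling_map Complex.ofRealHom (Real.exp s) w) w

end ToC

section Action

/-- The vector `r(Z)` is the image of `(1, 0, 0, 0)` under the translation by `-Z`, so additivity of
translations suffices. -/
theorem translation_rvec (A : H3 ℂ) (Z : H3 ℂ) :
    translation α β A (rvec α β Z) = rvec α β (Z - A) := by
  have h : ∀ Z, rvec α β Z = translation α β (-Z) (mkW 1 0 0 0) := by
    intro Z
    rw [translation_apply]
    apply W_ext <;> simp [rvec, cross_comm (α := α) (β := β) 0, cross_zero_right,
      trPair_zero_left, sharp_neg, normN_neg]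
  rw [h, h, neg_sub, sub_eq_neg_add, translation_add, LinearMap.comp_apply]

theorem jfac_translationGL (A : H3 ℝ) (Z : H3 ℂ) : jfac α β (translationGL α β A) Z = 1 := by
  rw [jfac, translationGL, glFamily_inv, ← translationGL, ract_translationGL_toC, translation_rvec]
  rfl

theorem act_translationGL (A : H3 ℝ) (Z : H3 ℂ) :
    act α β (translationGL α β A) Z = Z + fun k => (A k : ℂ) := by
  rw [act, jfac_translationGL, translationGL, glFamily_inv, ← translationGL,
    ract_translationGL_toC, translation_rvec]
  funext k
  simp [rvec]

end Action

end QuatG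

end

/-! ### Commensurability of lattices and the periods of a modular form. -/

noncomputable section
namespace QuatG

set_option linter.unusedSectionVars false

variable {α β : ℚ}

theorem exists_common_denominator {ι : Type*} [Finite ι] (q : ι → ℚ) :
    ∃ N : ℕ, 0 < N ∧ ∀ i, ∃ z : ℤ, (N : ℚ) * q i = z := by
  classical
  cases nonempty_fintype ι
  refine ⟨∏ i, (q i).den, Finset.prod_pos fun i _ => (q i).pos, fun i => ?_⟩
  refine ⟨(∏ j ∈ Finset.univ.erase i, (q j).den : ℕ) * (q i).num, ?_⟩
  rw [← Finset.mul_prod_erase Finset.univ (fun j => (q j).den) (Finset.mem_univ i)]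
  push_cast
  have := Rat.den_mul_eq_num (q i)
  linear_combination (∏ j ∈ Finset.univ.erase i, ((q j).den : ℚ)) * this

/-- Vectors of rational numbers with integral entries. -/
def IntegralVec {ι : Type*} (v : ι → ℚ) : Prop := ∀ k, ∃ z : ℤ, v k = z

namespace IntegralVec

variable {ι : Type*} {u v : ι → ℚ}

theorem add (hu : IntegralVec u) (hv : IntegralVec v) : IntegralVec (u + v) := fun k => by
  obtain ⟨a, ha⟩ := hu k
  obtain ⟨b, hb⟩ := hv k
  exact ⟨a + b, by simp [ha, hb]⟩

theorem intCast_smul (hv : IntegralVec v) (n : ℤ) : IntegralVec ((n : ℚ) • v) := fun k => by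
  obtain ⟨b, hb⟩ := hv k
  exact ⟨n * b, by simp [hb]⟩

end IntegralVec

theorem exists_mul_integral_linearMap (f : W ℚ →ₗ[ℚ] W ℚ) :
    ∃ N : ℕ, 0 < N ∧ ∀ v, IntegralVec v → IntegralVec ((N : ℚ) • f v) := by
  obtain ⟨N, hN, h⟩ := exists_common_denominator
    (fun p : WIdx × WIdx => rightMatrix f p.1 p.2)
  refine ⟨N, hN, fun v hv j => ?_⟩
  choose z hz using h
  choose y hy using hv
  refine ⟨∑ i, y i * z (i, j), ?_⟩
  rw [Pi.smul_apply, ← vecMul_rightMatrix, smul_eq_mul, Matrix.vecMul, dotProduct,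
    Finset.mul_sum]
  push_cast
  refine Finset.sum_congr rfl fun i _ => ?_
  rw [hy, ← hz (i, j)]
  ring

section Order

variable {B₀ : Subring (Quat α β ℚ)}

theorem exists_smul_mem_of_mem_span {x : Quat α β ℚ}
    (hx : x ∈ Submodule.span ℚ (B₀ : Set (Quat α β ℚ))) :
    ∃ N : ℕ, 0 < N ∧ (N : ℚ) • x ∈ B₀ := by
  induction hx using Submodule.span_induction with
  | mem x hx => exact ⟨1, one_pos, by simpa using hx⟩
  | zero => exact ⟨1, one_pos, by simp [B₀.zero_mem]⟩
  | add x y _ _ hx hy =>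
    obtain ⟨m, hm, hx⟩ := hx
    obtain ⟨n, hn, hy⟩ := hy
    refine ⟨m * n, Nat.mul_pos hm hn, ?_⟩
    have : ((m * n : ℕ) : ℚ) • (x + y) = n • ((m : ℚ) • x) + m • ((n : ℚ) • y) := by
      rw [← Nat.cast_smul_eq_nsmul ℚ, ← Nat.cast_smul_eq_nsmul ℚ, smul_smul, smul_smul, smul_add]
      push_cast
      rw [mul_comm (n : ℚ)]
    rw [this]
    exact add_mem (nsmul_mem hx n) (nsmul_mem hy m)
  | smul q x _ hx =>
    obtain ⟨n, hn, hx⟩ := hx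
    refine ⟨n * q.den, Nat.mul_pos hn q.pos, ?_⟩
    have : ((n * q.den : ℕ) : ℚ) • q • x = q.num • ((n : ℚ) • x) := by
      rw [← Int.cast_smul_eq_zsmul ℚ, smul_smul, smul_smul]
      congr 1
      push_cast
      linear_combination (n : ℚ) * Rat.den_mul_eq_num q
    rw [this]
    exact zsmul_mem hx _

/-- The coordinates of a quaternion with respect to `1, i, j, k`. -/
def quatCoord (x : Quat α β ℚ) : Fin 4 → ℚ := ![x.re, x.imI, x.imJ, x.imK]

theorem quatCoord_off (h : H3 ℚ) (i : Fin 3) (l : Fin 4) :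
    quatCoord (off α β h i) l = h (Sum.inr (i, l)) := by
  fin_cases l <;> rfl

theorem exists_mem_of_integral (hB : Submodule.span ℚ (B₀ : Set (Quat α β ℚ)) = ⊤) :
    ∃ D : ℕ, 0 < D ∧ ∀ x : Quat α β ℚ, IntegralVec (quatCoord x) → (D : ℚ) • x ∈ B₀ := by
  have h : ∀ x : Quat α β ℚ, ∃ N : ℕ, 0 < N ∧ (N : ℚ) • x ∈ B₀ := fun x =>
    exists_smul_mem_of_mem_span (by rw [hB]; trivial)
  obtain ⟨a, ha, ha'⟩ := h ⟨1, 0, 0, 0⟩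
  obtain ⟨b, hb, hb'⟩ := h ⟨0, 1, 0, 0⟩
  obtain ⟨c, hc, hc'⟩ := h ⟨0, 0, 1, 0⟩
  obtain ⟨d, hd, hd'⟩ := h ⟨0, 0, 0, 1⟩
  refine ⟨a * b * c * d, by positivity, fun x hx => ?_⟩
  obtain ⟨p, hp⟩ := hx 0
  obtain ⟨q, hq⟩ := hx 1
  obtain ⟨r, hr⟩ := hx 2
  obtain ⟨s, hs⟩ := hx 3
  have hp : x.re = p := hp
  have hq : x.imI = q := hq
  have hr : x.imJ = r := hr
  have hs : x.imK = s := hs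
  have hmem := add_mem (add_mem (add_mem (zsmul_mem ha' (p * (b * c * d)))
    (zsmul_mem hb' (q * (a * c * d)))) (zsmul_mem hc' (r * (a * b * d))))
    (zsmul_mem hd' (s * (a * b * c)))
  convert hmem using 1
  simp only [← Int.cast_smul_eq_zsmul ℚ, smul_smul]
  ext <;> simp [hp, hq, hr, hs] <;> ring

theorem exists_integral_of_mem (hB : B₀.toAddSubgroup.FG) :
    ∃ D : ℕ, 0 < D ∧ ∀ x ∈ B₀, IntegralVec ((D : ℚ) • quatCoord x) := by
  obtain ⟨S, hS⟩ := hB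
  obtain ⟨D, hD, h⟩ := exists_common_denominator
    (fun p : S × Fin 4 => quatCoord (p.1 : Quat α β ℚ) p.2)
  refine ⟨D, hD, fun x hx => ?_⟩
  have hx' : x ∈ AddSubgroup.closure (S : Set (Quat α β ℚ)) := by rw [hS]; exact hx
  clear hx
  induction hx' using AddSubgroup.closure_induction with
  | mem x hx => exact fun l => h (⟨x, hx⟩, l)
  | zero =>
    intro l
    exact ⟨0, by fin_cases l <;> simp [quatCoord]⟩
  | add x y hx' hy' hx hy =>
    have : (D : ℚ) • quatCoord (x + y) = (D : ℚ) • quatCoord x + (D : ℚ) • quatCoord y := by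
      rw [← smul_add]; congr 1
      funext l; fin_cases l <;> simp [quatCoord]
    rw [this]
    exact hx.add hy
  | neg x hx' hx =>
    have : (D : ℚ) • quatCoord (-x) = ((-1 : ℤ) : ℚ) • ((D : ℚ) • quatCoord x) := by
      funext l; fin_cases l <;> simp [quatCoord]
    rw [this]
    exact hx.intCast_smul _

/-- The lattice `W(ℤ)` lies between `D ℤ^32` and `D⁻¹ ℤ^32`: the lower bound holds because the order
spans `B`, the upper one because it is finitely generated. -/
theorem IsOrder.exists_lattice_bounds (hB : IsOrder B₀) :
    ∃ D : ℕ, 0 < D ∧ (∀ v : W ℚ, IntegralVec v → (fun k => (((D : ℚ) • v) k : ℝ)) ∈ Wint B₀) ∧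
      ∀ w ∈ Wint B₀, ∃ v : W ℚ, IntegralVec ((D : ℚ) • v) ∧ w = fun k => (v k : ℝ) := by
  obtain ⟨m, hm, h₁⟩ := exists_mem_of_integral hB.2
  obtain ⟨n, hn, h₂⟩ := exists_integral_of_mem hB.1
  refine ⟨m * n, Nat.mul_pos hm hn, fun v hv => ?_, ?_⟩
  · have hD : ∀ k, ∃ z : ℤ, (((m * n : ℕ) : ℚ) • v) k = z := fun k => by
      obtain ⟨z, hz⟩ := hv k
      exact ⟨(m * n : ℕ) * z, by simp [hz]⟩
    have hH : ∀ x : H3 ℚ, IntegralVec x → ((m * n : ℕ) : ℚ) • x ∈ H3int B₀ := fun x hx => by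
      refine ⟨fun i => ?_, fun i => ?_⟩
      · obtain ⟨z, hz⟩ := hx (Sum.inl i)
        exact ⟨(m * n : ℕ) * z, by simp [dg, hz]⟩
      · have := h₁ ((n : ℚ) • off α β x i) (fun l => by
          rw [← off_smul, quatCoord_off]
          exact hx.intCast_smul (n : ℤ) _)
        rwa [smul_smul, ← Nat.cast_mul, ← off_smul] at this
    exact ⟨_, hD _, hH (wb v) fun k => hv _, hH (wc v) fun k => hv _, hD _, rfl⟩
  · rintro _ ⟨v, ha, hb, hc, hd, rfl⟩
    refine ⟨v, ?_, rfl⟩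
    have hZ : ∀ q : ℚ, (∃ z : ℤ, q = z) → ∃ z : ℤ, ((m * n : ℕ) : ℚ) * q = z := by
      rintro q ⟨z, hz⟩
      exact ⟨(m * n : ℕ) * z, by simp [hz]⟩
    have hH : ∀ x ∈ H3int B₀, ∀ k, ∃ z : ℤ, ((m * n : ℕ) : ℚ) * x k = z := by
      rintro x ⟨hx₁, hx₂⟩ (i | ⟨i, l⟩)
      · exact hZ _ (hx₁ i)
      · obtain ⟨z, hz⟩ := h₂ _ (hx₂ i) l
        rw [Pi.smul_apply, smul_eq_mul, quatCoord_off] at hz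
        refine ⟨m * z, ?_⟩
        push_cast
        rw [mul_assoc, hz]
    rintro (k | k | k | k)
    exacts [hZ _ ha, hH _ hb k, hH _ hc k, hZ _ hd]

end Order

/-- The derivative at `0` of `t ↦ translation (tA)`. -/
def infinitesimalTranslation (α β : ℚ) {L : Type} [Field L] [CharZero L] (A : H3 L) :
    W L →ₗ[L] W L where
  toFun w := mkW 0 (wa w • A) (cross α β (wb w) A) (trPair α β (wc w) A)
  map_add' u v := by
    apply W_ext <;> simp only [wa_add, wb_add, wc_add, wd_add, wa_mkW, wb_mkW, wc_mkW, wd_mkW,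
      cross_add_left, trPair_add_left, add_smul, add_zero]
  map_smul' t v := by
    apply W_ext <;> simp only [wa_smul, wb_smul, wc_smul, wd_smul, wa_mkW, wb_mkW, wc_mkW, wd_mkW,
      cross_smul_left, trPair_smul_left, smul_smul, RingHom.id_apply, mul_zero]

/-- The translation by `tA` is the exponential of `t` times a map whose fourth power is zero. So it
is polynomial in `t` with denominators dividing `6`, and becomes the identity modulo `M` when `t` is
divisible enough. -/
theorem translation_smul_eq {L : Type} [Field L] [CharZero L] (A : H3 L) (t : L) (w : W L) :
    translation α β (t • A) w = w + t • infinitesimalTranslation α β A w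
      + (t ^ 2 / 2) • infinitesimalTranslation α β A (infinitesimalTranslation α β A w)
      + (t ^ 3 / 6) • infinitesimalTranslation α β A
          (infinitesimalTranslation α β A (infinitesimalTranslation α β A w)) := by
  have e : ∀ w, infinitesimalTranslation α β A w =
    mkW 0 (wa w • A) (cross α β (wb w) A) (trPair α β (wc w) A) := fun _ => rfl
  apply W_ext <;> simp only [e, translation_apply, wa_add, wb_add, wc_add, wd_add, wa_smul,
    wb_smul, wc_smul, wd_smul, wa_mkW, wb_mkW, wc_mkW, wd_mkW, cross_smul_left, cross_smul_right,
    cross_self, trPair_smul_right, trPair_smul_left, sharp_smul, normN_smul, trPair_cross_rotate,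
    trPair_sharp_self, zero_smul, smul_zero, mul_zero, add_zero, smul_smul,
    cross_comm (α := α) (β := β) 0 A, cross_zero_right]
  · rw [mul_comm]
  · congr 2
    ring
  · ring

theorem exists_period_translationGL {B₀ : Subring (Quat α β ℚ)} (hB : IsOrder B₀) (M : ℕ)
    (hM : 0 < M) (A : H3 ℚ) : ∃ T : ℕ, 0 < T ∧ ∀ z : ℤ,
      translationGL α β (fun k => (((T * z : ℚ) • A) k : ℝ)) ∈ GammaPrincipal B₀ M := by
  obtain ⟨D, hD, h₁, h₂⟩ := hB.exists_lattice_bounds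
  obtain ⟨E, hE, hf⟩ := exists_mul_integral_linearMap (infinitesimalTranslation α β A)
  set f := infinitesimalTranslation α β A with hfdef
  -- The `6` clears the factorials and `E ^ 3` the denominators of up to three applications of `f`.
  -- One factor `D` makes the coordinates of a lattice vector integral, the other returns an
  -- integral vector to `W(ℤ)`.
  refine ⟨6 * M * D ^ 2 * E ^ 3, by positivity, ?_⟩
  have key : ∀ z : ℤ, ∀ w ∈ Wint B₀, ∃ v ∈ Wint B₀,
      ract w (translationGL α β (fun k => ((((6 * M * D ^ 2 * E ^ 3 : ℕ) * z : ℚ) • A) k : ℝ))) =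
        w + (M : ℝ) • v := by
    intro z w hw
    obtain ⟨v, hv, rfl⟩ := h₂ w hw
    set u := (D : ℚ) • v with hu
    have e₁ := hf u hv
    have e₂ := hf _ e₁
    have e₃ := hf _ e₂
    have hvint := ((e₁.intCast_smul (6 * E ^ 2 * z)).add
      (e₂.intCast_smul (18 * M * D ^ 2 * E ^ 4 * z ^ 2))).add
      (e₃.intCast_smul (36 * M ^ 2 * D ^ 4 * E ^ 6 * z ^ 3))
    refine ⟨_, h₁ _ hvint, ?_⟩
    rw [translationGL, ract_glFamily]
    refine (translation_map (Rat.castHom ℝ) _ v).trans ?_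
    rw [translation_smul_eq, ← hfdef]
    funext k
    simp only [map_smul, hu, Pi.add_apply, Pi.smul_apply, smul_eq_mul, eq_ratCast]
    push_cast
    ring
  intro z
  have hGZ : translationGL α β (fun k => ((((6 * M * D ^ 2 * E ^ 3 : ℕ) * z : ℚ) • A) k : ℝ)) ∈
      GZ B₀ := by
    refine ⟨GPlus_le_GG (translationGL_mem _), fun w => ⟨fun hw => ?_, fun hw => ?_⟩, Or.inl rfl⟩
    -- The inverse is the translation for `-z`, to which the same congruence applies.
    · obtain ⟨v, hv, e⟩ := key (-z) _ hw
      have e' : (fun k => ((((6 * M * D ^ 2 * E ^ 3 : ℕ) * (-z : ℤ) : ℚ) • A) k : ℝ)) =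
          -fun k => ((((6 * M * D ^ 2 * E ^ 3 : ℕ) * z : ℚ) • A) k : ℝ) := by
        funext k; simp
      rw [e', ← ract_mul, translationGL, translationGL, ← glFamily_inv, mul_inv_cancel,
        ract_one] at e
      rw [e]
      refine add_mem hw ?_
      rw [Nat.cast_smul_eq_nsmul]
      exact nsmul_mem hv M
    · obtain ⟨v, hv, e⟩ := key z _ hw
      rw [e]
      refine add_mem hw ?_
      rw [Nat.cast_smul_eq_nsmul]
      exact nsmul_mem hv M
  exact ⟨hGZ, key z⟩

/-- A modular form is periodic in each coordinate, with a common integral period. -/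
theorem IsModularForm.exists_period {B₀ : Subring (Quat α β ℚ)} (hB : IsOrder B₀) {M : ℕ}
    (hM : 0 < M) {Γ : Subgroup (GLW ℝ)} (hΓ : IsCongruenceSubgroup B₀ M Γ) {r : ℕ}
    {F : H3 ℂ → ℂ} (hF : IsModularForm α β r Γ F) :
    ∃ T : ℕ, 0 < T ∧ ∀ Z ∈ HH α β, ∀ k, F (Z + Pi.single k (T : ℂ)) = F Z := by
  choose t ht h using fun k : HIdx =>
    exists_period_translationGL hB M hM (Pi.single k 1)
  -- The product of the periods is a common one: in direction `k` it is `t k` times the integer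
  -- formed by the other factors.
  refine ⟨∏ k, t k, Finset.prod_pos fun k _ => ht k, fun Z hZ k => ?_⟩
  have := hF.slash_eq _ (hΓ.1 (h k (∏ j ∈ Finset.univ.erase k, t j : ℕ))) (translationGL_mem _) Z hZ
  rw [slash, jfac_translationGL, act_translationGL] at this
  have h1 : ∀ A : H3 ℝ, (translationGL α β A).2 = 1 := fun _ => rfl
  rw [h1] at this
  simp only [Units.val_one, Complex.ofReal_one, one_pow, inv_one, one_mul] at this
  rw [← this]
  congr 2
  rw [← Finset.mul_prod_erase Finset.univ t (Finset.mem_univ k)]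
  funext j
  by_cases hj : j = k
  · subst hj; simp
  · simp [hj]

end QuatG

end

/-! ### Fourier series of periodic holomorphic functions on tube domains. -/

noncomputable section
namespace QuatG

set_option linter.unusedSectionVars false


section Tube

open MeasureTheory Filter Topology

/-- A finite set of indices lies in the box spanned by its projections, and over a box the sum of
products factors. -/
theorem summable_prod_apply {ι κ : Type*} [Fintype ι] {g : κ → ℝ} (hg : ∀ k, 0 ≤ g k)
    (hs : Summable g) : Summable fun m : ι → κ => ∏ i, g (m i) := by
  classical
  refine summable_of_sum_le (c := ∏ _i : ι, ∑' k, g k)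
    (fun m => Finset.prod_nonneg fun i _ => hg _) fun s => ?_
  calc ∑ m ∈ s, ∏ i, g (m i)
      ≤ ∑ m ∈ Fintype.piFinset fun i => s.image fun m => m i, ∏ i, g (m i) := by
        refine Finset.sum_le_sum_of_subset_of_nonneg (fun m hm => ?_)
          fun m _ _ => Finset.prod_nonneg fun i _ => hg _
        exact Fintype.mem_piFinset.2 fun i => Finset.mem_image_of_mem _ hm
    _ = ∏ i, ∑ k ∈ s.image (fun m => m i), g k := (Finset.prod_univ_sum _ _).symm
    _ ≤ ∏ _i : ι, ∑' k, g k :=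
        Finset.prod_le_prod (fun i _ => Finset.sum_nonneg fun k _ => hg k)
          fun i _ => hs.sum_le_tsum _ fun k _ => hg k

theorem summable_exp_neg_mul_abs {c : ℝ} (hc : 0 < c) :
    Summable fun n : ℤ => Real.exp (-(c * |(n : ℝ)|)) := by
  have h : Summable fun n : ℕ => Real.exp (-(c * |(((n : ℕ) : ℤ) : ℝ)|)) := by
    have := summable_geometric_of_lt_one (Real.exp_nonneg (-c)) (by simpa using hc)
    refine this.congr fun n => ?_
    rw [← Real.exp_nat_mul]
    congr 1
    simp
    ring
  exact Summable.of_nat_of_neg h (by simpa using h)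

variable {ι : Type} [Fintype ι]

/-- The tube domain `ℝ^ι + iΩ`. -/
def tube (Ω : Set (ι → ℝ)) : Set (ι → ℂ) := {Z | (fun k => (Z k).im) ∈ Ω}

theorem continuous_im_pi : Continuous fun Z : ι → ℂ => fun k => (Z k).im := by fun_prop

theorem isOpen_tube {Ω : Set (ι → ℝ)} (hΩ : IsOpen Ω) : IsOpen (tube Ω) :=
  hΩ.preimage continuous_im_pi

theorem add_ofReal_mem_tube {Ω : Set (ι → ℝ)} {Z : ι → ℂ} (hZ : Z ∈ tube Ω) (x : ι → ℝ) :
    (Z + fun k => (x k : ℂ)) ∈ tube Ω := by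
  simpa [tube] using hZ

/-- The character `e(m · Z) = exp(2πi ∑ m_k Z_k)`. -/
def expChar (m : ι → ℤ) (Z : ι → ℂ) : ℂ := Complex.exp (2 * Real.pi * Complex.I * ∑ k, m k * Z k)

theorem expChar_add (m : ι → ℤ) (Z Z' : ι → ℂ) :
    expChar m (Z + Z') = expChar m Z * expChar m Z' := by
  rw [expChar, expChar, expChar, ← Complex.exp_add, ← mul_add, ← Finset.sum_add_distrib]
  simp only [Pi.add_apply, mul_add]

theorem expChar_neg (m : ι → ℤ) (Z : ι → ℂ) : expChar (-m) Z = (expChar m Z)⁻¹ := by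
  rw [expChar, expChar, ← Complex.exp_neg]
  simp

theorem expChar_ne_zero (m : ι → ℤ) (Z : ι → ℂ) : expChar m Z ≠ 0 := Complex.exp_ne_zero _

theorem norm_expChar (m : ι → ℤ) (Z : ι → ℂ) :
    ‖expChar m Z‖ = Real.exp (-(2 * Real.pi * ∑ k, m k * (Z k).im)) := by
  have h : 2 * (Real.pi : ℂ) * Complex.I * ∑ k, (m k : ℂ) * Z k =
      ((2 * Real.pi : ℝ) : ℂ) * (Complex.I * ∑ k, (m k : ℂ) * Z k) := by
    push_cast; ring
  rw [expChar, Complex.norm_exp, h, Complex.re_ofReal_mul, Complex.I_mul_re, Complex.im_sum]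
  congr 1
  rw [mul_neg]
  congr 2
  refine Finset.sum_congr rfl fun k _ => ?_
  simp

theorem differentiable_expChar (m : ι → ℤ) : Differentiable ℂ (expChar m) := by
  unfold expChar
  fun_prop

theorem mFourier_coe (m : ι → ℤ) (x : ι → ℝ) :
    UnitAddTorus.mFourier m (fun i => (x i : UnitAddCircle)) = expChar m fun k => (x k : ℂ) := by
  rw [UnitAddTorus.mFourier, expChar, Finset.mul_sum, Complex.exp_sum]
  simp only [ContinuousMap.coe_mk]
  refine Finset.prod_congr rfl fun i _ => ?_
  rw [fourier_coe_apply]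
  congr 1
  push_cast
  ring

/-- Real vectors map onto the torus. -/
theorem isOpenQuotientMap_torus :
    IsOpenQuotientMap fun (x : ι → ℝ) (i : ι) => (x i : UnitAddCircle) :=
  IsOpenQuotientMap.piMap fun _ => QuotientAddGroup.isOpenQuotientMap_mk

variable {Ω : Set (ι → ℝ)} {F : (ι → ℂ) → ℂ}

theorem periodic_int [DecidableEq ι]
    (hper : ∀ Z ∈ tube Ω, ∀ k, F (Z + Pi.single k 1) = F Z) (m : ι → ℤ) :
    ∀ Z ∈ tube Ω, F (Z + fun k => (m k : ℂ)) = F Z := by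
  let P : AddSubgroup (ι → ℤ) :=
    { carrier := {m | ∀ Z ∈ tube Ω, F (Z + fun k => (m k : ℂ)) = F Z}
      zero_mem' := fun Z _ => by
        congr 1; funext k; simp
      add_mem' := fun {a b} ha hb Z hZ => by
        have h := hb _ (add_ofReal_mem_tube hZ fun k => (a k : ℝ))
        simp only [Complex.ofReal_intCast] at h
        rw [ha Z hZ] at h
        rw [← h]
        congr 1; funext k; simp [add_assoc]
      neg_mem' := fun {a} ha Z hZ => by
        have h := ha _ (add_ofReal_mem_tube hZ fun k => -(a k : ℝ))
        rw [← show (Z + fun k => ((-(a k : ℝ) : ℝ) : ℂ)) = Z + fun k => (((-a) k : ℤ) : ℂ) by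
          funext k; simp, ← h]
        congr 1; funext k; simp }
  have hP : m ∈ P := by
    have : m = ∑ k, m k • (Pi.single k 1 : ι → ℤ) := by
      funext j
      simp [Finset.sum_apply, Pi.single_apply]
    rw [this]
    refine sum_mem fun k _ => zsmul_mem (fun Z hZ => ?_) _
    rw [← hper Z hZ k]
    congr 1; funext j
    by_cases hj : j = k
    · subst hj; simp
    · simp [hj]
  exact hP

variable (hF : DifferentiableOn ℂ F (tube Ω)) (hΩ : IsOpen Ω)
  (hper : ∀ m : ι → ℤ, ∀ Z ∈ tube Ω, F (Z + fun k => (m k : ℂ)) = F Z)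

include hF in
theorem continuous_shift {Z : ι → ℂ} (hZ : Z ∈ tube Ω) :
    Continuous fun x : ι → ℝ => F (Z + fun k => (x k : ℂ)) :=
  hF.continuousOn.comp_continuous (by fun_prop) fun x => add_ofReal_mem_tube hZ x

/-- The restriction of a periodic function to `Z + ℝ^ι`, as a function on the torus. -/
def torusFun (F : (ι → ℂ) → ℂ) (Z : ι → ℂ) (θ : UnitAddTorus ι) : ℂ :=
  F (Z + fun k => ((Function.surjInv isOpenQuotientMap_torus.surjective θ k : ℝ) : ℂ))

include hper in
-- The chosen lift of a point of the torus differs from `x` by an integral vector, which periodicity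
-- absorbs.
theorem torusFun_coe {Z : ι → ℂ} (hZ : Z ∈ tube Ω) (x : ι → ℝ) :
    torusFun F Z (fun i => (x i : UnitAddCircle)) = F (Z + fun k => (x k : ℂ)) := by
  have h := Function.surjInv_eq (isOpenQuotientMap_torus (ι := ι)).surjective
    (fun i => (x i : UnitAddCircle))
  set y := Function.surjInv (isOpenQuotientMap_torus (ι := ι)).surjective
    (fun i => (x i : UnitAddCircle)) with hy
  have hm : ∀ i, ∃ m : ℤ, x i + m = y i := fun i => by
    have := congrFun h i
    rw [eq_comm, ← sub_eq_zero, ← AddCircle.coe_sub, AddCircle.coe_eq_zero_iff] at this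
    obtain ⟨n, hn⟩ := this
    refine ⟨-n, ?_⟩
    simp only [zsmul_eq_mul, mul_one] at hn
    push_cast
    linarith
  choose m hm using hm
  rw [torusFun, ← hy, ← hper m _ (add_ofReal_mem_tube hZ x)]
  congr 1
  funext k
  simp [← hm, add_assoc]

include hF hper in
theorem continuous_torusFun {Z : ι → ℂ} (hZ : Z ∈ tube Ω) : Continuous (torusFun F Z) := by
  rw [isOpenQuotientMap_torus.isQuotientMap.continuous_iff]
  refine (continuous_shift hF hZ).congr fun x => ?_
  rw [Function.comp_apply, torusFun_coe hper hZ]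

/-- The half-open unit box with corner `a`. -/
def unitBox (a : ι → ℝ) : Set (ι → ℝ) := {x | ∀ i, x i ∈ Set.Ioc (a i) (a i + 1)}

theorem unitBox_subset (a : ι → ℝ) : unitBox a ⊆ Set.Icc a (a + 1) := fun _ hx =>
  ⟨fun i => (hx i).1.le, fun i => (hx i).2⟩

theorem measurableSet_unitBox (a : ι → ℝ) : MeasurableSet (unitBox a) :=
  MeasurableSet.univ_pi' fun _ => measurableSet_Ioc

theorem volume_unitBox_lt_top (a : ι → ℝ) : volume (unitBox a) < ⊤ :=
  (measure_mono (unitBox_subset a)).trans_lt isCompact_Icc.measure_lt_top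

include hper in
-- The corner `a` is left free because comparing two corners gives the invariance of
-- `periodIntegral` under real shifts.
theorem mFourierCoeff_torusFun {Z : ι → ℂ} (hZ : Z ∈ tube Ω) (m : ι → ℤ) (a : ι → ℝ) :
    UnitAddTorus.mFourierCoeff (torusFun F Z) m =
      expChar m Z * ∫ x in unitBox a, expChar (-m) (Z + fun k => (x k : ℂ)) *
        F (Z + fun k => (x k : ℂ)) := by
  rw [UnitAddTorus.mFourierCoeff_eq_integral _ _ a, ← integral_const_mul]
  refine setIntegral_congr_fun (measurableSet_unitBox a) fun x _ => ?_
  rw [torusFun_coe hper hZ, mFourier_coe, expChar_add, expChar_neg m Z, smul_eq_mul]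
  field_simp [expChar_ne_zero m Z]

/-- The integral of `e(-m · Z)F(Z)` over a period. -/
def periodIntegral (F : (ι → ℂ) → ℂ) (m : ι → ℤ) (Z : ι → ℂ) : ℂ :=
  ∫ x in unitBox (0 : ι → ℝ), expChar (-m) (Z + fun k => (x k : ℂ)) * F (Z + fun k => (x k : ℂ))

include hper in
-- A shift by `s` turns the box with corner `0` into the box with corner `s`, and both boxes compute
-- the same Fourier coefficient.
theorem periodIntegral_add_ofReal {Z : ι → ℂ} (hZ : Z ∈ tube Ω) (m : ι → ℤ) (s : ι → ℝ) :
    periodIntegral F m (Z + fun k => (s k : ℂ)) = periodIntegral F m Z := by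
  have h := (mFourierCoeff_torusFun hper hZ m 0).symm.trans (mFourierCoeff_torusFun hper hZ m s)
  have h := mul_left_cancel₀ (expChar_ne_zero m Z) h
  rw [periodIntegral, periodIntegral, h]
  rw [← integral_indicator (measurableSet_unitBox _), ← integral_indicator (measurableSet_unitBox _),
    ← integral_add_right_eq_self ((unitBox s).indicator _) s]
  congr 1
  funext x
  have hx : x + s ∈ unitBox s ↔ x ∈ unitBox (0 : ι → ℝ) := by
    refine forall_congr' fun i => ?_
    simp only [Pi.add_apply, Set.mem_Ioc, Pi.zero_apply]
    constructor <;> rintro ⟨h₁, h₂⟩ <;> constructor <;> linarith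
  by_cases h : x ∈ unitBox (0 : ι → ℝ)
  · rw [Set.indicator_of_mem h, Set.indicator_of_mem (hx.2 h)]
    have e : (Z + (fun k => (s k : ℂ)) + fun k => (x k : ℂ)) =
        Z + fun k => (((x + s) k : ℝ) : ℂ) := by
      funext k; simp only [Pi.add_apply, Complex.ofReal_add]; ring
    rw [e]
  · rw [Set.indicator_of_notMem h, Set.indicator_of_notMem (mt hx.1 h)]

include hF hΩ in
-- Differentiation under the integral sign. The derivative of the integrand is dominated through
-- Cauchy's estimate on discs of radius `R / 2` inside the disc of radius `R`, where compactness
-- bounds the integrand.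
theorem hasDerivAt_periodIntegral_line (m : ι → ℤ) {Z V : ι → ℂ} {t₀ : ℂ}
    (ht₀ : Z + t₀ • V ∈ tube Ω) :
    ∃ d, HasDerivAt (fun t : ℂ => periodIntegral F m (Z + t • V)) d t₀ := by
  set G : (ι → ℂ) → ℂ := fun Z => expChar (-m) Z * F Z with hG
  have hGd : DifferentiableOn ℂ G (tube Ω) := (differentiable_expChar _).differentiableOn.mul hF
  have hUo : IsOpen {t : ℂ | Z + t • V ∈ tube Ω} :=
    (isOpen_tube hΩ).preimage (by fun_prop)
  obtain ⟨R, hR, hball⟩ := Metric.nhds_basis_closedBall.mem_iff.1 (hUo.mem_nhds ht₀)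
  set r := R / 2 with hr
  have hr0 : 0 < r := by positivity
  have hmem : ∀ t ∈ Metric.closedBall t₀ R, ∀ x : ι → ℝ,
      (Z + t • V + fun k => (x k : ℂ)) ∈ tube Ω := fun t ht x => add_ofReal_mem_tube (hball ht) x
  have hcont : ContinuousOn (fun p : ℂ × (ι → ℝ) => G (Z + p.1 • V + fun k => (p.2 k : ℂ)))
      (Metric.closedBall t₀ R ×ˢ Set.Icc (0 : ι → ℝ) (0 + 1)) :=
    hGd.continuousOn.comp (by fun_prop) fun p hp => hmem p.1 hp.1 p.2
  obtain ⟨C, hC⟩ := ((isCompact_closedBall t₀ R).prod isCompact_Icc).exists_bound_of_continuousOn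
    hcont
  have hdiff : ∀ x : ι → ℝ, ∀ t ∈ Metric.ball t₀ R, DifferentiableAt ℂ
      (fun t : ℂ => G (Z + t • V + fun k => (x k : ℂ))) t := fun x t ht => by
    have h₁ : DifferentiableAt ℂ G (Z + t • V + fun k => (x k : ℂ)) :=
      hGd.differentiableAt ((isOpen_tube hΩ).mem_nhds
        (hmem t (Metric.ball_subset_closedBall ht) x))
    exact DifferentiableAt.comp (f := fun t : ℂ => Z + t • V + fun k => (x k : ℂ)) t h₁
      (by fun_prop)
  have hlt : Metric.ball t₀ r ⊆ Metric.ball t₀ R := Metric.ball_subset_ball (by linarith)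
  have hcx : ∀ t ∈ Metric.ball t₀ R,
      Continuous fun x : ι → ℝ => G (Z + t • V + fun k => (x k : ℂ)) := fun t ht =>
    hGd.continuousOn.comp_continuous (by fun_prop)
      fun x => hmem t (Metric.ball_subset_closedBall ht) x
  have : IsFiniteMeasure (volume.restrict (unitBox (0 : ι → ℝ))) :=
    ⟨by rw [Measure.restrict_apply_univ]; exact volume_unitBox_lt_top 0⟩
  have ht₀R : t₀ ∈ Metric.ball t₀ R := Metric.mem_ball_self hR
  refine ⟨_, (hasDerivAt_integral_of_dominated_loc_of_deriv_le (𝕜 := ℂ)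
    (μ := volume.restrict (unitBox (0 : ι → ℝ))) (s := Metric.ball t₀ r)
    (F := fun t x => G (Z + t • V + fun k => (x k : ℂ)))
    (F' := fun t x => deriv (fun t : ℂ => G (Z + t • V + fun k => (x k : ℂ))) t)
    (bound := fun _ => C / r) (Metric.ball_mem_nhds _ hr0) ?_ ?_ ?_ ?_ ?_ ?_).2⟩
  · filter_upwards [Metric.ball_mem_nhds t₀ hR] with t ht
    exact (hcx t ht).aestronglyMeasurable
  · refine Measure.integrableOn_of_bounded (M := C) (volume_unitBox_lt_top 0).ne
      (hcx t₀ ht₀R).aestronglyMeasurable ?_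
    refine (ae_restrict_iff' (measurableSet_unitBox 0)).2 (Filter.Eventually.of_forall fun x hx => ?_)
    exact hC (t₀, x) ⟨Metric.ball_subset_closedBall ht₀R, unitBox_subset 0 hx⟩
  -- The derivative is measurable in `x` as a limit of difference quotients along a sequence tending
  -- to `t₀`.
  · have hu : Tendsto (fun n : ℕ => t₀ + ((r / (n + 2) : ℝ) : ℂ)) atTop (𝓝[≠] t₀) := by
      refine tendsto_nhdsWithin_iff.2 ⟨?_, Filter.Eventually.of_forall fun n => ?_⟩
      · have : Tendsto (fun n : ℕ => r / ((n : ℝ) + 2)) atTop (𝓝 0) :=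
          tendsto_const_nhds.div_atTop
            (tendsto_atTop_add_const_right _ _ tendsto_natCast_atTop_atTop)
        simpa using tendsto_const_nhds.add ((Complex.continuous_ofReal.tendsto 0).comp this)
      · have : r / ((n : ℝ) + 2) ≠ 0 := by positivity
        exact fun h => Complex.ofReal_ne_zero.2 this (by simpa using h)
    have hub : ∀ n : ℕ, t₀ + ((r / (n + 2) : ℝ) : ℂ) ∈ Metric.ball t₀ R := fun n => by
      have h0 : 0 ≤ r / ((n : ℝ) + 2) := by positivity
      have h1 : r / ((n : ℝ) + 2) ≤ r := div_le_self hr0.le (by linarith [n.cast_nonneg (α := ℝ)])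
      rw [Metric.mem_ball, dist_eq_norm, add_sub_cancel_left, Complex.norm_real,
        Real.norm_of_nonneg h0]
      linarith
    refine aestronglyMeasurable_of_tendsto_ae atTop (f := fun (n : ℕ) x =>
      slope (fun t : ℂ => G (Z + t • V + fun k => (x k : ℂ))) t₀
        (t₀ + ((r / (n + 2) : ℝ) : ℂ))) (fun n => ?_) (Filter.Eventually.of_forall fun x => ?_)
    · simp only [slope_def_module]
      exact (((hcx _ (hub n)).sub (hcx _ ht₀R)).const_smul
        (t₀ + ((r / (n + 2) : ℝ) : ℂ) - t₀)⁻¹).aestronglyMeasurable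
    · exact (hasDerivAt_iff_tendsto_slope.1 (hdiff x t₀ ht₀R).hasDerivAt).comp hu
  · refine (ae_restrict_iff' (measurableSet_unitBox 0)).2
      (Filter.Eventually.of_forall fun x hx t ht => ?_)
    have hsub : Metric.closedBall t r ⊆ Metric.closedBall t₀ R :=
      Metric.closedBall_subset_closedBall' (by rw [Metric.mem_ball] at ht; linarith)
    refine Complex.norm_deriv_le_of_forall_mem_sphere_norm_le hr0 ?_ fun z hz =>
      hC (z, x) ⟨hsub (Metric.sphere_subset_closedBall hz), unitBox_subset 0 hx⟩
    have hsub' : Metric.ball t r ⊆ Metric.ball t₀ R :=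
      Metric.ball_subset_ball' (by rw [Metric.mem_ball] at ht; linarith)
    refine ⟨fun z hz => (hdiff x z (hsub' hz)).differentiableWithinAt, ?_⟩
    rw [closure_ball t hr0.ne']
    exact hGd.continuousOn.comp (by fun_prop) fun z hz => hmem z (hsub hz) x
  · exact integrable_const _
  · exact Filter.Eventually.of_forall fun x t ht => (hdiff x t (hlt ht)).hasDerivAt

include hF hΩ hper in
-- On the line `Z + tV` with `V = Im Z' - Im Z` the period integral is holomorphic in `t` and does
-- not change under real increments of `t`, so its derivative is zero. Convexity makes the set of
-- admissible `t` connected; `t = I` reaches the imaginary part of `Z'`, and a real shift does the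
-- rest.
theorem periodIntegral_eq (hconv : Convex ℝ Ω) (m : ι → ℤ) {Z Z' : ι → ℂ} (hZ : Z ∈ tube Ω)
    (hZ' : Z' ∈ tube Ω) : periodIntegral F m Z = periodIntegral F m Z' := by
  set V : ι → ℂ := fun k => (((Z' k).im - (Z k).im : ℝ) : ℂ) with hV
  set U : Set ℂ := {t : ℂ | Z + t • V ∈ tube Ω} with hU
  have him : ∀ t : ℂ, (fun k => ((Z + t • V) k).im) =
      (fun k => (Z k).im) + t.im • ((fun k => (Z' k).im) - fun k => (Z k).im) := fun t => by
    funext k; simp [hV]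
  have hUo : IsOpen U := (isOpen_tube hΩ).preimage (by fun_prop)
  have hUc : Convex ℝ U := by
    have : U = (fun t : ℂ => (fun k => (Z k).im) + t.im • ((fun k => (Z' k).im) - fun k => (Z k).im))
        ⁻¹' Ω := by
      ext t
      change (fun k => ((Z + t • V) k).im) ∈ Ω ↔ _
      rw [him]; rfl
    rw [this]
    intro s hs t ht a b ha hb hab
    have := hconv hs ht ha hb hab
    rw [Set.mem_preimage]
    convert this using 1
    simp only [Complex.add_im, Complex.real_smul, Complex.im_ofReal_mul]
    funext k
    simp only [Pi.add_apply, Pi.smul_apply, smul_eq_mul]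
    linear_combination (-(Z k).im) * hab
  have h0 : (0 : ℂ) ∈ U := by
    change Z + (0 : ℂ) • V ∈ tube Ω
    simpa using hZ
  have hI : Complex.I ∈ U := by
    change (fun k => ((Z + Complex.I • V) k).im) ∈ Ω
    rw [him]
    simpa using! hZ'
  have hd : ∀ t ∈ U, HasDerivAt (fun t : ℂ => periodIntegral F m (Z + t • V)) 0 t := by
    intro t ht
    obtain ⟨d, hd⟩ := hasDerivAt_periodIntegral_line hF hΩ m ht
    have h₁ : HasDerivAt (fun s : ℝ => periodIntegral F m (Z + (t + s) • V)) d 0 := by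
      have e : HasDerivAt (fun s : ℝ => t + (s : ℂ)) 1 0 := by
        simpa using ((hasDerivAt_id (0 : ℝ)).ofReal_comp).const_add t
      have hd' : HasDerivAt (fun t : ℂ => periodIntegral F m (Z + t • V)) d (t + ((0 : ℝ) : ℂ)) := by
        simpa using hd
      simpa [Function.comp_def] using hd'.comp (0 : ℝ) e
    have h₂ : (fun s : ℝ => periodIntegral F m (Z + (t + s) • V)) =
        fun _ => periodIntegral F m (Z + t • V) := by
      funext s
      rw [← periodIntegral_add_ofReal hper ht m fun k => s * ((Z' k).im - (Z k).im)]
      congr 1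
      funext k
      simp [hV, add_mul, add_assoc]
    rw [h₂] at h₁
    rwa [h₁.unique (hasDerivAt_const _ _)] at hd
  have hconst := hUo.is_const_of_deriv_eq_zero hUc.isPreconnected
    (fun t ht => (hd t ht).differentiableAt.differentiableWithinAt)
    (fun t ht => (hd t ht).deriv) h0 hI
  simp only [zero_smul, add_zero] at hconst
  rw [hconst, ← periodIntegral_add_ofReal hper hI m fun k => (Z' k).re - (Z k).re]
  congr 1
  funext k
  apply Complex.ext <;> simp [hV]

include hF hΩ hper in
/-- A periodic holomorphic function on a tube domain is the sum of its Fourier series. -/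
theorem hasSum_fourier_tube (hconv : Convex ℝ Ω) (Z₀ : ι → ℂ) (hZ₀ : Z₀ ∈ tube Ω) :
    ∀ Z ∈ tube Ω, HasSum (fun m : ι → ℤ => periodIntegral F m Z₀ * expChar m Z) (F Z) := by
  intro Z hZ
  have hcoef : ∀ W ∈ tube Ω, ∀ m, UnitAddTorus.mFourierCoeff (torusFun F W) m =
      periodIntegral F m Z₀ * expChar m W := fun W hW m => by
    rw [periodIntegral_eq hF hΩ hper hconv m hZ₀ hW, mul_comm]
    exact mFourierCoeff_torusFun hper hW m 0
  obtain ⟨δ, hδ, hball⟩ := Metric.nhds_basis_closedBall.mem_iff.1 (hΩ.mem_nhds hZ)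
  have hmem : ∀ Y ∈ Metric.closedBall (fun k => (Z k).im) δ, ∀ x : ι → ℝ,
      (fun k => ((Y k : ℝ) : ℂ) * Complex.I + (x k : ℂ)) ∈ tube Ω := fun Y hY x => by
    simpa [tube] using hball hY
  obtain ⟨C, hC⟩ := ((isCompact_closedBall (fun k => (Z k).im) δ).prod
    (isCompact_Icc (a := fun k => (Z k).re) (b := (fun k => (Z k).re) + 1))).exists_bound_of_continuousOn
    (f := fun p : (ι → ℝ) × (ι → ℝ) =>
      F (fun k => ((p.1 k : ℝ) : ℂ) * Complex.I + (p.2 k : ℂ)))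
    (hF.continuousOn.comp (by fun_prop) fun p hp => hmem p.1 hp.1 p.2)
  have hbound : ∀ m : ι → ℤ, ‖periodIntegral F m Z₀ * expChar m Z‖ ≤
      (C * volume.real (unitBox (0 : ι → ℝ))) *
        ∏ k, Real.exp (-((2 * Real.pi * δ) * |(m k : ℝ)|)) := fun m => by
    -- The coefficient can be computed at any height. Lowering each `Im Z_k` by `δ` times the sign
    -- of `m k` makes the character larger by `exp(2πδ ∑ |m k|)`, while the term at the new point is
    -- still bounded by the supremum `C` of `F` times the volume of the box.
    set Y : ι → ℝ := fun k => (Z k).im - δ * SignType.sign (m k : ℝ) with hY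
    have hYmem : Y ∈ Metric.closedBall (fun k => (Z k).im) δ := by
      rw [mem_closedBall_iff_norm, pi_norm_le_iff_of_nonneg hδ.le]
      intro k
      have h1 : |((SignType.sign (m k : ℝ) : SignType) : ℝ)| ≤ 1 := by
        rcases lt_trichotomy (m k : ℝ) 0 with h | h | h <;> simp [h]
      simp only [hY, Pi.sub_apply, sub_sub_cancel_left, norm_neg, norm_mul, Real.norm_eq_abs,
        abs_of_pos hδ]
      nlinarith
    set W : ι → ℂ := fun k => ((Y k : ℝ) : ℂ) * Complex.I + ((Z k).re : ℂ) with hW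
    have hWmem : W ∈ tube Ω := hmem Y hYmem _
    have hI : periodIntegral F m Z₀ * expChar m W =
        ∫ x in unitBox (0 : ι → ℝ), expChar (-m) (fun k => (x k : ℂ)) *
          F (W + fun k => (x k : ℂ)) := by
      rw [periodIntegral_eq hF hΩ hper hconv m hZ₀ hWmem, periodIntegral, mul_comm,
        ← integral_const_mul]
      congr 1
      funext x
      rw [expChar_add, expChar_neg m W]
      field_simp [expChar_ne_zero m W]
    have h₁ : ‖periodIntegral F m Z₀ * expChar m W‖ ≤ C * volume.real (unitBox (0 : ι → ℝ)) := by
      rw [hI]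
      refine norm_setIntegral_le_of_norm_le_const (volume_unitBox_lt_top 0) fun x hx => ?_
      rw [norm_mul, norm_expChar]
      simp only [Complex.ofReal_im, mul_zero, Finset.sum_const_zero, neg_zero, Real.exp_zero,
        one_mul]
      have hx' := unitBox_subset 0 hx
      have := hC (Y, fun k => (Z k).re + x k) ⟨hYmem, fun k => ?_, fun k => ?_⟩
      · have e : (W + fun k => (x k : ℂ)) =
            fun k => ((Y k : ℝ) : ℂ) * Complex.I + (((Z k).re + x k : ℝ) : ℂ) := by
          funext k
          simp [hW, add_assoc]
        rw [e]
        exact this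
      · have := hx'.1 k
        simp only [Pi.zero_apply] at this
        simpa using this
      · have := hx'.2 k
        simp only [zero_add] at this
        simpa using this
    have h₂ : ‖expChar m Z‖ = ‖expChar m W‖ *
        ∏ k, Real.exp (-((2 * Real.pi * δ) * |(m k : ℝ)|)) := by
      rw [norm_expChar, norm_expChar, ← Real.exp_sum, ← Real.exp_add]
      congr 1
      rw [← sub_eq_zero, Finset.sum_neg_distrib, Finset.mul_sum, Finset.mul_sum,
        ← Finset.sum_neg_distrib, ← Finset.sum_neg_distrib, ← Finset.sum_neg_distrib,
        ← Finset.sum_add_distrib, ← Finset.sum_sub_distrib]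
      refine Finset.sum_eq_zero fun k _ => ?_
      have hs : (m k : ℝ) * (SignType.sign (m k : ℝ) : ℝ) = |(m k : ℝ)| := self_mul_sign _
      have hWk : (W k).im = (Z k).im - δ * SignType.sign (m k : ℝ) := by simp [hW, hY]
      rw [hWk, ← hs]
      ring
    rw [norm_mul, h₂, ← mul_assoc, ← norm_mul]
    exact mul_le_mul_of_nonneg_right h₁ (Finset.prod_nonneg fun k _ => Real.exp_nonneg _)
  have hsum : Summable fun m : ι → ℤ => periodIntegral F m Z₀ * expChar m Z := by
    refine Summable.of_norm_bounded (((summable_prod_apply (ι := ι)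
      (g := fun n : ℤ => Real.exp (-((2 * Real.pi * δ) * |(n : ℝ)|)))
      (fun n => Real.exp_nonneg _)
      (summable_exp_neg_mul_abs (by positivity)))).mul_left _) hbound
  -- A continuous function on the torus with summable Fourier coefficients is the sum of its series;
  -- the value at the origin is `F Z`.
  have h := UnitAddTorus.hasSum_mFourier_series_apply_of_summable
    (f := ⟨torusFun F Z, continuous_torusFun hF hper hZ⟩)
    (hsum.congr fun m => (hcoef Z hZ m).symm)
    (fun i => ((0 : ℝ) : UnitAddCircle))
  have e : torusFun F Z (fun i => ((0 : ℝ) : UnitAddCircle)) = F Z := by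
    rw [torusFun_coe hper hZ fun _ => 0]
    congr 1; funext k; simp
  simp only [ContinuousMap.coe_mk] at h
  rw [e] at h
  convert h using 2 with m
  rw [hcoef Z hZ, mFourier_coe m fun _ => 0]
  simp [expChar]

end Tube

end QuatG

end

/-! ### Isolating a coefficient of an exponential sum by averaging. -/

noncomputable section
namespace QuatG

section Mean

open Filter Topology

theorem tendsto_mean_pow {w : ℂ} (hw : ‖w‖ = 1) (h : w ≠ 1) :
    Tendsto (fun N : ℕ => (N : ℂ)⁻¹ * ∑ n ∈ Finset.range N, w ^ n) atTop (𝓝 0) := by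
  have h0 : w - 1 ≠ 0 := sub_ne_zero.2 h
  have hlim : Tendsto (fun N : ℕ => (2 / ‖w - 1‖) / (N : ℝ)) atTop (𝓝 0) :=
    tendsto_const_nhds.div_atTop tendsto_natCast_atTop_atTop
  refine squeeze_zero_norm (fun N => ?_) hlim
  rw [geom_sum_eq h, norm_mul, norm_inv, Complex.norm_natCast, norm_div, mul_comm, ← div_eq_mul_inv]
  gcongr
  calc ‖w ^ N - 1‖ ≤ ‖w ^ N‖ + ‖(1 : ℂ)‖ := norm_sub_le _ _
    _ = 2 := by rw [norm_pow, hw]; norm_num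

/-- A coefficient of an absolutely convergent exponential sum is bounded by the sum at the
multiples of a direction that separates its frequency from the others. -/
theorem norm_le_of_forall_tsum_pow {ι : Type*} {b w : ι → ℂ} (hb : Summable b)
    (hw : ∀ i, ‖w i‖ = 1) {i₀ : ι} (h₀ : w i₀ = 1) (h : ∀ i ≠ i₀, w i ≠ 1) {C : ℝ}
    (hC : ∀ n : ℕ, ‖∑' i, b i * w i ^ n‖ ≤ C) : ‖b i₀‖ ≤ C := by
  classical
  have hmean : ∀ (N : ℕ) i, ‖(N : ℂ)⁻¹ * ∑ n ∈ Finset.range N, w i ^ n‖ ≤ 1 := fun N i => by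
    rw [norm_mul, norm_inv, Complex.norm_natCast]
    have : ‖∑ n ∈ Finset.range N, w i ^ n‖ ≤ N := by
      refine (norm_sum_le _ _).trans ?_
      simp [hw]
    calc (N : ℝ)⁻¹ * ‖∑ n ∈ Finset.range N, w i ^ n‖ ≤ (N : ℝ)⁻¹ * N := by gcongr
      _ ≤ 1 := inv_mul_le_one
  -- The Cesàro means of `w i ^ n` tend to `1` for `i = i₀` and to `0` otherwise, and are bounded by
  -- `1`, so dominated convergence applies with majorant `‖b i‖`.
  have hlim : Tendsto (fun N : ℕ => ∑' i, b i * ((N : ℂ)⁻¹ * ∑ n ∈ Finset.range N, w i ^ n)) atTop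
      (𝓝 (∑' i, if i = i₀ then b i₀ else 0)) := by
    refine tendsto_tsum_of_dominated_convergence hb.norm (fun i => ?_)
      (Filter.Eventually.of_forall fun N i => ?_)
    · by_cases hi : i = i₀
      · subst hi
        simp only [h₀, one_pow, Finset.sum_const, Finset.card_range, nsmul_eq_mul, mul_one,
          if_true]
        refine tendsto_const_nhds.congr' ?_
        filter_upwards [eventually_gt_atTop 0] with N hN
        rw [inv_mul_cancel₀ (Nat.cast_ne_zero.2 hN.ne'), mul_one]
      · rw [if_neg hi]
        simpa using (tendsto_mean_pow (hw i) (h i hi)).const_mul (b i)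
    · rw [norm_mul]
      exact mul_le_of_le_one_right (norm_nonneg _) (hmean N i)
  rw [tsum_ite_eq] at hlim
  refine le_of_tendsto hlim.norm ?_
  filter_upwards [eventually_gt_atTop 0] with N hN
  have hs : ∀ n : ℕ, Summable fun i => b i * w i ^ n := fun n => by
    refine Summable.of_norm (hb.norm.congr fun i => ?_)
    rw [norm_mul, norm_pow, hw, one_pow, mul_one]
  have e : ∑' i, b i * ((N : ℂ)⁻¹ * ∑ n ∈ Finset.range N, w i ^ n) =
      (N : ℂ)⁻¹ * ∑ n ∈ Finset.range N, ∑' i, b i * w i ^ n := by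
    rw [← Summable.tsum_finsetSum fun n _ => hs n, ← tsum_mul_left]
    refine tsum_congr fun i => ?_
    rw [← Finset.mul_sum]
    ring
  rw [e, norm_mul, norm_inv, Complex.norm_natCast]
  calc (N : ℝ)⁻¹ * ‖∑ n ∈ Finset.range N, ∑' i, b i * w i ^ n‖
      ≤ (N : ℝ)⁻¹ * (N * C) := by
        gcongr
        refine (norm_sum_le_of_le _ fun n _ => hC n).trans ?_
        simp
    _ = C := by
        rw [← mul_assoc, inv_mul_cancel₀ (Nat.cast_ne_zero.2 hN.ne'), one_mul]

/-- Take distinct powers of a transcendental number `x`: a relation would be a polynomial over `ℚ`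
vanishing at `x`. The exponents start at `1`, so that `z` alone is the constant term. -/
theorem exists_generic_direction (κ : Type*) [Fintype κ] : ∃ X : κ → ℝ, ∀ q : κ → ℚ, q ≠ 0 →
    ∀ z : ℤ, ∑ k, (q k : ℝ) * X k ≠ z := by
  classical
  obtain ⟨x, hx⟩ : ∃ x : ℝ, Transcendental ℤ x :=
    ⟨_, transcendental_liouvilleNumber le_rfl⟩
  have hx : Transcendental ℚ x := fun h => hx ((IsFractionRing.isAlgebraic_iff ℤ ℚ ℝ).2 h)
  let e := Fintype.equivFin κ
  refine ⟨fun k => x ^ ((e k : ℕ) + 1), fun q hq z hz => hq ?_⟩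
  set P : Polynomial ℚ := ∑ k, Polynomial.C (q k) * Polynomial.X ^ ((e k : ℕ) + 1) -
    Polynomial.C (z : ℚ) with hP
  have hP0 : P = 0 := by
    by_contra h
    refine hx ⟨P, h, ?_⟩
    simp [hP, hz]
  funext k
  have := congrArg (fun P => Polynomial.coeff P ((e k : ℕ) + 1)) hP0
  simpa [hP, Polynomial.finsetSum_coeff, Polynomial.coeff_X_pow, Polynomial.coeff_C_succ,
    Fin.val_inj, -eq_intCast, -map_intCast] using this

/-- Along a generic direction distinct rational frequencies give distinct unimodular numbers.
Dividing by the one for `i₀` reduces to `norm_le_of_forall_tsum_pow`. -/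
theorem norm_coeff_le_of_hasSum {ι κ : Type*} [Fintype κ] {X : κ → ℝ}
    (hX : ∀ q : κ → ℚ, q ≠ 0 → ∀ z : ℤ, ∑ k, (q k : ℝ) * X k ≠ z) {q : ι → κ → ℚ}
    (hq : Function.Injective q) {b : ι → ℂ} {s : ℕ → ℂ}
    (hs : ∀ n : ℕ, HasSum (fun i => b i *
      Complex.exp (2 * Real.pi * Complex.I * (n * ∑ k, (q i k : ℂ) * (X k : ℂ)))) (s n))
    {C : ℝ} (hC : ∀ n, ‖s n‖ ≤ C) (i₀ : ι) : ‖b i₀‖ ≤ C := by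
  set l : ι → ℝ := fun i => ∑ k, (q i k : ℝ) * X k with hl
  have hlc : ∀ i, ∑ k, (q i k : ℂ) * (X k : ℂ) = (l i : ℂ) := fun i => by simp [hl]
  have hnorm : ∀ t : ℝ, ‖Complex.exp (2 * Real.pi * Complex.I * t)‖ = 1 := fun t => by
    rw [Complex.norm_exp]; simp
  set w : ι → ℂ := fun i => Complex.exp (2 * Real.pi * Complex.I * ((l i - l i₀ : ℝ) : ℂ)) with hw
  have hterm : ∀ (n : ℕ) i, Complex.exp (2 * Real.pi * Complex.I * (n * ∑ k, (q i k : ℂ) * X k)) =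
      w i ^ n * Complex.exp (2 * Real.pi * Complex.I * ((n * l i₀ : ℝ) : ℂ)) := fun n i => by
    rw [hw, ← Complex.exp_nat_mul, ← Complex.exp_add, hlc]
    congr 1
    push_cast
    ring
  have hb : Summable b := by simpa using (hs 0).summable
  refine norm_le_of_forall_tsum_pow hb (w := w) (fun i => hnorm _) (by simp [hw])
    (fun i hi h => ?_) fun n => ?_
  · rw [hw, Complex.exp_eq_one_iff] at h
    obtain ⟨z, hz⟩ := h
    have hz' : ((l i - l i₀ : ℝ) : ℂ) = z := by
      have h2 : (2 * Real.pi * Complex.I : ℂ) ≠ 0 := Complex.two_pi_I_ne_zero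
      rw [mul_comm (z : ℂ)] at hz
      exact mul_left_cancel₀ h2 hz
    have hz'' : l i - l i₀ = z := by exact_mod_cast hz'
    refine hX (q i - q i₀) (sub_ne_zero.2 fun h => hi (hq h)) z ?_
    rw [← hz'']
    simp only [hl, Pi.sub_apply, Rat.cast_sub, sub_mul, Finset.sum_sub_distrib]
  · have h := (hs n).tsum_eq
    simp only [hterm] at h
    simp only [← mul_assoc (b _)] at h
    rw [tsum_mul_right] at h
    have := hC n
    rwa [← h, norm_mul, hnorm, mul_one] at this

end Mean

end QuatG

end

/-! ### The cone of positive definite matrices and the Siegel space inside `ℋ`. -/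

noncomputable section
namespace QuatG

set_option linter.unusedSectionVars false

variable {α β : ℚ}

/-- The coefficients of the pairing `tr(x, y)` in coordinates. -/
def pairWeight (α β : ℚ) : HIdx → ℚ :=
  Sum.elim (fun _ => 1) fun p => ![2, -2 * α, -2 * β, 2 * α * β] p.2

theorem pairWeight_pos (hα : α < 0) (hβ : β < 0) (k : HIdx) : 0 < pairWeight α β k := by
  have := mul_pos_of_neg_of_neg hα hβ
  rcases k with i | ⟨i, l⟩
  · exact one_pos
  · fin_cases l <;> simp [pairWeight] <;> linarith

theorem trPair_eq_sum {L : Type} [Field L] [CharZero L] (x y : H3 L) :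
    trPair α β x y = ∑ k, (pairWeight α β k : L) * x k * y k := by
  rw [trPair_eq, Fintype.sum_sum_type, Fintype.sum_prod_type]
  simp only [Fin.sum_univ_three, Fin.sum_univ_four, re_mul, re_star, imI_star, imJ_star, imK_star]
  simp [pairWeight, dg, off]
  ring

section PositiveDefinite

theorem algebraMap_eq_mk {L : Type} [Field L] (t : L) :
    algebraMap L (Quat α β L) t = ⟨t, 0, 0, 0⟩ := rfl

theorem re_sum_star_mul_toMatrix_mul (Y : H3 ℝ) (v : Fin 3 → Quat α β ℝ) :
    (∑ i, ∑ j, star (v i) * toMatrix α β Y i j * v j).re =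
      dg Y 0 * qnorm (v 0) + dg Y 1 * qnorm (v 1) + dg Y 2 * qnorm (v 2)
      + 2 * (star (v 1) * off α β Y 0 * v 2).re + 2 * (star (v 2) * off α β Y 1 * v 0).re
      + 2 * (star (v 0) * off α β Y 2 * v 1).re := by
  simp only [Fin.sum_univ_three, toMatrix, Matrix.of_apply, Matrix.cons_val_zero,
    Matrix.cons_val_one, Matrix.cons_val, QuaternionAlgebra.re_add, re_mul, imI_mul, imJ_mul,
    imK_mul, re_star, imI_star, imJ_star, imK_star, qnorm_eq, algebraMap_eq_mk]
  ring

/-- The value of the Hermitian form `Y` at the vector with given coordinates. -/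
def hermForm (α β : ℚ) (Y : H3 ℝ) (u : Fin 3 → Fin 4 → ℝ) : ℝ :=
  (∑ i, ∑ j, star (⟨u i 0, u i 1, u i 2, u i 3⟩ : Quat α β ℝ) * toMatrix α β Y i j *
    (⟨u j 0, u j 1, u j 2, u j 3⟩ : Quat α β ℝ)).re

theorem posDefH_iff (Y : H3 ℝ) : PosDefH α β Y ↔ ∀ u ≠ 0, 0 < hermForm α β Y u := by
  constructor
  · refine fun h u hu => h (fun i => ⟨u i 0, u i 1, u i 2, u i 3⟩) fun h0 => hu ?_
    funext i l
    have := congrFun h0 i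
    simp only [Pi.zero_apply, QuaternionAlgebra.ext_iff] at this
    fin_cases l
    exacts [this.1, this.2.1, this.2.2.1, this.2.2.2]
  · refine fun h v hv => h (fun i => ![(v i).re, (v i).imI, (v i).imJ, (v i).imK])
      fun h0 => hv ?_
    funext i
    have := congrFun h0 i
    exact QuaternionAlgebra.ext (congrFun this 0) (congrFun this 1) (congrFun this 2)
      (congrFun this 3)

theorem hermForm_eq (Y : H3 ℝ) (u : Fin 3 → Fin 4 → ℝ) : hermForm α β Y u =
    Y (Sum.inl 0) * qnorm (⟨u 0 0, u 0 1, u 0 2, u 0 3⟩ : Quat α β ℝ)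
    + Y (Sum.inl 1) * qnorm (⟨u 1 0, u 1 1, u 1 2, u 1 3⟩ : Quat α β ℝ)
    + Y (Sum.inl 2) * qnorm (⟨u 2 0, u 2 1, u 2 2, u 2 3⟩ : Quat α β ℝ)
    + 2 * (star ⟨u 1 0, u 1 1, u 1 2, u 1 3⟩ * off α β Y 0 * ⟨u 2 0, u 2 1, u 2 2, u 2 3⟩).re
    + 2 * (star ⟨u 2 0, u 2 1, u 2 2, u 2 3⟩ * off α β Y 1 * ⟨u 0 0, u 0 1, u 0 2, u 0 3⟩).re
    + 2 * (star ⟨u 0 0, u 0 1, u 0 2, u 0 3⟩ * off α β Y 2 * ⟨u 1 0, u 1 1, u 1 2, u 1 3⟩).re :=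
  re_sum_star_mul_toMatrix_mul Y fun i => ⟨u i 0, u i 1, u i 2, u i 3⟩

theorem continuous_hermForm :
    Continuous fun p : H3 ℝ × (Fin 3 → Fin 4 → ℝ) => hermForm α β p.1 p.2 := by
  simp only [hermForm_eq, qnorm_eq, re_mul, imI_mul, imJ_mul, imK_mul, re_star, imI_star,
    imJ_star, imK_star, off]
  fun_prop

theorem hermForm_smul_right (Y : H3 ℝ) (t : ℝ) (u : Fin 3 → Fin 4 → ℝ) :
    hermForm α β Y (t • u) = t ^ 2 * hermForm α β Y u := by
  simp only [hermForm_eq, qnorm_eq, re_mul, imI_mul, imJ_mul, imK_mul, re_star, imI_star,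
    imJ_star, imK_star, Pi.smul_apply, smul_eq_mul]
  ring

theorem hermForm_smul_left (Y : H3 ℝ) (t : ℝ) (u : Fin 3 → Fin 4 → ℝ) :
    hermForm α β (t • Y) u = t * hermForm α β Y u := by
  simp only [hermForm_eq, off_smul, re_mul, imI_mul, imJ_mul, imK_mul,
    QuaternionAlgebra.re_smul, QuaternionAlgebra.imI_smul, QuaternionAlgebra.imJ_smul,
    QuaternionAlgebra.imK_smul, Pi.smul_apply, smul_eq_mul]
  ring

theorem hermForm_add_left (Y Y' : H3 ℝ) (u : Fin 3 → Fin 4 → ℝ) :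
    hermForm α β (Y + Y') u = hermForm α β Y u + hermForm α β Y' u := by
  simp only [hermForm_eq, off_add, re_mul, imI_mul, imJ_mul, imK_mul,
    QuaternionAlgebra.re_add, QuaternionAlgebra.imI_add, QuaternionAlgebra.imJ_add,
    QuaternionAlgebra.imK_add, Pi.add_apply]
  ring

theorem PosDefH.smul {Y : H3 ℝ} (hY : PosDefH α β Y) {t : ℝ} (ht : 0 < t) :
    PosDefH α β (t • Y) := by
  rw [posDefH_iff] at hY ⊢
  intro u hu
  rw [hermForm_smul_left]
  exact mul_pos ht (hY u hu)

theorem convex_posDefH : Convex ℝ {Y : H3 ℝ | PosDefH α β Y} := by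
  rw [convex_iff_forall_pos]
  intro Y hY Y' hY' a b ha hb _
  have h₁ := PosDefH.smul hY ha
  have h₂ := PosDefH.smul hY' hb
  rw [Set.mem_ofPred_eq, posDefH_iff] at *
  intro u hu
  rw [hermForm_add_left]
  exact add_pos (h₁ u hu) (h₂ u hu)

/-- By homogeneity, positivity need only be tested on the unit sphere, and compactness of the sphere
makes the condition open in `Y`. -/
theorem isOpen_posDefH : IsOpen {Y : H3 ℝ | PosDefH α β Y} := by
  have hiff : ∀ Y : H3 ℝ, PosDefH α β Y ↔
      ∀ u ∈ Metric.sphere (0 : Fin 3 → Fin 4 → ℝ) 1, 0 < hermForm α β Y u := fun Y => by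
    rw [posDefH_iff]
    constructor
    · intro h u hu
      exact h u (ne_zero_of_mem_sphere one_ne_zero ⟨u, hu⟩)
    · intro h u hu
      have hn : 0 < ‖u‖ := norm_pos_iff.2 hu
      have := h (‖u‖⁻¹ • u) (by
        rw [mem_sphere_zero_iff_norm, norm_smul, norm_inv, norm_norm, inv_mul_cancel₀ hn.ne'])
      rw [hermForm_smul_right] at this
      exact pos_of_mul_pos_right this (by positivity)
  rw [isOpen_iff_eventually]
  intro Y hY
  rw [Set.mem_ofPred_eq, hiff] at hY
  have := (isCompact_sphere (0 : Fin 3 → Fin 4 → ℝ) 1).eventually_forall_of_forall_eventually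
    (x₀ := Y) (P := fun Y u => 0 < hermForm α β Y u) fun u hu =>
      (continuous_hermForm (α := α) (β := β)).continuousAt.eventually_const_lt (hY u hu)
  filter_upwards [this] with Y' hY'
  exact (hiff Y').2 hY'

theorem qnorm_nonneg (hα : α < 0) (hβ : β < 0) (x : Quat α β ℝ) : 0 ≤ qnorm x := by
  have hα' : (α : ℝ) < 0 := by exact_mod_cast hα
  have hβ' : (β : ℝ) < 0 := by exact_mod_cast hβ
  have := mul_pos_of_neg_of_neg hα' hβ'
  rw [qnorm_eq]
  nlinarith [sq_nonneg x.re, mul_nonneg (neg_nonneg.2 hα'.le) (sq_nonneg x.imI),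
    mul_nonneg (neg_nonneg.2 hβ'.le) (sq_nonneg x.imJ), mul_nonneg this.le (sq_nonneg x.imK)]

theorem qnorm_pos (hα : α < 0) (hβ : β < 0) {x : Quat α β ℝ} (hx : x ≠ 0) : 0 < qnorm x := by
  refine (qnorm_nonneg hα hβ x).lt_of_ne' fun h => hx ?_
  have hα' : (α : ℝ) < 0 := by exact_mod_cast hα
  have hβ' : (β : ℝ) < 0 := by exact_mod_cast hβ
  have hαβ := mul_pos_of_neg_of_neg hα' hβ'
  rw [qnorm_eq] at h
  have h₁ := sq_nonneg x.re
  have h₂ := mul_nonneg (neg_nonneg.2 hα'.le) (sq_nonneg x.imI)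
  have h₃ := mul_nonneg (neg_nonneg.2 hβ'.le) (sq_nonneg x.imJ)
  have h₄ := mul_nonneg hαβ.le (sq_nonneg x.imK)
  have e₁ : x.re ^ 2 = 0 := by linarith
  have e₂ : (α : ℝ) * x.imI ^ 2 = 0 := by linarith
  have e₃ : (β : ℝ) * x.imJ ^ 2 = 0 := by linarith
  have e₄ : (α : ℝ) * β * x.imK ^ 2 = 0 := by linarith
  exact QuaternionAlgebra.ext (pow_eq_zero_iff two_ne_zero |>.1 e₁)
    (pow_eq_zero_iff two_ne_zero |>.1 ((mul_eq_zero_iff_left hα'.ne).1 e₂))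
    (pow_eq_zero_iff two_ne_zero |>.1 ((mul_eq_zero_iff_left hβ'.ne).1 e₃))
    (pow_eq_zero_iff two_ne_zero |>.1 ((mul_eq_zero_iff_left hαβ.ne').1 e₄))

end PositiveDefinite

section SiegelSpace

/-- For a real symmetric `Y` the Hermitian form splits into four copies of the quadratic form of
`Y`, one for each of `1, i, j, k`, with the positive weights `1, -α, -β, αβ`. -/
theorem siegelEmb_mem_HH (hα : α < 0) (hβ : β < 0) {z : Matrix (Fin 3) (Fin 3) ℂ}
    (hz : z ∈ Siegel) : siegelEmb z ∈ HH α β := by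
  obtain ⟨hs, hp⟩ := hz
  change PosDefH α β _
  rw [posDefH_iff]
  intro u hu
  set Y := z.map Complex.im with hY
  have hsY : ∀ i j, Y i j = Y j i := fun i j => by
    rw [hY, Matrix.map_apply, Matrix.map_apply, ← hs.apply i j]
  have hα' : 0 < -(α : ℝ) := by rw [neg_pos]; exact_mod_cast hα
  have hβ' : 0 < -(β : ℝ) := by rw [neg_pos]; exact_mod_cast hβ
  set q : Fin 4 → ℝ := fun l => dotProduct (fun i => u i l) (Y.mulVec fun i => u i l) with hq
  set n : Fin 4 → ℝ := ![1, -α, -β, -α * -β] with hn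
  have hnpos : ∀ l, 0 < n l := fun l => by
    have := mul_pos hα' hβ'
    fin_cases l <;> simp [hn] at * <;> linarith
  have hform : hermForm α β (imH (siegelEmb z)) u = ∑ l, n l * q l := by
    have h01 := hsY 1 0
    have h12 := hsY 2 1
    have h02 := hsY 2 0
    simp only [hermForm_eq, qnorm_eq, re_mul, imI_mul, imJ_mul, imK_mul, re_star, imI_star,
      imJ_star, imK_star]
    simp only [hq, hn, dotProduct, Matrix.mulVec, Fin.sum_univ_three, Fin.sum_univ_four, h01, h12,
      h02]
    simp [imH, siegelEmb, off, hY]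
    have h02' : (z 2 0).im = (z 0 2).im := h02
    rw [h02']
    ring
  rw [hform]
  have hq0 : ∀ l, 0 ≤ q l := fun l => by
    simpa using hp.posSemidef.dotProduct_mulVec_nonneg fun i => u i l
  obtain ⟨l, hl⟩ : ∃ l, (fun i => u i l) ≠ 0 := by
    by_contra! h
    exact hu (by funext i l; exact congrFun (h l) i)
  refine Finset.sum_pos' (fun l _ => mul_nonneg (hnpos l).le (hq0 l))
    ⟨l, Finset.mem_univ _, mul_pos (hnpos l) ?_⟩
  simpa using hp.dotProduct_mulVec_pos hl

/-- The symmetric matrix `T` such that `tr(z, h) = tr(Tz)` for `z` in the Siegel space. -/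
def symPart (h : H3 ℚ) : Sym3 :=
  ⟨!![h (Sum.inl 0), h (Sum.inr (2, 0)), h (Sum.inr (1, 0));
      h (Sum.inr (2, 0)), h (Sum.inl 1), h (Sum.inr (0, 0));
      h (Sum.inr (1, 0)), h (Sum.inr (0, 0)), h (Sum.inl 2)], by
    ext i j; fin_cases i <;> fin_cases j <;> rfl⟩

/-- The Hermitian matrix with the same entries as a symmetric matrix. -/
def ofSym (T : Sym3) : H3 ℚ :=
  Sum.elim (fun i => T.1 i i) fun p => if p.2 = 0 then ![T.1 1 2, T.1 2 0, T.1 0 1] p.1 else 0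

/-- The entries of `siegelEmb z` have no `i, j, k` coordinates, so those of `h` drop out of the
pairing. -/
theorem trPair_siegelEmb {z : Matrix (Fin 3) (Fin 3) ℂ} (hz : z.IsSymm) (h : H3 ℚ) :
    trPair α β (siegelEmb z) (fun k => ((h k : ℚ) : ℂ)) =
      Matrix.trace ((symPart h).1.map (fun q : ℚ => (q : ℂ)) * z) := by
  have h01 := hz.apply 0 1
  have h12 := hz.apply 1 2
  have h02 := hz.apply 0 2
  rw [trPair_eq_sum, Fintype.sum_sum_type, Fintype.sum_prod_type]
  simp [Fin.sum_univ_three, pairWeight, siegelEmb, symPart, Matrix.trace,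
    Matrix.mul_apply, h01, h12, h02]
  ring

theorem symPart_ofSym (T : Sym3) : symPart (ofSym T) = T := by
  have h : ∀ i j, T.1 i j = T.1 j i := fun i j => (T.2.apply i j).symm
  apply Subtype.ext
  ext i j
  fin_cases i <;> fin_cases j <;> simp [symPart, ofSym] <;> exact h _ _

theorem ofSym_injective : Function.Injective ofSym :=
  Function.LeftInverse.injective symPart_ofSym

end SiegelSpace

end QuatG

end

/-! ### Moving the base point along rays. -/

noncomputable section
namespace QuatG

set_option linter.unusedSectionVars false

variable {α β : ℚ}

section BasePoint

open Complex in
-- The inversion acts as `Z ↦ -Z⁻¹`, which fixes `i`.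
theorem inversion_rvec_iH : inversion (rvec α β iH) = -I • rvec α β iH := by
  have hs : sharp α β iH = Sum.elim (fun _ => -1) fun _ => 0 := by
    apply ext_dg_off (α := α) (β := β) <;> intro i
    · fin_cases i <;> dsimp only [Fin.zero_eta, Fin.mk_one, Fin.reduceFinMk, Fin.isValue] <;>
        simp only [dg_sharp_zero, dg_sharp_one, dg_sharp_two, qnorm_eq] <;> simp [iH, dg, off]
    · fin_cases i <;> dsimp only [Fin.zero_eta, Fin.mk_one, Fin.reduceFinMk, Fin.isValue] <;>
        simp only [off_sharp_zero, off_sharp_one, off_sharp_two] <;> ext <;> simp [iH, dg, off]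
  have hN : normN α β iH = -I := by
    simp [normN, qnorm_eq, qtr_eq, iH, dg, off]
  apply W_ext <;> simp only [inversion_apply, rvec, wa_mkW, wb_mkW, wc_mkW, wd_mkW, wa_smul,
    wb_smul, wc_smul, wd_smul, hs, hN]
  · ring
  · funext k
    rcases k with k | k <;> simp [iH]
  · funext k
    rcases k with k | k <;> simp [iH]
  · simp

theorem oppositeTranslation_rvec_iH (A : H3 ℂ) : oppositeTranslation α β (-A) (rvec α β iH) =
    Complex.I • mkW (normN α β (iH + A)) (sharp α β (iH + A)) (iH + A) 1 := by
  rw [oppositeTranslation_apply, inversion_rvec_iH, map_smul, translation_rvec, map_smul,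
    sub_neg_eq_add, neg_smul, neg_neg]
  congr 1
  apply W_ext <;> simp [inversion_apply, rvec]

/-- The elements of `G^+(ℝ)` that move the base point along a ray, up to translation. -/
def rayGL (α β : ℚ) (A X : H3 ℝ) (s : ℝ) : GLW ℝ :=
  translationGL α β X * (scalingGL s * oppositeGL α β A)

theorem rayGL_mem (A X : H3 ℝ) (s : ℝ) : rayGL α β A X s ∈ GPlus α β :=
  mul_mem (translationGL_mem X) (mul_mem (scalingGL_mem s) (oppositeGL_mem A))

theorem ract_rayGL_inv_toC (A X : H3 ℝ) (s : ℝ) (w : W ℂ) :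
    ract w (toC (rayGL α β A X s)⁻¹) = translation α β (-fun k => (X k : ℂ))
      (scaling (Real.exp (-s) : ℂ) (oppositeTranslation α β (-fun k => (A k : ℂ)) w)) := by
  have h : ∀ A : H3 ℝ, (fun k => ((-A) k : ℂ)) = -fun k => (A k : ℂ) := fun A => by
    funext k; simp
  rw [rayGL, mul_inv_rev, mul_inv_rev, toC_mul, toC_mul, ract_mul, ract_mul]
  rw [show (oppositeGL α β A)⁻¹ = oppositeGL α β (-A) from glFamily_inv _ _ _,
    show (scalingGL s)⁻¹ = scalingGL (-s) from glFamily_inv _ _ _,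
    show (translationGL α β X)⁻¹ = translationGL α β (-X) from glFamily_inv _ _ _,
    ract_oppositeGL_toC, ract_scalingGL_toC, ract_translationGL_toC]
  simp only [Pi.neg_apply, Complex.ofReal_neg]
  rfl

/-- Since `N(h)⁻¹ h^#` is the inverse of `h`, the new point is `X - e^{2s}(i + A)⁻¹`. The exponent
`2s` is the difference of the weights `3` and `1` of `scaling` on the first two components. -/
theorem act_rayGL_iH {A : H3 ℝ} (hA : normN α β (iH + fun k => (A k : ℂ)) ≠ 0) (X : H3 ℝ) (s : ℝ) :
    act α β (rayGL α β A X s) iH = (fun k => (X k : ℂ)) - (Real.exp (2 * s) : ℂ) •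
      ((normN α β (iH + fun k => (A k : ℂ)))⁻¹ • sharp α β (iH + fun k => (A k : ℂ))) := by
  rw [act, jfac, ract_rayGL_inv_toC, oppositeTranslation_rvec_iH]
  set N := normN α β (iH + fun k => (A k : ℂ))
  set S := sharp α β (iH + fun k => (A k : ℂ))
  have he : (Real.exp (2 * s) : ℂ) = ((Real.exp (-s) : ℂ) ^ 2)⁻¹ := by
    rw [← Complex.ofReal_pow, ← Complex.ofReal_inv, ← Real.exp_nat_mul, ← Real.exp_neg]
    congr 2
    push_cast
    ring
  have h0 : (Real.exp (-s) : ℂ) ≠ 0 := Complex.ofReal_ne_zero.2 (Real.exp_ne_zero _)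
  have hI := Complex.I_ne_zero
  rw [he]
  funext k
  simp only [translation_apply, scaling_apply, wa_mkW, wb_mkW, wa_smul, wb_smul, Pi.neg_apply,
    Pi.smul_apply, Pi.add_apply, Pi.sub_apply, smul_eq_mul]
  field_simp
  ring

end BasePoint

/-! ### Submultiplicativity of the height, and growth of `F` on a ray. -/

section Height

theorem abs_entry_le_height (g : GLW ℝ) (i j : WIdx) :
    |(g.1 : Matrix WIdx WIdx ℝ) i j| ≤ height g :=
  (norm_le_pi_norm (fun p : WIdx × WIdx => (g.1 : Matrix WIdx WIdx ℝ) p.1 p.2) (i, j)).trans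
    (le_max_left _ _)

theorem abs_inv_entry_le_height (g : GLW ℝ) (i j : WIdx) :
    |((g⁻¹).1 : Matrix WIdx WIdx ℝ) i j| ≤ height g :=
  (norm_le_pi_norm (fun p : WIdx × WIdx => ((g⁻¹).1 : Matrix WIdx WIdx ℝ) p.1 p.2) (i, j)).trans
    (le_max_right _ _)

theorem height_nonneg (g : GLW ℝ) : 0 ≤ height g := (norm_nonneg _).trans (le_max_left _ _)

theorem height_le {g : GLW ℝ} {C : ℝ} (hC : 0 ≤ C)
    (h₁ : ∀ i j, |(g.1 : Matrix WIdx WIdx ℝ) i j| ≤ C)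
    (h₂ : ∀ i j, |((g⁻¹).1 : Matrix WIdx WIdx ℝ) i j| ≤ C) : height g ≤ C :=
  max_le ((pi_norm_le_iff_of_nonneg hC).2 fun p => h₁ p.1 p.2)
    ((pi_norm_le_iff_of_nonneg hC).2 fun p => h₂ p.1 p.2)

theorem abs_mul_entry_le {M N : Matrix WIdx WIdx ℝ} {a b : ℝ} (ha : 0 ≤ a)
    (hM : ∀ i j, |M i j| ≤ a) (hN : ∀ i j, |N i j| ≤ b) (i j : WIdx) :
    |(M * N) i j| ≤ Fintype.card WIdx * (a * b) := by
  rw [Matrix.mul_apply]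
  refine (Finset.abs_sum_le_sum_abs _ _).trans ?_
  calc ∑ k, |M i k * N k j| ≤ ∑ _k : WIdx, a * b := Finset.sum_le_sum fun k _ => by
        rw [abs_mul]
        exact mul_le_mul (hM i k) (hN k j) (abs_nonneg _) ha
    _ = _ := by rw [Finset.sum_const, Finset.card_univ, nsmul_eq_mul]

theorem height_mul_le (g h : GLW ℝ) :
    height (g * h) ≤ Fintype.card WIdx * (height g * height h) := by
  have hg := height_nonneg g
  have hh := height_nonneg h
  refine height_le (by positivity) (fun i j => ?_) fun i j => ?_
  · exact abs_mul_entry_le hg (abs_entry_le_height g) (abs_entry_le_height h) i j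
  · rw [mul_inv_rev, mul_comm (height g)]
    exact abs_mul_entry_le hh (abs_inv_entry_le_height h) (abs_inv_entry_le_height g) i j

theorem continuous_height : Continuous height := by
  have h : Continuous fun g : GLW ℝ =>
      fun p : WIdx × WIdx => (g.1 : Matrix WIdx WIdx ℝ) p.1 p.2 :=
    continuous_pi fun p => (Units.continuous_val.comp continuous_fst).matrix_elem p.1 p.2
  exact h.norm.max (h.comp continuous_inv).norm

theorem continuous_translationGL : Continuous (translationGL α β) :=
  continuous_glFamily translation_zero translation_add fun _ => Continuous.translation continuous_id continuous_const

theorem height_scalingGL_le {s : ℝ} (hs : 0 ≤ s) : height (scalingGL s) ≤ Real.exp (3 * s) := by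
  have key : ∀ t : ℝ, 0 < t → t ≤ Real.exp s → t⁻¹ ≤ Real.exp s → ∀ i j,
      |rightMatrix (scaling t) i j| ≤ Real.exp (3 * s) := by
    intro t ht h₁ h₂ i j
    have h1 : 1 ≤ Real.exp s := Real.one_le_exp hs
    have e : Real.exp (3 * s) = Real.exp s ^ 3 := by
      rw [← Real.exp_nat_mul]; norm_num
    have hti : 0 < t⁻¹ := inv_pos.2 ht
    have hle : Real.exp s ≤ Real.exp s ^ 3 := le_self_pow₀ h1 (by norm_num)
    have hsingle : |(Pi.single i 1 : W ℝ) j| ≤ 1 := by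
      by_cases hij : j = i
      · subst hij; simp
      · simp [hij]
    have hmul : ∀ c : ℝ, 0 ≤ c → c ≤ Real.exp s ^ 3 →
        |c * (Pi.single i 1 : W ℝ) j| ≤ Real.exp s ^ 3 := fun c h0 hc => by
      rw [abs_mul, abs_of_nonneg h0]
      exact (mul_le_of_le_one_right h0 hsingle).trans hc
    simp only [rightMatrix, Matrix.transpose_apply, LinearMap.toMatrix'_apply]
    rw [e]
    rcases j with j | j | j | j
    · exact hmul _ (by positivity) (pow_le_pow_left₀ ht.le h₁ 3)
    · exact hmul _ ht.le (h₁.trans hle)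
    · exact hmul _ hti.le (h₂.trans hle)
    · exact hmul _ (by positivity) (pow_le_pow_left₀ hti.le h₂ 3)
  refine height_le (Real.exp_nonneg _) (key _ (Real.exp_pos _) le_rfl ?_)
    (key (Real.exp (-s)) (Real.exp_pos _) ?_ ?_)
  · rw [← Real.exp_neg]; exact Real.exp_le_exp.2 (by linarith)
  · exact Real.exp_le_exp.2 (by linarith)
  · rw [← Real.exp_neg, neg_neg]

end Height

/-- The growth of a periodic modular form on a ray of imaginary parts. -/
theorem IsModularForm.growth_on_ray {r : ℕ} {Γ : Subgroup (GLW ℝ)} {F : H3 ℂ → ℂ}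
    (hF : IsModularForm α β r Γ F) {T : ℕ} (hT : 0 < T)
    (hper : ∀ m : HIdx → ℤ, ∀ Z ∈ HH α β, F (Z + fun k => (T : ℂ) * m k) = F Z)
    {A X₀ Y₀ : H3 ℝ} (hA : normN α β (iH + fun k => (A k : ℂ)) ≠ 0)
    (hZ : -((normN α β (iH + fun k => (A k : ℂ)))⁻¹ • sharp α β (iH + fun k => (A k : ℂ))) =
      fun k => (X₀ k : ℂ) + Y₀ k * Complex.I)
    (hY : PosDefH α β Y₀) (hN : normN α β Y₀ ≠ 0) :
    ∃ C K : ℝ, 0 ≤ C ∧ 0 ≤ K ∧ ∀ s : ℝ, 0 ≤ s → ∀ X : H3 ℝ,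
      ‖F (fun k => (X k : ℂ) + ((Real.exp (2 * s) * Y₀ k : ℝ) : ℂ) * Complex.I)‖ ≤
        C * Real.exp (K * s) := by
  obtain ⟨C, n, hC⟩ := hF.moderate_growth
  -- Periodicity lets the translation part range over a compact box only, where its height is
  -- bounded. This makes the estimate uniform in `X`.
  obtain ⟨H, hH⟩ := (isCompact_Icc (a := (0 : H3 ℝ)) (b := fun _ => (T : ℝ))).exists_bound_of_continuousOn
    (continuous_height.comp (continuous_translationGL (α := α) (β := β))).continuousOn
  have hTR : (0 : ℝ) < T := Nat.cast_pos.2 hT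
  have hHnn : 0 ≤ H := (norm_nonneg _).trans (hH 0 ⟨le_rfl, fun _ => hTR.le⟩)
  set c : ℝ := ((Fintype.card WIdx : ℕ) : ℝ) with hc
  have hcnn : 0 ≤ c := Nat.cast_nonneg _
  set B : ℝ := c * (H * (c * height (oppositeGL α β A))) with hB
  have hBnn : 0 ≤ B := by have := height_nonneg (oppositeGL α β A); positivity
  refine ⟨|C| * B ^ n / |normN α β Y₀| ^ r, 3 * n, by positivity, by positivity,
    fun s hs X => ?_⟩
  -- The point on the ray has real part `e^{2s}X₀`, which has to be subtracted from `X` before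
  -- reducing modulo `T`.
  set X' : H3 ℝ := fun k => X k - Real.exp (2 * s) * X₀ k with hX'
  set m : HIdx → ℤ := fun k => -⌊X' k / T⌋ with hm
  set X₂ : H3 ℝ := fun k => X' k + T * m k with hX₂
  have hX₂mem : X₂ ∈ Set.Icc (0 : H3 ℝ) fun _ => (T : ℝ) := by
    constructor <;> intro k
    · have h1 := Int.floor_le (X' k / T)
      rw [le_div_iff₀ hTR] at h1
      simp only [hX₂, hm, Int.cast_neg, Pi.zero_apply]
      linarith
    · have h1 := (Int.lt_floor_add_one (X' k / T)).le
      rw [div_le_iff₀ hTR] at h1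
      simp only [hX₂, hm, Int.cast_neg]
      linarith
  have hact : act α β (rayGL α β A X₂ s) iH =
      (fun k => (X k : ℂ) + ((Real.exp (2 * s) * Y₀ k : ℝ) : ℂ) * Complex.I) +
        fun k => (T : ℂ) * m k := by
    rw [act_rayGL_iH hA, sub_eq_add_neg, ← smul_neg, hZ]
    funext k
    simp only [hX₂, hX', Pi.add_apply, Pi.smul_apply, smul_eq_mul]
    push_cast
    ring
  have him : imH (act α β (rayGL α β A X₂ s) iH) = Real.exp (2 * s) • Y₀ := by
    rw [hact]
    funext k
    simp [imH, -Complex.ofReal_mul, -Complex.ofReal_exp]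
  have hmem : (fun k => (X k : ℂ) + ((Real.exp (2 * s) * Y₀ k : ℝ) : ℂ) * Complex.I) ∈ HH α β := by
    change PosDefH α β _
    convert hY.smul (Real.exp_pos (2 * s)) using 1
    funext k
    simp [imH, -Complex.ofReal_mul]
  have hval := hC _ (rayGL_mem (α := α) (β := β) A X₂ s)
  rw [him, hact, hper m _ hmem, normN_smul, norm_mul, norm_pow, Complex.norm_real, norm_mul,
    norm_pow, Real.norm_of_nonneg (Real.exp_nonneg _), Real.norm_eq_abs] at hval
  have hheight : height (rayGL α β A X₂ s) ≤ B * Real.exp (3 * s) := by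
    have h1 := height_mul_le (translationGL α β X₂) (scalingGL s * oppositeGL α β A)
    have h2 := height_mul_le (scalingGL s) (oppositeGL α β A)
    have h3 := height_scalingGL_le hs
    have h4 : height (translationGL α β X₂) ≤ H := (le_abs_self _).trans (hH X₂ hX₂mem)
    have h5 := height_nonneg (oppositeGL α β A)
    calc height (rayGL α β A X₂ s)
        ≤ c * (height (translationGL α β X₂) * height (scalingGL s * oppositeGL α β A)) := h1
      _ ≤ c * (H * (c * (Real.exp (3 * s) * height (oppositeGL α β A)))) := by
          refine mul_le_mul_of_nonneg_left (mul_le_mul h4 (h2.trans ?_) (height_nonneg _) hHnn) hcnn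
          gcongr
      _ = B * Real.exp (3 * s) := by rw [hB]; ring
  have hNpos : 0 < |normN α β Y₀| ^ r := by positivity
  -- The norm of `e^{2s}Y₀` is `e^{6s}N(Y₀)`; the exponential factor only helps and is dropped.
  have h1 : 1 ≤ Real.exp (2 * s) ^ 3 := one_le_pow₀ (Real.one_le_exp (by linarith))
  rw [div_mul_eq_mul_div, le_div_iff₀ hNpos]
  set f := ‖F (fun k => (X k : ℂ) + ((Real.exp (2 * s) * Y₀ k : ℝ) : ℂ) * Complex.I)‖
  calc f * |normN α β Y₀| ^ r
      ≤ (Real.exp (2 * s) ^ 3 * |normN α β Y₀|) ^ r * f := by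
        rw [mul_comm]
        refine mul_le_mul_of_nonneg_right (pow_le_pow_left₀ (abs_nonneg _) ?_ r) (norm_nonneg _)
        exact le_mul_of_one_le_left (abs_nonneg _) h1
    _ ≤ C * height (rayGL α β A X₂ s) ^ n := hval
    _ ≤ |C| * (B * Real.exp (3 * s)) ^ n := by
        exact mul_le_mul (le_abs_self C) (pow_le_pow_left₀ (height_nonneg _) hheight n)
          (pow_nonneg (height_nonneg _) n) (abs_nonneg C)
    _ = |C| * B ^ n * Real.exp (3 * n * s) := by
        rw [mul_pow, ← Real.exp_nat_mul, mul_assoc |C|, show (n : ℝ) * (3 * s) = 3 * n * s by ring]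

/-! ### Explicit imaginary parts with one nonzero off-diagonal quaternion. -/

section TestPoints

theorem qnorm_smul_sub_two_smul (t : ℝ) (a y z : Quat α β ℝ) :
    qnorm (t • y - (2 : ℝ) • (a * z)) =
      t ^ 2 * qnorm y - 4 * t * (star y * a * z).re + 4 * qnorm a * qnorm z := by
  simp only [qnorm_eq, re_mul, imI_mul, imJ_mul, imK_mul, re_star, imI_star, imJ_star, imK_star,
    QuaternionAlgebra.re_sub, QuaternionAlgebra.imI_sub, QuaternionAlgebra.imJ_sub,
    QuaternionAlgebra.imK_sub, QuaternionAlgebra.re_smul, QuaternionAlgebra.imI_smul,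
    QuaternionAlgebra.imJ_smul, QuaternionAlgebra.imK_smul, smul_eq_mul]
  ring

/-- The Hermitian matrix with diagonal entries `1` and one further entry `u`. -/
def testShift (i : Fin 3) (u : Fin 4 → ℝ) : H3 ℝ :=
  -- The imaginary part of `-(A + i)⁻¹` is `(A² + 1)⁻¹`. With diagonal `1` the matrix `A²` has the
  -- off-diagonal entry `2u`; with diagonal `0` it would be diagonal and give no information on that
  -- entry.
  Sum.elim (fun _ => 1) fun p => if p.1 = i then u p.2 else 0

/-- The real part of `-(A + i)⁻¹` for the matrix `A` of `testShift`, where `n = n(u)`. -/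
def testRe (i : Fin 3) (u : Fin 4 → ℝ) (n : ℝ) : H3 ℝ :=
  Sum.elim (fun j => if j = i then -1 / 2 else (n - 2) / (n ^ 2 + 4))
    fun p => if p.1 = i then -n * u p.2 / (n ^ 2 + 4) else 0

/-- The imaginary part of `-(A + i)⁻¹` for the matrix `A` of `testShift`, where `n = n(u)`. -/
def testIm (i : Fin 3) (u : Fin 4 → ℝ) (n : ℝ) : H3 ℝ :=
  Sum.elim (fun j => if j = i then 1 / 2 else (n + 2) / (n ^ 2 + 4))
    fun p => if p.1 = i then -2 * u p.2 / (n ^ 2 + 4) else 0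

variable (i : Fin 3) {u : Fin 4 → ℝ} {n : ℝ}
  (hn : n = u 0 ^ 2 - α * u 1 ^ 2 - β * u 2 ^ 2 + α * β * u 3 ^ 2)

open Complex

include hn in
theorem normN_testShift : normN α β (iH + fun k => (testShift i u k : ℂ)) =
    (1 + I) * (2 * I - n) := by
  have hI := Complex.I_sq
  rw [hn]
  fin_cases i <;> simp [normN, qnorm_eq, qtr_eq, testShift, iH, dg, off] <;> ring_nf <;> simp only [hI, show I ^ 3 = -I by rw [pow_succ, hI]; ring] <;> ring

include hn in
theorem sharp_testShift : sharp α β (iH + fun k => (testShift i u k : ℂ)) =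
    Sum.elim (fun j => if j = i then 2 * I - n else 2 * I)
      fun p => if p.1 = i then -(1 + I) * u p.2 else 0 := by
  have hI := Complex.I_sq
  rw [hn]
  apply ext_dg_off (α := α) (β := β) <;> intro j
  · fin_cases i <;> fin_cases j <;>
      dsimp only [Fin.zero_eta, Fin.mk_one, Fin.reduceFinMk, Fin.isValue] <;>
      simp only [dg_sharp_zero, dg_sharp_one, dg_sharp_two, qnorm_eq] <;>
      simp [testShift, iH, dg, off] <;>
      ring_nf <;> simp only [hI] <;> ring
  · fin_cases i <;> fin_cases j <;>
      dsimp only [Fin.zero_eta, Fin.mk_one, Fin.reduceFinMk, Fin.isValue] <;> 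
      simp only [off_sharp_zero, off_sharp_one, off_sharp_two] <;> ext <;>
      simp [testShift, iH, dg, off] <;> ring

theorem two_I_sub_ne_zero (n : ℝ) : 2 * I - (n : ℂ) ≠ 0 := fun h => by
  have := congrArg Complex.im h
  simp at this

theorem one_add_I_ne_zero : (1 : ℂ) + I ≠ 0 := fun h => by
  have := congrArg Complex.im h
  simp at this

include hn in
theorem neg_inv_testShift :
    -((normN α β (iH + fun k => (testShift i u k : ℂ)))⁻¹ •
      sharp α β (iH + fun k => (testShift i u k : ℂ))) =
      fun k => (testRe i u n k : ℂ) + testIm i u n k * I := by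
  have hI := Complex.I_sq
  have h₁ := one_add_I_ne_zero
  have h₂ := two_I_sub_ne_zero n
  have h₃ : (n : ℂ) ^ 2 + 4 ≠ 0 := by
    have : (n : ℝ) ^ 2 + 4 ≠ 0 := by positivity
    exact_mod_cast this
  rw [normN_testShift i hn, sharp_testShift i hn]
  funext k
  rw [Pi.neg_apply, Pi.smul_apply, smul_eq_mul, neg_eq_iff_eq_neg,
    inv_mul_eq_iff_eq_mul₀ (mul_ne_zero h₁ h₂)]
  rcases k with j | ⟨j, l⟩
  · by_cases hj : j = i
    · simp only [Sum.elim_inl, testRe, testIm, if_pos hj]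
      push_cast
      linear_combination (2 * I - n) / 2 * hI
    · simp only [Sum.elim_inl, testRe, testIm, if_neg hj]
      push_cast
      field_simp
      linear_combination (2 * n - n ^ 2 + (2 * n + 4) * I) * hI
  · by_cases hj : j = i
    · simp only [Sum.elim_inr, testRe, testIm, if_pos hj]
      push_cast
      field_simp
      linear_combination -4 * (u l : ℂ) * hI
    · simp [testRe, testIm, hj]

include hn in
theorem normN_testIm : normN α β (testIm i u n) = 1 / (2 * (n ^ 2 + 4)) := by
  have h₃ : n ^ 2 + 4 ≠ 0 := by positivity
  have e : normN α β (testIm i u n) = 1 / 2 * (((n + 2) / (n ^ 2 + 4)) ^ 2 -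
      (2 / (n ^ 2 + 4)) ^ 2 * (u 0 ^ 2 - α * u 1 ^ 2 - β * u 2 ^ 2 + α * β * u 3 ^ 2)) := by
    fin_cases i <;> simp [normN, qnorm_eq, qtr_eq, testIm, dg, off] <;> ring
  -- The numerator simplifies by `(n + 2)² - 4n = n² + 4`.
  rw [e, ← hn]
  field_simp
  ring

include hn in
-- The `i`-th diagonal entry splits off, and the remaining binary Hermitian form is positive by
-- completing the square in `y`.
theorem posDefH_testIm (hα : α < 0) (hβ : β < 0) : PosDefH α β (testIm i u n) := by
  have hn' : n = qnorm (⟨u 0, u 1, u 2, u 3⟩ : Quat α β ℝ) := by rw [hn, qnorm_eq]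
  set a : Quat α β ℝ := ⟨u 0, u 1, u 2, u 3⟩ with ha
  have hn0 : 0 ≤ n := by rw [hn']; exact qnorm_nonneg hα hβ a
  have h₄ : 0 < n ^ 2 + 4 := by positivity
  have key : ∀ x y z : Quat α β ℝ, (x ≠ 0 ∨ y ≠ 0 ∨ z ≠ 0) →
      0 < 1 / 2 * qnorm x + (n + 2) / (n ^ 2 + 4) * qnorm y + (n + 2) / (n ^ 2 + 4) * qnorm z
        + 2 * (star y * ((-2 / (n ^ 2 + 4) : ℝ) • a) * z).re := by
    intro x y z h
    have e : 1 / 2 * qnorm x + (n + 2) / (n ^ 2 + 4) * qnorm y + (n + 2) / (n ^ 2 + 4) * qnorm z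
        + 2 * (star y * ((-2 / (n ^ 2 + 4) : ℝ) • a) * z).re =
        1 / 2 * qnorm x + (qnorm ((n + 2) • y - (2 : ℝ) • (a * z)) / (n ^ 2 + 4) + qnorm z)
          / (n + 2) := by
      have h₅ : n + 2 ≠ 0 := by positivity
      have h₆ : n ^ 2 + 4 ≠ 0 := by positivity
      rw [qnorm_smul_sub_two_smul, ← hn', mul_smul_comm, smul_mul_assoc,
        QuaternionAlgebra.re_smul, smul_eq_mul]
      field_simp
      ring
    rw [e]
    have hx := qnorm_nonneg hα hβ x
    have hz := qnorm_nonneg hα hβ z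
    have hy := qnorm_nonneg hα hβ ((n + 2) • y - (2 : ℝ) • (a * z))
    by_cases hz0 : z = 0
    · subst hz0
      by_cases hy0 : y = 0
      · have := qnorm_pos hα hβ (h.resolve_right (by simp [hy0]))
        positivity
      · have h₇ : 0 < qnorm ((n + 2) • y - (2 : ℝ) • (a * 0)) := by
          refine qnorm_pos hα hβ ?_
          rw [mul_zero, smul_zero, sub_zero]
          exact smul_ne_zero (by positivity) hy0
        positivity
    · have := qnorm_pos hα hβ hz0
      positivity
  intro v hv
  rw [re_sum_star_mul_toMatrix_mul]
  have hoff : ∀ j, off α β (testIm i u n) j = if j = i then (-2 / (n ^ 2 + 4) : ℝ) • a else 0 := by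
    intro j
    by_cases hj : j = i
    · ext <;> simp [off, testIm, hj, ha] <;> ring
    · ext <;> simp [off, testIm, hj]
  have hv' : ∃ j, v j ≠ 0 := Function.ne_iff.1 hv
  rw [Fin.exists_fin_succ, Fin.exists_fin_two] at hv'
  have hv' : v 0 ≠ 0 ∨ v 1 ≠ 0 ∨ v 2 ≠ 0 := hv'
  simp only [hoff]
  fin_cases i
  · have := key (v 0) (v 1) (v 2) hv'
    simpa [testIm, dg, -Nat.reduceAdd] using this
  · have := key (v 1) (v 2) (v 0) (by tauto)
    simp [testIm, dg] at this ⊢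
    linarith
  · have := key (v 2) (v 0) (v 1) (by tauto)
    simp [testIm, dg] at this ⊢
    linarith

end TestPoints

end QuatG

end

/-! ### Existence of the Fourier expansion of `F`. -/

noncomputable section
namespace QuatG

set_option linter.unusedSectionVars false

variable {α β : ℚ}

section Periodic

variable {F : H3 ℂ → ℂ} {T : ℕ}

theorem smul_mem_HH {Z : H3 ℂ} (hZ : Z ∈ HH α β) {t : ℝ} (ht : 0 < t) : (t : ℂ) • Z ∈ HH α β := by
  change PosDefH α β _
  convert PosDefH.smul hZ ht using 1
  funext k
  simp [imH]

theorem add_ofReal_mem_HH {Z : H3 ℂ} (hZ : Z ∈ HH α β) (X : H3 ℝ) :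
    (Z + fun k => (X k : ℂ)) ∈ HH α β :=
  add_ofReal_mem_tube (Ω := {Y : H3 ℝ | PosDefH α β Y}) hZ X

theorem periodic_rescaled (hT : 0 < T)
    (hper : ∀ Z ∈ HH α β, ∀ k, F (Z + Pi.single k (T : ℂ)) = F Z) (m : HIdx → ℤ) :
    ∀ Z ∈ HH α β, F ((T : ℂ) • (Z + fun k => (m k : ℂ))) = F ((T : ℂ) • Z) := by
  refine periodic_int (Ω := {Y : H3 ℝ | PosDefH α β Y}) (F := fun Z => F ((T : ℂ) • Z))
    (fun Z hZ k => ?_) m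
  have hZ' : (T : ℂ) • Z ∈ HH α β := by
    simpa using smul_mem_HH (α := α) (β := β) hZ (t := (T : ℝ)) (Nat.cast_pos.2 hT)
  rw [← hper _ hZ' k]
  congr 1
  funext j
  by_cases hj : j = k
  · subst hj; simp [mul_add]
  · simp [hj]

theorem periodic_lattice (hT : 0 < T)
    (hper : ∀ Z ∈ HH α β, ∀ k, F (Z + Pi.single k (T : ℂ)) = F Z) (m : HIdx → ℤ) :
    ∀ Z ∈ HH α β, F (Z + fun k => (T : ℂ) * m k) = F Z := by
  intro Z hZ
  have hTC : (T : ℂ) ≠ 0 := Nat.cast_ne_zero.2 hT.ne'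
  have hZ' : (T : ℂ)⁻¹ • Z ∈ HH α β := by
    simpa using smul_mem_HH hZ (t := (T : ℝ)⁻¹) (by positivity)
  have h := periodic_rescaled hT hper m _ hZ'
  rw [smul_add, smul_inv_smul₀ hTC] at h
  exact h

/-- The Hermitian matrix with given integral coordinates in the lattice dual to `Tℤ^15`. -/
def dualLattice (α β : ℚ) (T : ℕ) (m : HIdx → ℤ) : H3 ℚ := fun k => m k / (T * pairWeight α β k)

theorem dualLattice_injective (hα : α < 0) (hβ : β < 0) (hT : 0 < T) :
    Function.Injective (dualLattice α β T) := by
  intro m m' h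
  funext k
  have h₁ : (T : ℚ) * pairWeight α β k ≠ 0 :=
    mul_ne_zero (Nat.cast_ne_zero.2 hT.ne') (pairWeight_pos hα hβ k).ne'
  have := congrFun h k
  simp only [dualLattice] at this
  rw [div_left_inj' h₁] at this
  exact_mod_cast this

theorem iH_mem_HH (hα : α < 0) (hβ : β < 0) : iH ∈ HH α β := by
  have h := siegelEmb_mem_HH hα hβ (z := Complex.I • (1 : Matrix (Fin 3) (Fin 3) ℂ)) ⟨by
    rw [Matrix.IsSymm, Matrix.transpose_smul, Matrix.transpose_one], by
    have : (Complex.I • (1 : Matrix (Fin 3) (Fin 3) ℂ)).map Complex.im = 1 := by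
      ext i j
      by_cases hij : i = j
      · subst hij; simp
      · simp [hij]
    rw [this]
    exact Matrix.PosDef.one⟩
  convert h using 1
  funext k
  rcases k with k | ⟨i, l⟩
  · simp [iH, siegelEmb]
  · fin_cases i <;> simp [iH, siegelEmb]

/-- Existence of the Fourier expansion of a periodic holomorphic function. -/
theorem exists_fourierExpansion (hα : α < 0) (hβ : β < 0) (hF : DifferentiableOn ℂ F (HH α β))
    (hT : 0 < T) (hper : ∀ Z ∈ HH α β, ∀ k, F (Z + Pi.single k (T : ℂ)) = F Z) :
    ∃ aF, IsFourierExpansion α β F aF ∧ ∀ h, aF h ≠ 0 → h ∈ Set.range (dualLattice α β T) := by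
  have hTC : (T : ℂ) ≠ 0 := Nat.cast_ne_zero.2 hT.ne'
  have hinj := dualLattice_injective hα hβ hT
  have hF' : DifferentiableOn ℂ (fun Z : H3 ℂ => F ((T : ℂ) • Z))
      (tube {Y : H3 ℝ | PosDefH α β Y}) :=
    hF.comp (f := fun Z : H3 ℂ => (T : ℂ) • Z) (by fun_prop) fun Z hZ => by
      simpa using smul_mem_HH (α := α) (β := β) hZ (t := (T : ℝ)) (Nat.cast_pos.2 hT)
  have hsum := hasSum_fourier_tube hF' isOpen_posDefH (periodic_rescaled hT hper) convex_posDefH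
    iH (iH_mem_HH hα hβ)
  set c := fun m => periodIntegral (fun Z : H3 ℂ => F ((T : ℂ) • Z)) m iH with hc
  -- The function `F(TZ)` has period `1`. The weights in `dualLattice` turn `tr(Z, h)` into `∑ m_k
  -- Z_k / T`, and the coefficients are extended by zero off the dual lattice.
  refine ⟨Function.extend (dualLattice α β T) c 0, fun Z hZ => ?_, fun h hh => ?_⟩
  · have hZ' : (T : ℂ)⁻¹ • Z ∈ HH α β := by
      simpa using smul_mem_HH hZ (t := (T : ℝ)⁻¹) (by positivity)
    have := hsum _ hZ'
    simp only [smul_inv_smul₀ hTC] at this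
    rw [← hinj.hasSum_iff (fun h hh => by
      rw [Function.extend_apply' _ _ _ (by simpa using hh), Pi.zero_apply, zero_mul])]
    convert this using 1
    funext m
    rw [Function.comp_apply, hinj.extend_apply, expChar, trPair_eq_sum]
    congr 3
    refine Finset.sum_congr rfl fun k _ => ?_
    have h₁ : ((pairWeight α β k : ℚ) : ℂ) ≠ 0 :=
      Rat.cast_ne_zero.2 (pairWeight_pos hα hβ k).ne'
    simp only [dualLattice, Pi.smul_apply, smul_eq_mul]
    push_cast
    field_simp
  · by_contra hn
    exact hh (by rw [Function.extend_apply' _ _ _ (by simpa using hn), Pi.zero_apply])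

end Periodic

/-! ### Bounds for single coefficients, and uniqueness of the expansions. -/

section Uniqueness

variable {F : H3 ℂ → ℂ} {aF aF' : H3 ℚ → ℂ}

/-- Averaging over real shifts of one point `Z`. The bound `C = 0` gives uniqueness, and the bounds
along a ray control the support. -/
theorem norm_coeff_le (hα : α < 0) (hβ : β < 0) (hexp : IsFourierExpansion α β F aF)
    {Z : H3 ℂ} (hZ : Z ∈ HH α β) {C : ℝ} (hC : ∀ X : H3 ℝ, ‖F (Z + fun k => (X k : ℂ))‖ ≤ C)
    (h₀ : H3 ℚ) : ‖aF h₀ * Complex.exp (2 * Real.pi * Complex.I *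
      trPair α β Z (fun k => ((h₀ k : ℚ) : ℂ)))‖ ≤ C := by
  obtain ⟨X, hX⟩ := exists_generic_direction HIdx
  refine norm_coeff_le_of_hasSum hX (q := fun (h : H3 ℚ) k => pairWeight α β k * h k)
    (b := fun h => aF h * Complex.exp (2 * Real.pi * Complex.I *
      trPair α β Z (fun k => ((h k : ℚ) : ℂ))))
    (s := fun n => F (Z + fun k => ((n * X k : ℝ) : ℂ))) (fun h h' e => ?_) (fun n => ?_)
    (fun n => hC _) h₀
  · funext k
    exact mul_left_cancel₀ (pairWeight_pos hα hβ k).ne' (congrFun e k)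
  · convert hexp _ (add_ofReal_mem_HH hZ fun k => n * X k) using 1
    funext h
    rw [mul_assoc, ← Complex.exp_add, trPair_add_left, ← mul_add]
    congr 4
    rw [trPair_eq_sum, Finset.mul_sum]
    refine Finset.sum_congr rfl fun k _ => ?_
    push_cast
    ring

theorem IsFourierExpansion.unique (hα : α < 0) (hβ : β < 0) (h : IsFourierExpansion α β F aF)
    (h' : IsFourierExpansion α β F aF') : aF = aF' := by
  have h0 : IsFourierExpansion α β (fun _ => 0) (aF - aF') := fun Z hZ => by
    simpa [sub_mul] using (h Z hZ).sub (h' Z hZ)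
  funext k
  have := norm_coeff_le hα hβ h0 (iH_mem_HH hα hβ) (C := 0) (fun X => by simp) k
  rw [norm_le_zero_iff, mul_eq_zero, or_iff_left (Complex.exp_ne_zero _)] at this
  exact sub_eq_zero.1 this

/-- The same averaging, started at `i`. For `α = β = -1` the weights are `1` on the diagonal and `2`
on the real parts off it, as in the trace of a product of symmetric matrices; so a generic direction
for `HIdx` serves here, through `ofSym`. -/
theorem IsSiegelFourierExpansion.unique {f : Matrix (Fin 3) (Fin 3) ℂ → ℂ} {af af' : Sym3 → ℂ}
    (h : IsSiegelFourierExpansion f af) (h' : IsSiegelFourierExpansion f af') : af = af' := by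
  obtain ⟨X, hX⟩ := exists_generic_direction HIdx
  set Xm : Matrix (Fin 3) (Fin 3) ℝ :=
    !![X (Sum.inl 0), X (Sum.inr (2, 0)), X (Sum.inr (1, 0));
       X (Sum.inr (2, 0)), X (Sum.inl 1), X (Sum.inr (0, 0));
       X (Sum.inr (1, 0)), X (Sum.inr (0, 0)), X (Sum.inl 2)] with hXm
  have hXs : ∀ i j, Xm i j = Xm j i := fun i j => by fin_cases i <;> fin_cases j <;> rfl
  set z : ℕ → Matrix (Fin 3) (Fin 3) ℂ := fun n => Complex.I • 1 + (n : ℂ) • Xm.map Complex.ofReal with hz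
  have hmem : ∀ n, z n ∈ Siegel := fun n => by
    constructor
    · ext i j
      simp [hz, hXs i j, Matrix.one_apply, eq_comm]
    · have : (z n).map Complex.im = 1 := by
        ext i j
        by_cases hij : i = j
        · subst hij; simp [hz]
        · simp [hz, hij]
      rw [this]
      exact Matrix.PosDef.one
  have hw : ∀ k, pairWeight (-1) (-1) k ≠ 0 := fun k =>
    (pairWeight_pos (by norm_num) (by norm_num) k).ne'
  have htr : ∀ T : Sym3, Matrix.trace (T.1.map (fun q : ℚ => (q : ℂ)) * Xm.map Complex.ofReal) =
      ∑ k, ((pairWeight (-1) (-1) k * ofSym T k : ℚ) : ℂ) * (X k : ℂ) := fun T => by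
    have hT : ∀ i j, T.1 i j = T.1 j i := fun i j => (T.2.apply i j).symm
    rw [Fintype.sum_sum_type, Fintype.sum_prod_type]
    simp [Fin.sum_univ_three, Fin.sum_univ_four, pairWeight, ofSym, Matrix.trace, Matrix.mul_apply, hXm, hT 1 0,
      hT 2 1, hT 0 2]
    ring
  funext T₀
  have := norm_coeff_le_of_hasSum hX
    (q := fun (T : Sym3) k => pairWeight (-1) (-1) k * ofSym T k)
    (b := fun T => (af T - af' T) * Complex.exp (2 * Real.pi * Complex.I *
      Matrix.trace (T.1.map (fun q : ℚ => (q : ℂ)) * z 0)))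
    (s := fun _ => 0) (fun T T' e => ofSym_injective ?_) (fun n => ?_) (C := 0)
    (fun n => by simp) T₀
  · rw [norm_le_zero_iff, mul_eq_zero, or_iff_left (Complex.exp_ne_zero _)] at this
    exact sub_eq_zero.1 this
  · funext k
    exact mul_left_cancel₀ (hw k) (congrFun e k)
  · have hd := (h _ (hmem n)).sub (h' _ (hmem n))
    rw [sub_self] at hd
    refine Eq.subst (motive := fun t => HasSum t 0) (funext fun T => Eq.symm ?_) hd
    rw [← sub_mul, mul_assoc, ← Complex.exp_add, ← htr, ← mul_add]
    have hzn : Matrix.trace (T.1.map (fun q : ℚ => (q : ℂ)) * z n) =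
        Matrix.trace (T.1.map (fun q : ℚ => (q : ℂ)) * z 0) +
          n * Matrix.trace (T.1.map (fun q : ℚ => (q : ℂ)) * Xm.map Complex.ofReal) := by
      simp [hz, mul_add]
    rw [hzn]

end Uniqueness

/-! ### Positivity on the support and finiteness of the fibres. -/

section Support

variable {F : H3 ℂ → ℂ} {aF : H3 ℚ → ℂ}

theorem exp_growth_contradiction {a C K τ : ℝ} (ha : 0 < a) (hC : 0 ≤ C) (hK : 0 ≤ K) (hτ : 0 < τ)
    (h : ∀ s, 0 ≤ s → a * Real.exp (τ * Real.exp (2 * s)) ≤ C * Real.exp (K * s)) : False := by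
  -- The first summand gives `τ s ≥ K + 1`, so that `τ e^{2s} ≥ τ s² ≥ Ks + s` and `a e^s ≤ C`. Then
  -- `s + 1 ≤ C / a`, against the second summand.
  set s := (K + 1) / τ + C / a with hs
  have h₁ : 0 ≤ (K + 1) / τ := by positivity
  have h₂ : 0 ≤ C / a := by positivity
  have hs0 : 0 ≤ s := add_nonneg h₁ h₂
  have h₃ := h s hs0
  have h₄ : K * s + s ≤ τ * Real.exp (2 * s) := by
    have e₁ : s ^ 2 ≤ Real.exp (2 * s) := by
      rw [two_mul, Real.exp_add, ← pow_two]
      exact pow_le_pow_left₀ hs0 ((by linarith : s ≤ s + 1).trans (Real.add_one_le_exp s)) 2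
    have e₂ : K + 1 ≤ τ * s := by
      rw [hs, mul_add, mul_div_cancel₀ _ hτ.ne']
      nlinarith
    nlinarith
  have h₅ : a * Real.exp s ≤ C := by
    have : a * Real.exp (K * s + s) ≤ C * Real.exp (K * s) :=
      (mul_le_mul_of_nonneg_left (Real.exp_le_exp.2 h₄) ha.le).trans h₃
    rw [Real.exp_add] at this
    have hp := Real.exp_pos (K * s)
    nlinarith
  have h₆ : s + 1 ≤ C / a := by
    rw [le_div_iff₀ ha, mul_comm]
    exact (mul_le_mul_of_nonneg_left (Real.add_one_le_exp s) ha.le).trans h₅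
  linarith

/-- Nonzero Fourier coefficients of a modular form pair nonnegatively with the test points. -/
theorem IsModularForm.trPair_testIm_nonneg (hα : α < 0) (hβ : β < 0) {r : ℕ}
    {Γ : Subgroup (GLW ℝ)} (hF : IsModularForm α β r Γ F) {T : ℕ} (hT : 0 < T)
    (hper : ∀ Z ∈ HH α β, ∀ k, F (Z + Pi.single k (T : ℂ)) = F Z)
    (hexp : IsFourierExpansion α β F aF) {h : H3 ℚ} (hh : aF h ≠ 0) (i : Fin 3) {u : Fin 4 → ℝ}
    {n : ℝ} (hn : n = u 0 ^ 2 - α * u 1 ^ 2 - β * u 2 ^ 2 + α * β * u 3 ^ 2) :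
    0 ≤ ∑ k, (pairWeight α β k : ℝ) * testIm i u n k * h k := by
  have hA : normN α β (iH + fun k => (testShift i u k : ℂ)) ≠ 0 := by
    rw [normN_testShift i hn]
    exact mul_ne_zero one_add_I_ne_zero (two_I_sub_ne_zero n)
  have hY := posDefH_testIm i hn hα hβ
  have hN : normN α β (testIm i u n) ≠ 0 := by
    rw [normN_testIm i hn]
    positivity
  obtain ⟨C, K, hC, hK, hg⟩ := hF.growth_on_ray hT (periodic_lattice hT hper) hA
    (neg_inv_testShift i hn) hY hN
  by_contra! hneg
  -- At the point `i e^{2s}Y₀` the exponential with index `h` has modulus `exp(-2π e^{2s} tr(Y₀,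
  -- h))`.
  refine exp_growth_contradiction (norm_pos_iff.2 hh) hC hK
    (τ := 2 * Real.pi * -∑ k, (pairWeight α β k : ℝ) * testIm i u n k * h k)
    (by have := Real.pi_pos; have := neg_pos.2 hneg; positivity) fun s hs => ?_
  set Z : H3 ℂ := fun k => ((Real.exp (2 * s) * testIm i u n k : ℝ) : ℂ) * Complex.I with hZdef
  have hZ : Z ∈ HH α β := by
    change PosDefH α β _
    convert hY.smul (Real.exp_pos (2 * s)) using 1
    funext k
    simp [imH, hZdef, -Complex.ofReal_mul, -Complex.ofReal_exp]
  have hb := norm_coeff_le hα hβ hexp hZ (C := C * Real.exp (K * s)) (fun X => by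
    rw [add_comm]
    exact hg s hs X) h
  rw [norm_mul, Complex.norm_exp] at hb
  convert hb using 3
  have : 2 * (Real.pi : ℂ) * Complex.I * trPair α β Z (fun k => ((h k : ℚ) : ℂ)) =
      ((2 * Real.pi * (-∑ k, (pairWeight α β k : ℝ) * testIm i u n k * h k) *
        Real.exp (2 * s) : ℝ) : ℂ) := by
    rw [trPair_eq_sum]
    push_cast
    rw [← Finset.sum_neg_distrib, Finset.mul_sum, Finset.mul_sum, Finset.sum_mul]
    refine Finset.sum_congr rfl fun k _ => ?_
    simp only [hZdef]
    push_cast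
    linear_combination (2 * Real.pi * (pairWeight α β k : ℂ) * Complex.exp (2 * s) *
      (testIm i u n k : ℂ) * (h k : ℂ)) * Complex.I_sq
  rw [this, Complex.ofReal_re]

theorem finite_bounded_multiples (c : ℚ) (R : ℝ) :
    {q : ℚ | (∃ m : ℤ, q = m / c) ∧ |(q : ℝ)| ≤ R}.Finite := by
  -- Division by zero gives zero, so the set is then contained in `{0}`.
  by_cases hc : c = 0
  · refine (Set.finite_singleton (0 : ℚ)).subset ?_
    rintro q ⟨⟨m, rfl⟩, -⟩
    simp [hc]
  have hc' : (0 : ℝ) < |(c : ℝ)| := abs_pos.2 (Rat.cast_ne_zero.2 hc)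
  refine ((Set.finite_Icc (-⌈R * |(c : ℝ)|⌉) ⌈R * |(c : ℝ)|⌉).image fun m : ℤ => (m / c : ℚ)).subset ?_
  rintro q ⟨⟨m, rfl⟩, hq⟩
  refine ⟨m, ?_, rfl⟩
  push_cast at hq
  rw [abs_div, div_le_iff₀ hc'] at hq
  have h := abs_le.1 (hq.trans (Int.le_ceil _))
  constructor
  · have := h.1
    exact_mod_cast this
  · exact_mod_cast h.2

/-- Only finitely many nonzero Fourier coefficients of a modular form restrict to a given index. -/
theorem IsModularForm.finite_fiber (hα : α < 0) (hβ : β < 0) {r : ℕ}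
    {Γ : Subgroup (GLW ℝ)} (hF : IsModularForm α β r Γ F) {N : ℕ} (hN : 0 < N)
    (hper : ∀ Z ∈ HH α β, ∀ k, F (Z + Pi.single k (N : ℂ)) = F Z)
    (hexp : IsFourierExpansion α β F aF)
    (hsupp : ∀ h, aF h ≠ 0 → h ∈ Set.range (dualLattice α β N)) (T : Sym3) :
    {h | symPart h = T ∧ aF h ≠ 0}.Finite := by
  have hbound : ∀ k, ∃ R : ℝ, ∀ h, symPart h = T → aF h ≠ 0 → |((h k : ℚ) : ℝ)| ≤ R := by
    have hdiag : ∀ h, symPart h = T → ∀ j, h (Sum.inl j) = T.1 j j := by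
      rintro h rfl j
      fin_cases j <;> rfl
    rintro (j | ⟨i, l⟩)
    · exact ⟨|((T.1 j j : ℚ) : ℝ)|, fun h hT _ => by rw [hdiag h hT]⟩
    · set n : ℝ := (Pi.single l 1 : Fin 4 → ℝ) 0 ^ 2 - α * (Pi.single l 1 : Fin 4 → ℝ) 1 ^ 2
        - β * (Pi.single l 1 : Fin 4 → ℝ) 2 ^ 2 + α * β * (Pi.single l 1 : Fin 4 → ℝ) 3 ^ 2 with hn
      set w : ℝ := (pairWeight α β (Sum.inr (i, l)) : ℝ) with hwdef
      have hw : 0 < w := Rat.cast_pos.2 (pairWeight_pos hα hβ _)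
      set D : ℝ := ∑ j, testIm i (Pi.single l 1) n (Sum.inl j) * (T.1 j j : ℝ) with hD
      have h₄ : 0 < n ^ 2 + 4 := by positivity
      refine ⟨D * (n ^ 2 + 4) / (2 * w), fun h hT hh => ?_⟩
      -- The vectors `±e_l` have the same norm `n` and hence test matrices that differ only in the
      -- sign of the off-diagonal entry. The diagonal contributes `D`, fixed by `T`; the two signs
      -- bound the coordinate from both sides.
      have key : ∀ ε : ℝ, ε ^ 2 = 1 → 0 ≤ D + w * (-2 * ε / (n ^ 2 + 4)) * h (Sum.inr (i, l)) := by
        intro ε hε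
        have hn' : n = (ε • Pi.single l 1 : Fin 4 → ℝ) 0 ^ 2
            - α * (ε • Pi.single l 1 : Fin 4 → ℝ) 1 ^ 2
            - β * (ε • Pi.single l 1 : Fin 4 → ℝ) 2 ^ 2
            + α * β * (ε • Pi.single l 1 : Fin 4 → ℝ) 3 ^ 2 := by
          simp only [Pi.smul_apply, smul_eq_mul, mul_pow, hε, one_mul]
          exact hn
        have h0 := hF.trPair_testIm_nonneg hα hβ hN hper hexp hh i hn'
        rw [Fintype.sum_sum_type] at h0
        have e₁ : ∑ j, ((pairWeight α β (Sum.inl j) : ℚ) : ℝ) *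
            testIm i (ε • Pi.single l 1) n (Sum.inl j) * h (Sum.inl j) = D := by
          refine Finset.sum_congr rfl fun j _ => ?_
          rw [hdiag h hT]
          simp [pairWeight, testIm]
        have e₂ : ∑ p : Fin 3 × Fin 4, ((pairWeight α β (Sum.inr p) : ℚ) : ℝ) *
            testIm i (ε • Pi.single l 1) n (Sum.inr p) * h (Sum.inr p) =
            w * (-2 * ε / (n ^ 2 + 4)) * h (Sum.inr (i, l)) := by
          rw [Finset.sum_eq_single (i, l)]
          · simp [testIm, hwdef]
          · rintro ⟨i', l'⟩ - hne
            by_cases hi : i' = i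
            · have hl : l' ≠ l := fun hl => hne (by rw [hi, hl])
              simp [testIm, hl]
            · simp [testIm, hi]
          · simp
        rw [e₁, e₂] at h0
        exact h0
      have k₁ := key 1 (by norm_num)
      have k₂ := key (-1) (by norm_num)
      rw [le_div_iff₀ (by positivity), ← abs_of_pos (by positivity : (0 : ℝ) < 2 * w), ← abs_mul,
        abs_le]
      have hx : ∀ y : ℝ, D + w * (y / (n ^ 2 + 4)) * h (Sum.inr (i, l)) =
          (D * (n ^ 2 + 4) + w * y * h (Sum.inr (i, l))) / (n ^ 2 + 4) := fun y => by
        field_simp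
      rw [hx, le_div_iff₀ h₄, zero_mul] at k₁ k₂
      constructor <;> linarith
  choose R hR using hbound
  -- Each coordinate of `h` is bounded and, on the dual lattice, has a fixed denominator.
  refine (Set.Finite.pi' fun k => finite_bounded_multiples (N * pairWeight α β k) (R k)).subset ?_
  rintro h ⟨hT, hh⟩ k
  obtain ⟨m, rfl⟩ := hsupp h hh
  exact ⟨⟨m k, rfl⟩, hR k _ hT hh⟩

/-- The Fourier expansion of the restriction to the Siegel upper half space. -/
theorem IsFourierExpansion.restrict (hα : α < 0) (hβ : β < 0) (hexp : IsFourierExpansion α β F aF) :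
    IsSiegelFourierExpansion (restrict F)
      fun T => ∑' h : {h : H3 ℚ // symPart h = T}, aF h := by
  intro z hz
  have h := hexp _ (siegelEmb_mem_HH hα hβ hz)
  rw [← (Equiv.sigmaFiberEquiv symPart).hasSum_iff] at h
  refine h.sigma fun T => ?_
  have hs := h.summable.sigma_factor T
  have e : ∀ x : {h : H3 ℚ // symPart h = T}, trPair α β (siegelEmb z)
      (fun k => (((x : H3 ℚ) k : ℚ) : ℂ)) = Matrix.trace (T.1.map (fun q : ℚ => (q : ℂ)) * z) :=
    fun x => by rw [trPair_siegelEmb hz.1, x.2]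
  simp only [Function.comp_apply, Equiv.sigmaFiberEquiv_apply, e] at hs ⊢
  -- On a fibre the exponential is constant and nonzero, so the coefficients themselves are summable
  -- there.
  rw [summable_mul_right_iff (Complex.exp_ne_zero _)] at hs
  exact hs.hasSum.mul_right _

end Support

end QuatG

end

theorem proposition4p8 (α β : ℚ) (hα : α < 0) (hβ : β < 0)
    (B₀ : Subring (QuatG.Quat α β ℚ)) (hB₀ : QuatG.IsMaximalOrder B₀)
    (M : ℕ) (hM : 0 < M) (Γ : Subgroup (QuatG.GLW ℝ))
    (hΓ : QuatG.IsCongruenceSubgroup B₀ M Γ)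
    (r : ℕ) (F : QuatG.H3 ℂ → ℂ) (hF : QuatG.IsModularForm α β r Γ F) :
    (∃ aF, QuatG.IsFourierExpansion α β F aF) ∧
    (∃ af, QuatG.IsSiegelFourierExpansion (QuatG.restrict F) af) ∧
    ∀ (aF : QuatG.H3 ℚ → ℂ) (af : QuatG.Sym3 → ℂ),
      QuatG.IsFourierExpansion α β F aF →
      QuatG.IsSiegelFourierExpansion (QuatG.restrict F) af →
      ∀ T : QuatG.Sym3, ∃ c : QuatG.H3 ℚ →₀ ℤ, af T = c.sum (fun h n => (n : ℂ) * aF h) := by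
  obtain ⟨N, hN, hper⟩ := hF.exists_period hB₀.prop hM hΓ
  obtain ⟨a, ha, hsupp⟩ := QuatG.exists_fourierExpansion hα hβ hF.holomorphic hN hper
  refine ⟨⟨a, ha⟩, ⟨_, ha.restrict hα hβ⟩, fun aF af haF haf T => ?_⟩
  obtain rfl := ha.unique hα hβ haF
  obtain rfl := haf.unique (ha.restrict hα hβ)
  have hfin := hF.finite_fiber hα hβ hN hper ha hsupp T
  -- By uniqueness `af T` is the sum of `a` over the fibre of `T`, so all multiplicities are `1`.
  refine ⟨Finsupp.indicator hfin.toFinset fun _ _ => 1, ?_⟩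
  rw [Finsupp.sum_indicator_index _ (by simp)]
  simp only [Int.cast_one, one_mul]
  refine (tsum_subtype {h | QuatG.symPart h = T} a).trans ?_
  rw [tsum_eq_sum (s := hfin.toFinset) fun h hh => ?_]
  · exact Finset.sum_congr rfl fun h hh => Set.indicator_of_mem
      (show h ∈ {h | QuatG.symPart h = T} from (hfin.mem_toFinset.1 hh).1) a
  · by_contra hne
    exact hh (hfin.mem_toFinset.2 (Set.indicator_apply_ne_zero.1 hne))
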